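/- Let $E\to X$ be a smooth real vector bundle of finite rank over a smooth (Hausdorff, $\sigma$-compact, finite-dimensional, possibly with boundary or corners) manifold $X$, with dual bundle $E^*$, and let $\mu=(\mu_x)_{x\in X}$ be a smooth Haar system on $E$, i.e. a family of Lebesgue measures $\mu_x$ on the fibres $E_x$ given by a smooth positive section of the bundle of $1$-densities. Let $\mathscr S(E)$ be the space of smooth functions $f:E\to\mathbb C$ that vanish outside the part of $E$ over some compact subset of $X$ and such that, in every local trivialization $V\times\mathbb R^q$ of $E$ over a chart domain $V$ of $X$, for every compact $K\subset V$, every $k\in\mathbb N$ and all multi-indices $l,\alpha$, $$\sup_{x\in K,\ v\in\mathbb R^q}\|v\|^k\,|\partial_x^l\partial_v^\alpha f(x,v)|<\infty .$$ (So $\mathscr S(X\times\mathbb R^q)=C_c^\infty(X,\mathscr S(\mathbb R^q))$ for a trivial bundle.) Let $\mathscr S(E^*)$ be defined in the same way, and put $$(f*g)(x,v)=\int_{E_x}f(x,v-w)\,g(x,w)\,d\mu_x(w),\qquad (\mathscr F f)(x,\xi)=\int_{E_x}e^{-i\xi(v)}f(x,v)\,d\mu_x(v)\quad(\xi\in E_x^*).$$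 (i) $(\mathscr S(E),*)$ is an associative complex algebra, and $\mathscr F$ is an isomorphism of algebras from $(\mathscr S(E),*)$ onto $\mathscr S(E^*)$ with the pointwise product. (ii) $\mathscr S(E^*)\subset C_0(E^*)$, and via $\mathscr F$ the algebra $\mathscr S(E)$ is stable under holomorphic functional calculus in $C_0(E^*)$. That is, writing $A=\mathscr F(\mathscr S(E))$, $B=C_0(E^*)$, and $A^+\subset B^+$ for the algebras with adjoined unit: for all $n$, all $a\in M_n(A^+)$ and all $f$ holomorphic on an open neighbourhood of the spectrum of $a$ in $M_n(B^+)$, the element $f(a)=\frac1{2\pi i}\oint f(z)(z-a)^{-1}dz$ of $M_n(B^+)$ (integral over any contour in the neighbourhood surrounding the spectrum) belongs to $M_n(A^+)$. In particular, for $g\in A$ and $\varphi$ holomorphic on an open set containing $g(E^*)\cup\{0\}$ with $\varphi(0)=0$, one has $\varphi\circ g\in A$. Moreover the homomorphism $\mathscr S(E)\to C_0(E^*)$ given by $\mathscr F$ induces an isomorphism $$K_0(\mathscr S(E))\;\cong\;K_0(C_0(E^*))=K^0(E^*),$$ where $K_0$ of a complex algebra $A$ without unit is $\ker(K_0(A^+)\to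 K_0(\mathbb C))$. -/

import Mathlib

open scoped Manifold ContDiff Bundle ZeroAtInfty
open Bundle Set MeasureTheory

noncomputable section

set_option linter.unusedSectionVars false

/-! ### Schwartz functions on the total space of a vector bundle -/

section SchwartzBundle

variable {EB : Type*} [NormedAddCommGroup EB] [NormedSpace ℝ EB]
  {HB : Type*} [TopologicalSpace HB] (I : ModelWithCorners ℝ EB HB)
  {X : Type*} [TopologicalSpace X] [ChartedSpace HB X]
  (F : Type*) [NormedAddCommGroup F] [NormedSpace ℝ F]
  (E : X → Type*) [∀ x, AddCommGroup (E x)] [∀ x, Module ℝ (E x)]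
  [∀ x, TopologicalSpace (E x)] [TopologicalSpace (TotalSpace F E)]
  [FiberBundle F E] [VectorBundle ℝ F E]

/-- The image in the model space of the domain around `x₀` on which both the chart of `X` and the
trivialization of `E` at `x₀` are defined. -/
def bundleChartDomain (x₀ : X) : Set EB :=
  (extChartAt I x₀).target ∩ (extChartAt I x₀).symm ⁻¹' (trivializationAt F E x₀).baseSet

variable {F E} in
/-- A function on the total space `E`, written in the chart of `X` and the trivialization of `E`
at `x₀`, as a function of `(y, v)` with `y` in `bundleChartDomain I F E x₀` and `v ∈ F`. -/
def bundleLocalRep (f : TotalSpace F E → ℂ) (x₀ : X) : EB × F → ℂ := fun p =>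
  f ((trivializationAt F E x₀).toOpenPartialHomeomorph.symm ((extChartAt I x₀).symm p.1, p.2))

variable {F E} in
/-- `f` belongs to the Schwartz space of the bundle: it is smooth, its support is contained in the
part of the total space lying over a compact subset of the base, and in every trivializing chart
all its derivatives decrease rapidly along the fibres, uniformly over compact sets of the base. -/
structure IsBundleSchwartz (f : TotalSpace F E → ℂ) : Prop where
  smooth : ContMDiff (I.prod 𝓘(ℝ, F)) 𝓘(ℝ, ℂ) ∞ f
  support : ∃ K : Set X, IsCompact K ∧ ∀ p : TotalSpace F E, p.proj ∉ K → f p = 0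
  decay : ∀ (x₀ : X) (K : Set EB), IsCompact K → K ⊆ bundleChartDomain I F E x₀ →
    ∀ k n : ℕ, ∃ C : ℝ, ∀ y ∈ K, ∀ v : F,
      ‖v‖ ^ k * ‖iteratedFDerivWithin ℝ n (bundleLocalRep I f x₀)
        (bundleChartDomain I F E x₀ ×ˢ univ) (y, v)‖ ≤ C

theorem bundleChartDomain_uniqueDiffOn (x₀ : X) :
    UniqueDiffOn ℝ (bundleChartDomain I F E x₀) := by
  have h1 : bundleChartDomain I F E x₀ = (extChartAt I x₀).target ∩ (extChartAt I x₀).symm ⁻¹'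
      ((trivializationAt F E x₀).baseSet) := rfl
  rw [h1, ← image_id ((extChartAt I x₀).target ∩ _)]
  simp only [image_id]
  have : (extChartAt I x₀).target ∩ (extChartAt I x₀).symm ⁻¹' (trivializationAt F E x₀).baseSet
      = range I ∩ ((chartAt HB x₀).extend I).target ∩ I.symm ⁻¹'
        ((chartAt HB x₀).target ∩ (chartAt HB x₀).symm ⁻¹' (trivializationAt F E x₀).baseSet) := by
    ext y
    simp only [extChartAt, mem_inter_iff, mem_preimage, OpenPartialHomeomorph.extend_target',
      OpenPartialHomeomorph.extend_coe_symm, Function.comp_apply]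
    constructor
    · rintro ⟨⟨z, hz, rfl⟩, h⟩
      simp only [ModelWithCorners.left_inv] at h ⊢
      exact ⟨⟨mem_range_self z, ⟨z, hz, rfl⟩⟩, hz, h⟩
    · rintro ⟨⟨_, hz⟩, _, h⟩
      exact ⟨hz, h⟩
  rw [this]
  have h2 : range I ∩ ((chartAt HB x₀).extend I).target ∩ I.symm ⁻¹'
        ((chartAt HB x₀).target ∩ (chartAt HB x₀).symm ⁻¹' (trivializationAt F E x₀).baseSet)
      = range I ∩ I.symm ⁻¹'
        ((chartAt HB x₀).target ∩ (chartAt HB x₀).symm ⁻¹' (trivializationAt F E x₀).baseSet) := by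
    ext y
    simp only [mem_inter_iff, mem_preimage, OpenPartialHomeomorph.extend_target']
    constructor
    · rintro ⟨⟨h, _⟩, h'⟩
      exact ⟨h, h'⟩
    · rintro ⟨⟨z, rfl⟩, h'⟩
      refine ⟨⟨mem_range_self z, z, ?_, rfl⟩, h'⟩
      simpa using h'.1
  rw [h2]
  refine I.uniqueDiffOn.inter (IsOpen.preimage I.continuous_symm ?_)
  exact (chartAt HB x₀).symm.isOpen_inter_preimage (trivializationAt F E x₀).open_baseSet

theorem bundleChartDomain_prod_uniqueDiffOn (x₀ : X) :
    UniqueDiffOn ℝ (bundleChartDomain I F E x₀ ×ˢ (univ : Set F)) :=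
  (bundleChartDomain_uniqueDiffOn I F E x₀).prod uniqueDiffOn_univ

variable {F E} in
theorem bundleLocalRep_contDiffOn [IsManifold I ∞ X] [ContMDiffVectorBundle ∞ F E I]
    {f : TotalSpace F E → ℂ} (hf : ContMDiff (I.prod 𝓘(ℝ, F)) 𝓘(ℝ, ℂ) ∞ f) (x₀ : X) :
    ContDiffOn ℝ ∞ (bundleLocalRep I f x₀) (bundleChartDomain I F E x₀ ×ˢ univ) := by
  have h1 : ContMDiffOn (𝓘(ℝ, EB).prod 𝓘(ℝ, F)) (I.prod 𝓘(ℝ, F)) ∞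
      (fun p : EB × F => ((extChartAt I x₀).symm p.1, p.2))
      (bundleChartDomain I F E x₀ ×ˢ univ) := by
    refine ContMDiffOn.prodMk ?_ contMDiffOn_snd
    exact (contMDiffOn_extChartAt_symm x₀).comp contMDiffOn_fst (fun p hp => hp.1.1)
  have h2 := (Bundle.Trivialization.contMDiffOn_symm (IB := I) (n := ∞)
    (trivializationAt F E x₀)).comp h1
    (fun p hp => (trivializationAt F E x₀).mem_target.2 hp.1.2)
  have h3 : ContMDiffOn (𝓘(ℝ, EB).prod 𝓘(ℝ, F)) 𝓘(ℝ, ℂ) ∞ (bundleLocalRep I f x₀)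
      (bundleChartDomain I F E x₀ ×ˢ univ) := hf.comp_contMDiffOn h2
  rw [← modelWithCornersSelf_prod, chartedSpaceSelf_prod] at h3
  exact h3.contDiffOn

namespace IsBundleSchwartz

variable {F E}

theorem zero : IsBundleSchwartz I (0 : TotalSpace F E → ℂ) where
  smooth := contMDiff_const
  support := ⟨∅, isCompact_empty, fun _ _ => rfl⟩
  decay := by
    intro x₀ K _ hK k n
    refine ⟨0, fun y hy v => ?_⟩
    have h : bundleLocalRep I (0 : TotalSpace F E → ℂ) x₀ = fun _ => 0 := rfl
    have h' : iteratedFDerivWithin ℝ n (fun _ : EB × F => (0 : ℂ)) = 0 := by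
      ext1 s
      exact iteratedFDerivWithin_fun_zero
    rw [h, h']
    simp

variable [IsManifold I ∞ X] [ContMDiffVectorBundle ∞ F E I]

theorem add {f g : TotalSpace F E → ℂ} (hf : IsBundleSchwartz I f) (hg : IsBundleSchwartz I g) :
    IsBundleSchwartz I (f + g) where
  smooth := hf.smooth.add hg.smooth
  support := by
    obtain ⟨K, hK, h⟩ := hf.support
    obtain ⟨L, hL, h'⟩ := hg.support
    refine ⟨K ∪ L, hK.union hL, fun p hp => ?_⟩
    rw [mem_union, not_or] at hp
    simp [h p hp.1, h' p hp.2]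
  decay := by
    intro x₀ K hKc hK k n
    obtain ⟨C, hC⟩ := hf.decay x₀ K hKc hK k n
    obtain ⟨D, hD⟩ := hg.decay x₀ K hKc hK k n
    refine ⟨C + D, fun y hy v => ?_⟩
    have hmem : (y, v) ∈ bundleChartDomain I F E x₀ ×ˢ (univ : Set F) := ⟨hK hy, mem_univ _⟩
    have e : bundleLocalRep I (f + g) x₀ = bundleLocalRep I f x₀ + bundleLocalRep I g x₀ := rfl
    rw [e, iteratedFDerivWithin_add_apply
      (((bundleLocalRep_contDiffOn I hf.smooth x₀) _ hmem).of_le (by exact_mod_cast le_top))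
      (((bundleLocalRep_contDiffOn I hg.smooth x₀) _ hmem).of_le (by exact_mod_cast le_top))
      (bundleChartDomain_prod_uniqueDiffOn I F E x₀) hmem]
    calc _ ≤ ‖v‖ ^ k * (_ + _) := by gcongr; exact norm_add_le _ _
      _ ≤ C + D := by rw [mul_add]; exact add_le_add (hC y hy v) (hD y hy v)

theorem smul (c : ℂ) {f : TotalSpace F E → ℂ} (hf : IsBundleSchwartz I f) :
    IsBundleSchwartz I (c • f) where
  smooth := (contDiff_const_smul (𝕜 := ℝ) (F := ℂ) c).contMDiff.comp hf.smooth
  support := by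
    obtain ⟨K, hK, h⟩ := hf.support
    exact ⟨K, hK, fun p hp => by simp [h p hp]⟩
  decay := by
    intro x₀ K hKc hK k n
    obtain ⟨C, hC⟩ := hf.decay x₀ K hKc hK k n
    refine ⟨‖c‖ * C, fun y hy v => ?_⟩
    have hmem : (y, v) ∈ bundleChartDomain I F E x₀ ×ˢ (univ : Set F) := ⟨hK hy, mem_univ _⟩
    have e : bundleLocalRep I (c • f) x₀ = c • bundleLocalRep I f x₀ := rfl
    rw [e, iteratedFDerivWithin_const_smul_apply
      (((bundleLocalRep_contDiffOn I hf.smooth x₀) _ hmem).of_le (by exact_mod_cast le_top))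
      (bundleChartDomain_prod_uniqueDiffOn I F E x₀) hmem, norm_smul]
    rw [mul_left_comm]
    exact mul_le_mul_of_nonneg_left (hC y hy v) (norm_nonneg c)

theorem mul {f g : TotalSpace F E → ℂ} (hf : IsBundleSchwartz I f) (hg : IsBundleSchwartz I g) :
    IsBundleSchwartz I (f * g) where
  smooth := (contDiff_mul (𝕜 := ℝ) (𝔸 := ℂ)).contMDiff.comp
    (hf.smooth.prodMk_space hg.smooth)
  support := by
    obtain ⟨K, hK, h⟩ := hf.support
    exact ⟨K, hK, fun p hp => by simp [h p hp]⟩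
  decay := by
    intro x₀ K hKc hK k n
    choose C hC using fun i => hf.decay x₀ K hKc hK k i
    choose D hD using fun i => hg.decay x₀ K hKc hK 0 i
    refine ⟨∑ i ∈ Finset.range (n + 1), (n.choose i : ℝ) * C i * D (n - i), fun y hy v => ?_⟩
    have hmem : (y, v) ∈ bundleChartDomain I F E x₀ ×ˢ (univ : Set F) := ⟨hK hy, mem_univ _⟩
    have h := norm_iteratedFDerivWithin_mul_le (bundleLocalRep_contDiffOn I hf.smooth x₀)
      (bundleLocalRep_contDiffOn I hg.smooth x₀)
      (bundleChartDomain_prod_uniqueDiffOn I F E x₀) hmem (n := n) (by exact_mod_cast le_top)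
    refine (mul_le_mul_of_nonneg_left h (by positivity)).trans ?_
    rw [Finset.mul_sum]
    refine Finset.sum_le_sum fun i _ => ?_
    have h1 := hC i y hy v
    have h2 := hD (n - i) y hy v
    rw [pow_zero, one_mul] at h2
    calc _ = (n.choose i : ℝ) * (‖v‖ ^ k * ‖iteratedFDerivWithin ℝ i (bundleLocalRep I f x₀)
          (bundleChartDomain I F E x₀ ×ˢ univ) (y, v)‖) *
          ‖iteratedFDerivWithin ℝ (n - i) (bundleLocalRep I g x₀)
          (bundleChartDomain I F E x₀ ×ˢ univ) (y, v)‖ := by ring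
      _ ≤ _ := by
        have : 0 ≤ C i := le_trans (by positivity) h1
        gcongr

end IsBundleSchwartz

/-- The Schwartz space `𝒮(E)` as a complex vector space of functions on the total space. -/
def bundleSchwartz [IsManifold I ∞ X] [ContMDiffVectorBundle ∞ F E I] :
    Submodule ℂ (TotalSpace F E → ℂ) where
  carrier := {f | IsBundleSchwartz I f}
  zero_mem' := IsBundleSchwartz.zero I
  add_mem' := fun hf hg => hf.add I hg
  smul_mem' := fun c _ hf => hf.smul I c

/-- `𝒮(E)` with the pointwise product of functions. -/
def bundleSchwartzPointwise [IsManifold I ∞ X] [ContMDiffVectorBundle ∞ F E I] :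
    NonUnitalSubalgebra ℂ (TotalSpace F E → ℂ) where
  __ := bundleSchwartz I F E
  mul_mem' := fun hf hg => IsBundleSchwartz.mul I hf hg

end SchwartzBundle

/-! ### The dual bundle, smooth Haar systems, convolution and fibrewise Fourier transform -/

/-- The fibres of the dual bundle `E^*`. -/
abbrev DualBundle {X : Type*} (E : X → Type*) [∀ x, AddCommGroup (E x)] [∀ x, Module ℝ (E x)]
    [∀ x, TopologicalSpace (E x)] (x : X) : Type _ :=
  E x →L[ℝ] Bundle.Trivial X ℝ x

section Convolution

variable {EB : Type*} [NormedAddCommGroup EB] [NormedSpace ℝ EB]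
  {HB : Type*} [TopologicalSpace HB] (I : ModelWithCorners ℝ EB HB)
  {X : Type*} [TopologicalSpace X] [ChartedSpace HB X]
  {F : Type*} [NormedAddCommGroup F] [NormedSpace ℝ F]
  {E : X → Type*} [∀ x, AddCommGroup (E x)] [∀ x, Module ℝ (E x)]
  [∀ x, TopologicalSpace (E x)] [TopologicalSpace (TotalSpace F E)]
  [FiberBundle F E] [VectorBundle ℝ F E] [∀ x, MeasurableSpace (E x)]

/-- A smooth Haar system on the bundle, given by a smooth positive section of the bundle of
`1`-densities: in every local trivialization the measure on the fibre over `x` is `ρ x` times a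
fixed Lebesgue (Haar) measure of the model fibre, where `ρ` is a smooth positive function. -/
def IsSmoothHaarSystem (F : Type*) [NormedAddCommGroup F] [NormedSpace ℝ F]
    [FiniteDimensional ℝ F] [MeasurableSpace F] [BorelSpace F]
    [TopologicalSpace (TotalSpace F E)] [FiberBundle F E] [VectorBundle ℝ F E]
    (μ : ∀ x, Measure (E x)) : Prop :=
  ∀ x₀ : X, ∃ ρ : X → ℝ,
    ContMDiffOn I 𝓘(ℝ, ℝ) ∞ ρ (trivializationAt F E x₀).baseSet ∧
    ∀ x ∈ (trivializationAt F E x₀).baseSet, 0 < ρ x ∧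
      (μ x).map ((trivializationAt F E x₀).continuousLinearMapAt ℝ x) =
        ENNReal.ofReal (ρ x) • Measure.addHaar (G := F)

/-- Fibrewise convolution `(f * g)(x, v) = ∫ f(x, v - w) g(x, w) dμ_x(w)`. -/
def bundleConv (μ : ∀ x, Measure (E x)) (f g : TotalSpace F E → ℂ) : TotalSpace F E → ℂ :=
  fun p => ∫ w : E p.proj, f ⟨p.proj, p.snd - w⟩ * g ⟨p.proj, w⟩ ∂(μ p.proj)

/-- Fibrewise Fourier transform `(𝓕 f)(x, ξ) = ∫ e^{-i ξ(v)} f(x, v) dμ_x(v)`, a function on the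
total space of the dual bundle. -/
def bundleFourier (μ : ∀ x, Measure (E x)) (f : TotalSpace F E → ℂ) :
    TotalSpace (F →L[ℝ] ℝ) (DualBundle E) → ℂ :=
  fun q => ∫ v : E q.proj, Complex.exp (-Complex.I * ((q.snd v : ℝ) : ℂ)) * f ⟨q.proj, v⟩
    ∂(μ q.proj)

variable [IsManifold I ∞ X] [ContMDiffVectorBundle ∞ F E I]

/-- Convolution is an everywhere defined operation on `𝒮(E)` which makes this vector space an
associative complex algebra. -/
structure IsConvolutionAlgebra (μ : ∀ x, Measure (E x)) : Prop where
  conv_mem : ∀ f ∈ bundleSchwartz I F E, ∀ g ∈ bundleSchwartz I F E,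
    bundleConv μ f g ∈ bundleSchwartz I F E
  integrable : ∀ f ∈ bundleSchwartz I F E, ∀ g ∈ bundleSchwartz I F E, ∀ p : TotalSpace F E,
    Integrable (fun w : E p.proj => f ⟨p.proj, p.snd - w⟩ * g ⟨p.proj, w⟩) (μ p.proj)
  conv_assoc : ∀ f ∈ bundleSchwartz I F E, ∀ g ∈ bundleSchwartz I F E,
    ∀ h ∈ bundleSchwartz I F E, bundleConv μ (bundleConv μ f g) h = bundleConv μ f (bundleConv μ g h)

variable {I} {μ : ∀ x, Measure (E x)}

/-- The algebra `(𝒮(E), *)`. -/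
def BundleConvAlgebra (_ : IsConvolutionAlgebra (F := F) I μ) : Type _ := bundleSchwartz I F E

namespace BundleConvAlgebra

variable (h : IsConvolutionAlgebra (F := F) I μ)

instance : AddCommGroup (BundleConvAlgebra h) :=
  inferInstanceAs (AddCommGroup (bundleSchwartz I F E))

instance : Module ℂ (BundleConvAlgebra h) :=
  inferInstanceAs (Module ℂ (bundleSchwartz I F E))

/-- The function on the total space underlying an element of `𝒮(E)`. -/
def toFun (f : BundleConvAlgebra h) : TotalSpace F E → ℂ := f.1

instance : Mul (BundleConvAlgebra h) where
  mul f g := ⟨bundleConv μ f.1 g.1, h.conv_mem _ f.2 _ g.2⟩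

instance : NonUnitalRing (BundleConvAlgebra h) where
  mul_assoc f g k := Subtype.ext (h.conv_assoc _ f.2 _ g.2 _ k.2)
  left_distrib f g k := by
    refine Subtype.ext (funext fun p => ?_)
    refine Eq.trans ?_ (integral_add (h.integrable _ f.2 _ g.2 p) (h.integrable _ f.2 _ k.2 p))
    exact integral_congr_ae (.of_forall fun w => mul_add _ _ _)
  right_distrib f g k := by
    refine Subtype.ext (funext fun p => ?_)
    refine Eq.trans ?_ (integral_add (h.integrable _ f.2 _ k.2 p) (h.integrable _ g.2 _ k.2 p))
    exact integral_congr_ae (.of_forall fun w => add_mul _ _ _)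
  zero_mul f := by
    refine Subtype.ext (funext fun p => ?_)
    refine Eq.trans ?_ (integral_zero (E p.proj) ℂ (μ := μ p.proj))
    exact integral_congr_ae (.of_forall fun w => zero_mul _)
  mul_zero f := by
    refine Subtype.ext (funext fun p => ?_)
    refine Eq.trans ?_ (integral_zero (E p.proj) ℂ (μ := μ p.proj))
    exact integral_congr_ae (.of_forall fun w => mul_zero _)

instance : IsScalarTower ℂ (BundleConvAlgebra h) (BundleConvAlgebra h) where
  smul_assoc c f g := by
    refine Subtype.ext (funext fun p => ?_)
    refine Eq.trans ?_ (integral_smul c (fun w : E p.proj =>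
      f.1 ⟨p.proj, p.snd - w⟩ * g.1 ⟨p.proj, w⟩))
    exact integral_congr_ae (.of_forall fun w => smul_mul_assoc c _ _)

instance : SMulCommClass ℂ (BundleConvAlgebra h) (BundleConvAlgebra h) where
  smul_comm c f g := by
    refine Subtype.ext (funext fun p => Eq.symm ?_)
    refine Eq.trans ?_ (integral_smul c (fun w : E p.proj =>
      f.1 ⟨p.proj, p.snd - w⟩ * g.1 ⟨p.proj, w⟩))
    exact integral_congr_ae (.of_forall fun w => mul_smul_comm c _ _)

end BundleConvAlgebra

end Convolution

/-! ### The group `K₀` -/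

section KTheory

/-- Idempotent square matrices over `R`, of any size. -/
abbrev IdempotentMatrix (R : Type*) [Ring R] : Type _ :=
  Σ n : ℕ, {p : Matrix (Fin n) (Fin n) R // IsIdempotentElem p}

namespace IdempotentMatrix

variable {R S : Type*} [Ring R] [Ring S]

/-- Algebraic (Murray-von Neumann) equivalence: `p = u v` and `q = v u`. For idempotents this
means that the finitely generated projective modules that they define are isomorphic. -/
def Equivalent (p q : IdempotentMatrix R) : Prop :=
  ∃ (u : Matrix (Fin p.1) (Fin q.1) R) (v : Matrix (Fin q.1) (Fin p.1) R),
    u * v = p.2.1 ∧ v * u = q.2.1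

/-- The block diagonal sum. -/
def directSum (p q : IdempotentMatrix R) : IdempotentMatrix R :=
  ⟨p.1 + q.1, (Matrix.fromBlocks p.2.1 0 0 q.2.1).submatrix finSumFinEquiv.symm
    finSumFinEquiv.symm, by
      have hp := p.2.2.eq
      have hq := q.2.2.eq
      rw [IsIdempotentElem, Matrix.submatrix_mul_equiv, Matrix.fromBlocks_multiply]
      simp [hp, hq]⟩

/-- The image under a ring homomorphism. -/
def map (f : R →+* S) (p : IdempotentMatrix R) : IdempotentMatrix S :=
  ⟨p.1, p.2.1.map f, by rw [IsIdempotentElem, ← Matrix.map_mul, p.2.2.eq]⟩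

end IdempotentMatrix

/-- The relations `[p] = [q]` for equivalent `p`, `q`, and `[p ⊕ q] = [p] + [q]`. -/
def K0Relations (R : Type*) [Ring R] : AddSubgroup (FreeAbelianGroup (IdempotentMatrix R)) :=
  AddSubgroup.closure
    ({z | ∃ p q : IdempotentMatrix R, p.Equivalent q ∧
        z = FreeAbelianGroup.of p - FreeAbelianGroup.of q} ∪
      {z | ∃ p q : IdempotentMatrix R,
        z = FreeAbelianGroup.of (p.directSum q) -
          (FreeAbelianGroup.of p + FreeAbelianGroup.of q)})

/-- `K₀` of a unital ring: the abelian group generated by idempotent matrices, subject to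
`[p] = [q]` for equivalent idempotents and `[p ⊕ q] = [p] + [q]`. -/
abbrev K0Unital (R : Type*) [Ring R] : Type _ :=
  FreeAbelianGroup (IdempotentMatrix R) ⧸ K0Relations R

/-- The map induced on `K₀` by a unital ring homomorphism. -/
def K0Unital.map {R S : Type*} [Ring R] [Ring S] (f : R →+* S) : K0Unital R →+ K0Unital S :=
  QuotientAddGroup.map (K0Relations R) (K0Relations S)
    (FreeAbelianGroup.map (IdempotentMatrix.map f)) (by
      rw [K0Relations, AddSubgroup.closure_le]
      rintro z (⟨p, q, ⟨u, v, huv, hvu⟩, rfl⟩ | ⟨p, q, rfl⟩)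
      · refine AddSubgroup.subset_closure (Or.inl ⟨p.map f, q.map f, ⟨u.map f, v.map f, ?_, ?_⟩, ?_⟩)
        · exact (Matrix.map_mul (f := f)).symm.trans (congrArg (fun m => Matrix.map m f) huv)
        · exact (Matrix.map_mul (f := f)).symm.trans (congrArg (fun m => Matrix.map m f) hvu)
        · simp
      · have e : (p.directSum q).map f = (p.map f).directSum (q.map f) := by
          refine Sigma.ext rfl (heq_of_eq (Subtype.ext ?_))
          have h0 : (Matrix.fromBlocks p.2.1 0 0 q.2.1).map f =
              Matrix.fromBlocks (p.2.1.map f) 0 0 (q.2.1.map f) := by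
            rw [Matrix.fromBlocks_map]
            simp
          exact congrArg (fun m => Matrix.submatrix m (finSumFinEquiv (m := p.1) (n := q.1)).symm
            (finSumFinEquiv (m := p.1) (n := q.1)).symm) h0
        refine AddSubgroup.subset_closure (Or.inr ⟨p.map f, q.map f, ?_⟩)
        simp [e])

variable {A B : Type*} [NonUnitalRing A] [Module ℂ A] [IsScalarTower ℂ A A] [SMulCommClass ℂ A A]
  [NonUnitalRing B] [Module ℂ B] [IsScalarTower ℂ B B] [SMulCommClass ℂ B B]

/-- `K₀` of a complex algebra `A` without unit: the kernel of `K₀(A⁺) → K₀(ℂ)`, where `A⁺` is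
obtained from `A` by adjoining a unit. -/
def K0 (A : Type*) [NonUnitalRing A] [Module ℂ A] [IsScalarTower ℂ A A] [SMulCommClass ℂ A A] :
    AddSubgroup (K0Unital (Unitization ℂ A)) :=
  (K0Unital.map (Unitization.fstHom ℂ A : Unitization ℂ A →+* ℂ)).ker

/-- The unital extension `A⁺ → B⁺` of a homomorphism `A → B`. -/
def unitizationMap (φ : A →ₙₐ[ℂ] B) : Unitization ℂ A →ₐ[ℂ] Unitization ℂ B :=
  Unitization.lift ((Unitization.inrNonUnitalAlgHom ℂ B).comp φ)

theorem K0Unital.map_map {R S T : Type*} [Ring R] [Ring S] [Ring T] (f : R →+* S) (g : S →+* T)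
    (x : K0Unital R) : K0Unital.map g (K0Unital.map f x) = K0Unital.map (g.comp f) x := by
  induction x using QuotientAddGroup.induction_on with
  | H x =>
    refine congrArg (QuotientAddGroup.mk (s := K0Relations T)) ?_
    induction x using FreeAbelianGroup.induction_on with
    | zero => simp
    | of p => rfl
    | neg p h => simpa using h
    | add x y hx hy => simp only [map_add, hx, hy]

/-- The map `K₀(A) → K₀(B)` induced by a homomorphism of algebras. -/
def K0.map (φ : A →ₙₐ[ℂ] B) : K0 A →+ K0 B :=
  ((K0Unital.map (unitizationMap φ : Unitization ℂ A →+* Unitization ℂ B)).comp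
    (K0 A).subtype).codRestrict (K0 B) (by
      rintro ⟨x, hx⟩
      have e : (Unitization.fstHom ℂ B : Unitization ℂ B →+* ℂ).comp
          (unitizationMap φ : Unitization ℂ A →+* Unitization ℂ B) =
          (Unitization.fstHom ℂ A : Unitization ℂ A →+* ℂ) := by
        ext x
        change (unitizationMap φ x).fst = x.fst
        simp [unitizationMap, Unitization.algebraMap_eq_inl]
      rw [K0, AddMonoidHom.mem_ker] at hx ⊢
      refine (K0Unital.map_map _ _ x).trans ?_
      rw [e]
      exact hx)

end KTheory

/-! ### Holomorphic functional calculus -/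

section HolomorphicCalculus

/-- A finite family of closed `C¹` curves in `U \ σ`, of total winding number `1` around every
point of `σ` and `0` around every point outside `U`: a contour over which the Cauchy integrals of
the holomorphic functional calculus are taken. -/
structure IsContour (σ U : Set ℂ) {m : ℕ} (γ : Fin m → ℝ → ℂ) : Prop where
  contDiffOn : ∀ j, ContDiffOn ℝ 1 (γ j) (Icc 0 1)
  closed : ∀ j, γ j 0 = γ j 1
  mapsTo : ∀ j, MapsTo (γ j) (Icc 0 1) (U \ σ)
  winding_inside : ∀ z ∈ σ,
    (2 * Real.pi * Complex.I)⁻¹ * ∑ j, ∫ t in (0 : ℝ)..1, deriv (γ j) t / (γ j t - z) = 1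
  winding_outside : ∀ z ∉ U,
    (2 * Real.pi * Complex.I)⁻¹ * ∑ j, ∫ t in (0 : ℝ)..1, deriv (γ j) t / (γ j t - z) = 0

variable {B : Type*} [NonUnitalCStarAlgebra B]

/-- The element `f(a) = (2πi)⁻¹ ∮ f(z) (z - a)⁻¹ dz` of `M_n(B⁺)`, as an integral over the curves
`γ`. The integral of a matrix valued function is computed entrywise. -/
def cauchyCalculus {n m : ℕ} (f : ℂ → ℂ) (γ : Fin m → ℝ → ℂ)
    (a : Matrix (Fin n) (Fin n) (Unitization ℂ B)) :
    Matrix (Fin n) (Fin n) (Unitization ℂ B) := fun i k =>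
  (2 * Real.pi * Complex.I)⁻¹ • ∑ j, ∫ t in (0 : ℝ)..1,
    (f (γ j t) * deriv (γ j) t) • resolvent a (γ j t) i k

/-- A subalgebra `A` of `B` is stable under holomorphic functional calculus if for every `n`, every
`a ∈ M_n(A⁺)` and every `f` holomorphic on a neighbourhood `U` of the spectrum of `a` in `M_n(B⁺)`
the element `f(a)` of `M_n(B⁺)` belongs to `M_n(A⁺)`. -/
def IsStableUnderHolomorphicCalculus (A : NonUnitalSubalgebra ℂ B) : Prop :=
  ∀ (n : ℕ) (a : Matrix (Fin n) (Fin n) (Unitization ℂ B)), (∀ i k, (a i k).snd ∈ A) →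
  ∀ (U : Set ℂ), IsOpen U → spectrum ℂ a ⊆ U →
  ∀ (f : ℂ → ℂ), DifferentiableOn ℂ f U →
  ∀ (m : ℕ) (γ : Fin m → ℝ → ℂ), IsContour (spectrum ℂ a) U γ →
    ∀ i k, (cauchyCalculus f γ a i k).snd ∈ A

end HolomorphicCalculus

end

noncomputable section

set_option linter.unusedSectionVars false

/-! ### Differentiation of parametric integrals within a convex set -/

section ParametricIntegral

open Filter Topology

/-- On the convex set `t` the mean value inequality turns the bound on the derivatives into a
Lipschitz bound, which dominates the difference quotients. Convexity replaces openness, as required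
at boundary points of a chart. -/
theorem hasFDerivWithinAt_integral_of_dominated {α : Type*} [MeasurableSpace α] {ν : Measure α}
    {H : Type*} [NormedAddCommGroup H] [NormedSpace ℝ H] {G : Type*} [NormedAddCommGroup G]
    [NormedSpace ℝ G] [CompleteSpace G] {f : H → α → G} {f' : H → α → H →L[ℝ] G} {s t : Set H}
    {x₀ : H} {bound : α → ℝ} (hts : t ∈ 𝓝[s] x₀) (hx₀ : x₀ ∈ t) (ht : Convex ℝ t)
    (hf_int : ∀ x ∈ t, Integrable (f x) ν) (hf'_meas : AEStronglyMeasurable (f' x₀) ν)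
    (h_bound : ∀ a, ∀ x ∈ t, ‖f' x a‖ ≤ bound a) (bound_int : Integrable bound ν)
    (h_diff : ∀ a, ∀ x ∈ t, HasFDerivWithinAt (f · a) (f' x a) t x) :
    HasFDerivWithinAt (fun x => ∫ a, f x a ∂ν) (∫ a, f' x₀ a ∂ν) s x₀ := by
  have hf'_int : Integrable (f' x₀) ν :=
    bound_int.mono' hf'_meas (.of_forall fun a => h_bound a x₀ hx₀)
  have nneg : ∀ x : H, 0 ≤ ‖x - x₀‖⁻¹ := fun x => inv_nonneg.mpr (norm_nonneg _)
  have h_lip : ∀ a, ∀ x ∈ t, ‖f x a - f x₀ a‖ ≤ bound a * ‖x - x₀‖ := fun a x hx =>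
    ht.norm_image_sub_le_of_norm_hasFDerivWithin_le (h_diff a) (h_bound a) hx₀ hx
  have key : ∀ᶠ x in 𝓝[s] x₀,
      ‖x - x₀‖⁻¹ * ‖((∫ a, f x a ∂ν) - ∫ a, f x₀ a ∂ν) - (∫ a, f' x₀ a ∂ν) (x - x₀)‖ =
      ‖∫ a, ‖x - x₀‖⁻¹ • (f x a - f x₀ a - f' x₀ a (x - x₀)) ∂ν‖ := by
    filter_upwards [hts] with x hx
    rw [← norm_smul_of_nonneg (nneg _), integral_smul, integral_sub, integral_sub,
      ← ContinuousLinearMap.integral_apply hf'_int]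
    exacts [hf_int x hx, hf_int _ hx₀, (hf_int x hx).sub (hf_int _ hx₀),
      hf'_int.apply_continuousLinearMap _]
  rw [hasFDerivWithinAt_iff_tendsto, tendsto_congr' key, ← tendsto_zero_iff_norm_tendsto_zero, ←
    show (∫ a : α, ‖x₀ - x₀‖⁻¹ • (f x₀ a - f x₀ a - (f' x₀ a) (x₀ - x₀)) ∂ν) = 0 by simp]
  -- One copy of `bound a` controls the difference quotient, the other the linear term.
  refine tendsto_integral_filter_of_dominated_convergence (bound := fun a => bound a + bound a)
    ?_ ?_ (bound_int.add bound_int) ?_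
  · filter_upwards [hts] with x hx
    exact (((hf_int x hx).1.sub (hf_int _ hx₀).1).sub
      (hf'_meas.apply_continuousLinearMap _)).const_smul _
  · filter_upwards [hts] with x hx
    refine .of_forall fun a => ?_
    have hb : 0 ≤ bound a := (norm_nonneg _).trans (h_bound a x₀ hx₀)
    have h1 : ‖f x a - f x₀ a - f' x₀ a (x - x₀)‖ ≤ (bound a + bound a) * ‖x - x₀‖ := by
      refine (norm_sub_le _ _).trans ?_
      rw [add_mul]
      exact add_le_add (h_lip a x hx) (((f' x₀ a).le_opNorm _).trans
        (mul_le_mul_of_nonneg_right (h_bound a x₀ hx₀) (norm_nonneg _)))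
    rw [norm_smul_of_nonneg (nneg _), ← div_eq_inv_mul]
    exact div_le_of_le_mul₀ (norm_nonneg _) (by positivity) h1
  · refine .of_forall fun a => ?_
    have h1 : HasFDerivWithinAt (f · a) (f' x₀ a) s x₀ :=
      (h_diff a x₀ hx₀).mono_of_mem_nhdsWithin hts
    rw [hasFDerivWithinAt_iff_tendsto] at h1
    simp only [sub_self, map_zero, smul_zero]
    rw [tendsto_zero_iff_norm_tendsto_zero]
    refine h1.congr fun x => ?_
    rw [norm_smul_of_nonneg (nneg _)]

end ParametricIntegral

/-! ### Families of rapidly decreasing functions -/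

section RapidDecrease

variable {EB : Type*} [NormedAddCommGroup EB] [NormedSpace ℝ EB]
  {V : Type*} [NormedAddCommGroup V] [NormedSpace ℝ V]

/-- A family of functions on `V`, smoothly parametrized by `D`, all of whose derivatives decrease
rapidly in `V`, locally uniformly on `D`. -/
structure RapidlyDecreasing (D : Set EB) (g : EB × V → ℂ) : Prop where
  contDiffOn : ContDiffOn ℝ ∞ g (D ×ˢ univ)
  decay : ∀ K : Set EB, IsCompact K → K ⊆ D → ∀ k n : ℕ, ∃ C : ℝ, ∀ y ∈ K, ∀ v : V,
    ‖v‖ ^ k * ‖iteratedFDerivWithin ℝ n g (D ×ˢ univ) (y, v)‖ ≤ C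

/-- A smooth function on `D × V` whose derivatives grow at most polynomially in `V`. -/
structure ModeratelyGrowing (D : Set EB) (g : EB × V → ℂ) : Prop where
  contDiffOn : ContDiffOn ℝ ∞ g (D ×ˢ univ)
  growth : ∀ K : Set EB, IsCompact K → K ⊆ D → ∀ n : ℕ, ∃ (k : ℕ) (C : ℝ), ∀ y ∈ K, ∀ v : V,
    ‖iteratedFDerivWithin ℝ n g (D ×ˢ univ) (y, v)‖ ≤ C * (1 + ‖v‖) ^ k

variable {D : Set EB} {g h : EB × V → ℂ}

namespace RapidlyDecreasing

/-- The weight `1 + ‖v‖` is multiplicative in the exponent and never small, which makes it more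
convenient than `‖v‖`. The estimate combines the decay bounds of orders `k` and `0`. -/
theorem exists_bound (hg : RapidlyDecreasing D g) {K : Set EB} (hK : IsCompact K) (hKD : K ⊆ D)
    (k n : ℕ) : ∃ C : ℝ, 0 ≤ C ∧ ∀ y ∈ K, ∀ v : V,
      (1 + ‖v‖) ^ k * ‖iteratedFDerivWithin ℝ n g (D ×ˢ univ) (y, v)‖ ≤ C := by
  obtain ⟨C, hC⟩ := hg.decay K hK hKD k n
  obtain ⟨C', hC'⟩ := hg.decay K hK hKD 0 n
  refine ⟨2 ^ (k - 1) * (max C' 0 + max C 0), by positivity, fun y hy v => ?_⟩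
  have h1 := hC y hy v
  have h2 := hC' y hy v
  rw [pow_zero, one_mul] at h2
  calc _ ≤ (2 ^ (k - 1) * (1 ^ k + ‖v‖ ^ k)) * _ :=
        mul_le_mul_of_nonneg_right (add_pow_le zero_le_one (norm_nonneg v) k) (norm_nonneg _)
    _ = 2 ^ (k - 1) * (‖iteratedFDerivWithin ℝ n g (D ×ˢ univ) (y, v)‖
          + ‖v‖ ^ k * ‖iteratedFDerivWithin ℝ n g (D ×ˢ univ) (y, v)‖) := by ring
    _ ≤ _ := by
      gcongr
      · exact h2.trans (le_max_left _ _)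
      · exact h1.trans (le_max_left _ _)

theorem congr (hg : RapidlyDecreasing D g) (hgh : EqOn h g (D ×ˢ univ)) :
    RapidlyDecreasing D h where
  contDiffOn := hg.contDiffOn.congr hgh
  decay := by
    intro K hK hKD k n
    obtain ⟨C, hC⟩ := hg.decay K hK hKD k n
    refine ⟨C, fun y hy v => ?_⟩
    rw [iteratedFDerivWithin_congr hgh ⟨hKD hy, mem_univ _⟩]
    exact hC y hy v

theorem add (hD : UniqueDiffOn ℝ D) (hg : RapidlyDecreasing D g) (hh : RapidlyDecreasing D h) :
    RapidlyDecreasing D (g + h) where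
  contDiffOn := hg.contDiffOn.add hh.contDiffOn
  decay := by
    intro K hK hKD k n
    obtain ⟨C, hC⟩ := hg.decay K hK hKD k n
    obtain ⟨C', hC'⟩ := hh.decay K hK hKD k n
    refine ⟨C + C', fun y hy v => ?_⟩
    have hmem : (y, v) ∈ D ×ˢ (univ : Set V) := ⟨hKD hy, mem_univ _⟩
    rw [iteratedFDerivWithin_add_apply ((hg.contDiffOn _ hmem).of_le (by exact_mod_cast le_top))
      ((hh.contDiffOn _ hmem).of_le (by exact_mod_cast le_top)) (hD.prod uniqueDiffOn_univ) hmem]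
    calc _ ≤ ‖v‖ ^ k * (_ + _) := by gcongr; exact norm_add_le _ _
      _ ≤ C + C' := by rw [mul_add]; exact add_le_add (hC y hy v) (hC' y hy v)

/-- By Leibniz's rule, the growth `(1 + ‖v‖) ^ m i` of the `i`-th derivative of `g` is absorbed by
asking for decay of order `k + m i` from `h`. -/
theorem mul (hD : UniqueDiffOn ℝ D) (hg : ModeratelyGrowing D g) (hh : RapidlyDecreasing D h) :
    RapidlyDecreasing D (fun p => g p * h p) where
  contDiffOn := hg.contDiffOn.mul hh.contDiffOn
  decay := by
    intro K hK hKD k n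
    choose m C hC using fun i => hg.growth K hK hKD i
    choose C' hC'0 hC' using fun i : ℕ => fun l : ℕ => hh.exists_bound hK hKD l i
    refine ⟨∑ i ∈ Finset.range (n + 1), (n.choose i : ℝ) * |C i| * C' (n - i) (k + m i),
      fun y hy v => ?_⟩
    have hmem : (y, v) ∈ D ×ˢ (univ : Set V) := ⟨hKD hy, mem_univ _⟩
    have h1 := norm_iteratedFDerivWithin_mul_le hg.contDiffOn hh.contDiffOn
      (hD.prod uniqueDiffOn_univ) hmem (n := n) (by exact_mod_cast le_top)
    refine (mul_le_mul_of_nonneg_left h1 (by positivity)).trans ?_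
    rw [Finset.mul_sum]
    refine Finset.sum_le_sum fun i _ => ?_
    have h3 := hC i y hy v
    have h4 := hC' (n - i) (k + m i) y hy v
    calc _ ≤ (1 + ‖v‖) ^ k * ((n.choose i : ℝ) * (|C i| * (1 + ‖v‖) ^ m i) *
          ‖iteratedFDerivWithin ℝ (n - i) h (D ×ˢ univ) (y, v)‖) := by
          gcongr
          · linarith [norm_nonneg v]
          · exact h3.trans (mul_le_mul_of_nonneg_right (le_abs_self _) (by positivity))
      _ = (n.choose i : ℝ) * |C i| * ((1 + ‖v‖) ^ (k + m i) *
          ‖iteratedFDerivWithin ℝ (n - i) h (D ×ˢ univ) (y, v)‖) := by ring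
      _ ≤ _ := by gcongr

theorem fderivWithin_apply (hD : UniqueDiffOn ℝ D) (hg : RapidlyDecreasing D g) (e : EB × V) :
    RapidlyDecreasing D (fun p => fderivWithin ℝ g (D ×ˢ univ) p e) where
  contDiffOn := (hg.contDiffOn.fderivWithin (hD.prod uniqueDiffOn_univ)
    (m := ∞) (by simp)).clm_apply contDiffOn_const
  decay := by
    intro K hK hKD k n
    obtain ⟨C, hC⟩ := hg.decay K hK hKD k (n + 1)
    refine ⟨‖e‖ * C, fun y hy v => ?_⟩
    have hs : UniqueDiffOn ℝ (D ×ˢ (univ : Set V)) := hD.prod uniqueDiffOn_univ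
    have hmem : (y, v) ∈ D ×ˢ (univ : Set V) := ⟨hKD hy, mem_univ _⟩
    have h1 := norm_iteratedFDerivWithin_clm_apply_const (c := e) (n := n)
      ((hg.contDiffOn.fderivWithin hs (m := ∞) (by simp)) _ hmem) hs hmem
      (by exact_mod_cast le_top)
    rw [norm_iteratedFDerivWithin_fderivWithin hs hmem] at h1
    refine (mul_le_mul_of_nonneg_left h1 (by positivity)).trans ?_
    rw [mul_left_comm]
    exact mul_le_mul_of_nonneg_left (hC y hy v) (norm_nonneg e)

end RapidlyDecreasing

/-- Over a compact set of parameters of norm at most `R` one has `1 + ‖(y, v)‖ ≤ (1 + R) (1 + ‖v‖)`,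
so temperate growth on the product becomes polynomial growth in `v` alone. -/
theorem ModeratelyGrowing.snd (hD : UniqueDiffOn ℝ D) {f : V → ℂ} (hf : f.HasTemperateGrowth) :
    ModeratelyGrowing D (fun p : EB × V => f p.2) where
  contDiffOn := (hf.1.comp contDiff_snd).contDiffOn
  growth := by
    intro K hK hKD n
    obtain ⟨R, hR0, hR⟩ := hK.isBounded.exists_pos_norm_le
    have h1 : (fun p : EB × V => f p.2).HasTemperateGrowth :=
      hf.comp (ContinuousLinearMap.snd ℝ EB V).hasTemperateGrowth
    obtain ⟨k, C, hC⟩ := h1.2 n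
    refine ⟨k, |C| * (1 + R) ^ k, fun y hy v => ?_⟩
    have hmem : (y, v) ∈ D ×ˢ (univ : Set V) := ⟨hKD hy, mem_univ _⟩
    have h2 : ContDiffAt ℝ n (fun p : EB × V => f p.2) (y, v) :=
      h1.1.contDiffAt.of_le (by exact_mod_cast le_top)
    rw [iteratedFDerivWithin_eq_iteratedFDeriv (hD.prod uniqueDiffOn_univ) h2 hmem]
    refine (hC (y, v)).trans ?_
    calc _ ≤ |C| * ((1 + R) * (1 + ‖v‖)) ^ k := by
          gcongr
          · exact le_abs_self _
          · have h2 : ‖(y, v)‖ ≤ R + ‖v‖ := by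
              rw [Prod.norm_mk]
              exact max_le (by linarith [hR y hy, norm_nonneg v]) (by linarith)
            nlinarith [norm_nonneg v]
      _ = _ := by rw [mul_pow]; ring

open scoped Pointwise in
-- The function and its domain are invariant under translation along `V`, so the derivatives at `(y,
-- v)` are those at `(y, 0)`, and these are bounded by compactness of `K`. The growth exponent is
-- therefore `0`.
theorem ModeratelyGrowing.fst (hD : UniqueDiffOn ℝ D) {f : EB → ℂ} (hf : ContDiffOn ℝ ∞ f D) :
    ModeratelyGrowing D (fun p : EB × V => f p.1) where
  contDiffOn := hf.comp contDiffOn_fst (fun p hp => hp.1)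
  growth := by
    intro K hK hKD n
    have hs : UniqueDiffOn ℝ (D ×ˢ (univ : Set V)) := hD.prod uniqueDiffOn_univ
    have h1 : ContDiffOn ℝ ∞ (fun p : EB × V => f p.1) (D ×ˢ univ) :=
      hf.comp contDiffOn_fst (fun p hp => hp.1)
    have h2 : ContinuousOn (iteratedFDerivWithin ℝ n f D) K :=
      (hf.continuousOn_iteratedFDerivWithin (by exact_mod_cast le_top) hD).mono hKD
    obtain ⟨C, hC⟩ := (hK.image_of_continuousOn
      ((h1.continuousOn_iteratedFDerivWithin (m := n) (by exact_mod_cast le_top) hs).comp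
        (f := fun y : EB => (y, (0 : V))) (by fun_prop) (s := K)
        (fun y hy => ⟨hKD hy, mem_univ _⟩))).isBounded.exists_norm_le
    refine ⟨0, C, fun y hy v => ?_⟩
    have h3 : iteratedFDerivWithin ℝ n (fun p : EB × V => f p.1) (D ×ˢ univ) (y, v) =
        iteratedFDerivWithin ℝ n (fun p : EB × V => f p.1) (D ×ˢ univ) (y, 0) := by
      have h4 := iteratedFDerivWithin_comp_add_right (𝕜 := ℝ) (s := D ×ˢ (univ : Set V))
        (f := fun p : EB × V => f p.1) n ((0 : EB), v) (y, 0)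
      simp only [Prod.fst_add, add_zero, Prod.mk_add_mk, zero_add] at h4
      have h5 : ((0 : EB), v) +ᵥ D ×ˢ (univ : Set V) = D ×ˢ univ := by
        ext ⟨a, b⟩
        simp only [Set.mem_vadd_set, mem_prod, mem_univ, and_true, vadd_eq_add, Prod.exists,
          Prod.mk_add_mk, zero_add, Prod.mk.injEq]
        exact ⟨fun ⟨c, d, h, h', _⟩ => h' ▸ h, fun h => ⟨a, b - v, h, rfl, by simp⟩⟩
      rw [h4, h5]
    rw [h3, pow_zero, mul_one]
    exact hC _ ⟨y, hy, rfl⟩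

theorem exists_norm_le_sum_abs (V : Type*) [NormedAddCommGroup V] [NormedSpace ℝ V]
    [FiniteDimensional ℝ V] :
    ∃ (n : ℕ) (b : Fin n → V) (l : Fin n → V →L[ℝ] ℝ), ∀ v, v = ∑ i, l i v • b i := by
  let b := Module.finBasis ℝ V
  exact ⟨_, b, fun i => LinearMap.toContinuousLinearMap (b.coord i), fun v => (b.sum_repr v).symm⟩

/-- A class of functions that are bounded locally uniformly in the parameter and that is stable
under directional derivatives and under multiplication by linear functionals consists of
families of rapidly decreasing functions. -/
theorem RapidlyDecreasing.of_class [FiniteDimensional ℝ EB] [FiniteDimensional ℝ V]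
    (hD : UniqueDiffOn ℝ D) (𝒞 : Set (EB × V → ℂ))
    (hb : ∀ g ∈ 𝒞, ∀ K, IsCompact K → K ⊆ D → ∃ C : ℝ, ∀ y ∈ K, ∀ v, ‖g (y, v)‖ ≤ C)
    (hm : ∀ g ∈ 𝒞, ∀ l : V →L[ℝ] ℝ, ∃ g₁ ∈ 𝒞, ∀ y ∈ D, ∀ v, g₁ (y, v) = (l v : ℂ) * g (y, v))
    (hd : ∀ g ∈ 𝒞, ∃ g' : EB × V → (EB × V →L[ℝ] ℂ),
      (∀ p ∈ D ×ˢ univ, HasFDerivWithinAt g (g' p) (D ×ˢ univ) p) ∧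
      ∀ e, ∃ g₁ ∈ 𝒞, ∀ p ∈ D ×ˢ univ, g' p e = g₁ p) :
    ∀ g ∈ 𝒞, RapidlyDecreasing D g := by
  have hs : UniqueDiffOn ℝ (D ×ˢ (univ : Set V)) := hD.prod uniqueDiffOn_univ
  have hd' : ∀ g ∈ 𝒞, DifferentiableOn ℝ g (D ×ˢ univ) ∧ ∀ e, ∃ g₁ ∈ 𝒞, ∀ p ∈ D ×ˢ univ,
      fderivWithin ℝ g (D ×ˢ univ) p e = g₁ p := by
    intro g hg
    obtain ⟨g', h1, h2⟩ := hd g hg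
    refine ⟨fun p hp => (h1 p hp).differentiableWithinAt, fun e => ?_⟩
    obtain ⟨g₁, hg₁, h3⟩ := h2 e
    exact ⟨g₁, hg₁, fun p hp => by rw [(h1 p hp).fderivWithin (hs p hp), h3 p hp]⟩
  have hsmooth : ∀ n : ℕ, ∀ g ∈ 𝒞, ContDiffOn ℝ n g (D ×ˢ univ) := by
    intro n
    induction n with
    | zero => exact fun g hg => contDiffOn_zero.2 (hd' g hg).1.continuousOn
    | succ n ih =>
      intro g hg
      push_cast
      -- In finite dimension the derivative is `C^n` as soon as its value on each fixed vector is,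
      -- and these values are again members of the class.
      refine contDiffOn_succ_of_fderivWithin (hd' g hg).1 (by simp) (contDiffOn_clm_apply.2 ?_)
      intro e
      obtain ⟨g₁, hg₁, h⟩ := (hd' g hg).2 e
      exact (ih g₁ hg₁).congr h
  have hsm : ∀ g ∈ 𝒞, ContDiffOn ℝ ∞ g (D ×ˢ univ) := fun g hg =>
    contDiffOn_infty.2 fun n => hsmooth n g hg
  have hzero : ∀ k : ℕ, ∀ g ∈ 𝒞, ∀ K, IsCompact K → K ⊆ D → ∃ C : ℝ, ∀ y ∈ K, ∀ v,
      ‖v‖ ^ k * ‖g (y, v)‖ ≤ C := by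
    intro k
    induction k with
    | zero => simpa using hb
    | succ k ih =>
      intro g hg K hK hKD
      obtain ⟨N, b, l, hbl⟩ := exists_norm_le_sum_abs V
      choose g₁ hg₁ h₁ using fun i => hm g hg (l i)
      choose C hC using fun i => ih (g₁ i) (hg₁ i) K hK hKD
      -- One factor `‖v‖` is traded for the coordinates `l i v`; multiplication by such a coordinate
      -- stays in the class.
      refine ⟨∑ i, ‖b i‖ * C i, fun y hy v => ?_⟩
      have hv : ‖v‖ ≤ ∑ i, ‖b i‖ * |l i v| := by
        conv_lhs => rw [hbl v]
        refine (norm_sum_le _ _).trans (Finset.sum_le_sum fun i _ => ?_)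
        rw [norm_smul, Real.norm_eq_abs, mul_comm]
      calc ‖v‖ ^ (k + 1) * ‖g (y, v)‖ = ‖v‖ * (‖v‖ ^ k * ‖g (y, v)‖) := by ring
        _ ≤ (∑ i, ‖b i‖ * |l i v|) * (‖v‖ ^ k * ‖g (y, v)‖) := by gcongr
        _ = ∑ i, ‖b i‖ * (‖v‖ ^ k * ‖g₁ i (y, v)‖) := by
          rw [Finset.sum_mul]
          refine Finset.sum_congr rfl fun i _ => ?_
          rw [h₁ i y (hKD hy) v, norm_mul, Complex.norm_real, Real.norm_eq_abs]
          ring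
        _ ≤ _ := by gcongr with i; exact hC i y hy v
  have hdecay : ∀ n : ℕ, ∀ g ∈ 𝒞, ∀ K, IsCompact K → K ⊆ D → ∀ k : ℕ, ∃ C : ℝ, ∀ y ∈ K,
      ∀ v, ‖v‖ ^ k * ‖iteratedFDerivWithin ℝ n g (D ×ˢ univ) (y, v)‖ ≤ C := by
    intro n
    induction n with
    | zero =>
      intro g hg K hK hKD k
      obtain ⟨C, hC⟩ := hzero k g hg K hK hKD
      exact ⟨C, fun y hy v => by rw [norm_iteratedFDerivWithin_zero]; exact hC y hy v⟩
    | succ n ih =>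
      intro g hg K hK hKD k
      obtain ⟨N, b, l, hbl⟩ := exists_norm_le_sum_abs (EB × V)
      choose g₁ hg₁ h₁ using fun i => (hd' g hg).2 (b i)
      choose C hC using fun i => ih (g₁ i) (hg₁ i) K hK hKD k
      let T : Fin N → ℂ →L[ℝ] (EB × V →L[ℝ] ℂ) := fun i =>
        ContinuousLinearMap.smulRightL ℝ (EB × V) ℂ (l i)
      refine ⟨∑ i, ‖T i‖ * C i, fun y hy v => ?_⟩
      have hmem : (y, v) ∈ D ×ˢ (univ : Set V) := ⟨hKD hy, mem_univ _⟩
      -- The derivative is a combination, with constant coefficients `T i`, of members of the class,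
      -- so decay at order `n` passes to order `n + 1`.
      have e1 : EqOn (fderivWithin ℝ g (D ×ˢ univ)) (fun p => ∑ i, (T i ∘ g₁ i) p)
          (D ×ˢ univ) := by
        intro p hp
        refine ContinuousLinearMap.ext fun e => ?_
        conv_lhs => rw [hbl e, map_sum]
        simp only [Function.comp_apply, sum_apply]
        refine Finset.sum_congr rfl fun i _ => ?_
        rw [map_smul, h₁ i p hp]
        simp [T]
      have hci : ∀ i, ContDiffWithinAt ℝ n (g₁ i) (D ×ˢ univ) (y, v) := fun i =>
        hsmooth n _ (hg₁ i) _ hmem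
      rw [← norm_iteratedFDerivWithin_fderivWithin hs hmem, iteratedFDerivWithin_congr e1 hmem,
        iteratedFDerivWithin_fun_sum_apply hs hmem
          (fun i _ => (T i).contDiff.comp_contDiffWithinAt (hci i))]
      calc _ ≤ ‖v‖ ^ k * ∑ i, ‖T i‖ *
            ‖iteratedFDerivWithin ℝ n (g₁ i) (D ×ˢ univ) (y, v)‖ := by
            gcongr
            refine (norm_sum_le _ _).trans (Finset.sum_le_sum fun i _ => ?_)
            exact (T i).norm_iteratedFDerivWithin_comp_left (hci i) hs hmem le_rfl
        _ = ∑ i, ‖T i‖ * (‖v‖ ^ k *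
            ‖iteratedFDerivWithin ℝ n (g₁ i) (D ×ˢ univ) (y, v)‖) := by
            rw [Finset.mul_sum]
            exact Finset.sum_congr rfl fun i _ => by ring
        _ ≤ _ := by gcongr with i; exact hC i y hy v
  exact fun g hg => ⟨hsm g hg, fun K hK hKD k n => hdecay n g hg K hK hKD k⟩

end RapidDecrease

/-! ### Fourier integrals of families of rapidly decreasing functions -/

section ParamFourier

variable {EB : Type*} [NormedAddCommGroup EB] [NormedSpace ℝ EB]
  {V : Type*} [NormedAddCommGroup V] [NormedSpace ℝ V] [FiniteDimensional ℝ V]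
  [MeasurableSpace V] [BorelSpace V]
  {V' : Type*} [NormedAddCommGroup V'] [NormedSpace ℝ V']
  {D : Set EB} {g : EB × V → ℂ}

theorem RapidlyDecreasing.differentiableWithinAt (hg : RapidlyDecreasing D g) {y : EB}
    (hy : y ∈ D) (v : V) : DifferentiableWithinAt ℝ g (D ×ˢ univ) (y, v) :=
  hg.contDiffOn.differentiableOn (by simp) _ ⟨hy, mem_univ _⟩

theorem RapidlyDecreasing.continuous_apply (hg : RapidlyDecreasing D g) {y : EB} (hy : y ∈ D) :
    Continuous fun v => g (y, v) :=
  hg.contDiffOn.continuousOn.comp_continuous (by fun_prop) fun v => ⟨hy, mem_univ v⟩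

theorem RapidlyDecreasing.continuous_fderivWithin (hD : UniqueDiffOn ℝ D)
    (hg : RapidlyDecreasing D g) {y : EB} (hy : y ∈ D) :
    Continuous fun v => fderivWithin ℝ g (D ×ˢ univ) (y, v) :=
  (hg.contDiffOn.continuousOn_fderivWithin (hD.prod uniqueDiffOn_univ)
    (by simp)).comp_continuous (by fun_prop) fun v => ⟨hy, mem_univ v⟩

theorem RapidlyDecreasing.hasFDerivAt_apply (hg : RapidlyDecreasing D g) {y : EB} (hy : y ∈ D)
    (v : V) : HasFDerivAt (fun v => g (y, v))
      ((fderivWithin ℝ g (D ×ˢ univ) (y, v)).comp (ContinuousLinearMap.inr ℝ EB V)) v := by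
  have h1 := (hg.differentiableWithinAt hy v).hasFDerivWithinAt
  have h2 : HasFDerivWithinAt (fun v : V => (y, v)) (ContinuousLinearMap.inr ℝ EB V) univ v :=
    (hasFDerivAt_prodMk_right y v).hasFDerivWithinAt
  exact (h1.comp v h2 (fun w _ => ⟨hy, mem_univ w⟩)).hasFDerivAt (Filter.univ_mem)

/-- The decay requested has `dim V + 1` orders more than the weight `‖v‖ ^ k`; this leaves the
integrable factor `(1 + ‖v‖) ^ (-(dim V + 1))`. The bound is common to all parameters in `K`, as
domination under the integral sign demands. -/
theorem RapidlyDecreasing.exists_integrable_bound (hg : RapidlyDecreasing D g) (ν : Measure V)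
    [ν.IsAddHaarMeasure] {K : Set EB} (hK : IsCompact K) (hKD : K ⊆ D) (k n : ℕ) :
    ∃ B : V → ℝ, Integrable B ν ∧ ∀ y ∈ K, ∀ v, ‖v‖ ^ k *
      ‖iteratedFDerivWithin ℝ n g (D ×ˢ univ) (y, v)‖ ≤ B v := by
  obtain ⟨C, hC0, hC⟩ := hg.exists_bound hK hKD (k + (Module.finrank ℝ V + 1)) n
  refine ⟨fun v => C * (1 + ‖v‖) ^ (-((Module.finrank ℝ V + 1 : ℕ) : ℝ)),
    (integrable_one_add_norm (by push_cast; linarith)).const_mul C, fun y hy v => ?_⟩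
  have h1 : (0 : ℝ) < 1 + ‖v‖ := by positivity
  beta_reduce
  rw [Real.rpow_neg h1.le, Real.rpow_natCast, ← div_eq_mul_inv, le_div_iff₀ (by positivity)]
  refine le_trans ?_ (hC y hy v)
  rw [mul_right_comm, pow_add (1 + ‖v‖) k]
  gcongr
  linarith

theorem RapidlyDecreasing.integrable (hg : RapidlyDecreasing D g) (ν : Measure V)
    [ν.IsAddHaarMeasure] {y : EB} (hy : y ∈ D) : Integrable (fun v => g (y, v)) ν := by
  obtain ⟨B, hB, h⟩ := hg.exists_integrable_bound ν (isCompact_singleton (x := y))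
    (singleton_subset_iff.2 hy) 0 0
  refine hB.mono' (hg.continuous_apply hy).aestronglyMeasurable (.of_forall fun v => ?_)
  simpa using h y rfl v

/-- The oscillatory factor `e^{-i t}`. -/
theorem norm_exp_neg_I_mul (t : ℝ) : ‖Complex.exp (-Complex.I * (t : ℂ))‖ = 1 := by
  rw [show -Complex.I * (t : ℂ) = ((-t : ℝ) : ℂ) * Complex.I by push_cast; ring,
    Complex.norm_exp_ofReal_mul_I]

theorem hasFDerivAt_exp_neg_I_mul {W : Type*} [NormedAddCommGroup W] [NormedSpace ℝ W]
    (l : W →L[ℝ] ℝ) (w : W) :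
    HasFDerivAt (fun w => Complex.exp (-Complex.I * (l w : ℂ)))
      (l.smulRight (Complex.exp (-Complex.I * (l w : ℂ)) * -Complex.I)) w := by
  have h1 : HasFDerivAt (fun w => -Complex.I * (l w : ℂ)) (l.smulRight (-Complex.I)) w := by
    have h2 := ((l.smulRight (-Complex.I)).hasFDerivAt (x := w))
    refine h2.congr_of_eventuallyEq (.of_forall fun w => ?_)
    simp [mul_comm]
  have h2 := h1.cexp
  convert! h2 using 1
  ext e
  simp
  ring

variable [FiniteDimensional ℝ V']

/-- The Fourier integral `∫ e^{-i L(v, ξ)} g(y, v) dν(v)` with respect to a pairing `L`. -/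
def paramFourier (ν : Measure V) (L : V →L[ℝ] V' →L[ℝ] ℝ) (g : EB × V → ℂ) : EB × V' → ℂ :=
  fun p => ∫ v, Complex.exp (-Complex.I * (L v p.2 : ℂ)) * g (p.1, v) ∂ν

variable (ν : Measure V) [ν.IsAddHaarMeasure] (L : V →L[ℝ] V' →L[ℝ] ℝ)

theorem continuous_fourierKernel (ξ : V') :
    Continuous fun v => Complex.exp (-Complex.I * (L v ξ : ℂ)) := by
  have : Continuous fun v => L v ξ := (L.flip ξ).continuous
  fun_prop

theorem RapidlyDecreasing.integrable_fourier (hg : RapidlyDecreasing D g) {y : EB}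
    (hy : y ∈ D) (ξ : V') :
    Integrable (fun v => Complex.exp (-Complex.I * (L v ξ : ℂ)) * g (y, v)) ν :=
  (hg.integrable ν hy).mono
    ((continuous_fourierKernel L ξ).mul (hg.continuous_apply hy)).aestronglyMeasurable
    (.of_forall fun v => by rw [norm_mul, norm_exp_neg_I_mul, one_mul])

/-- Integration by parts in the direction `w`: differentiating the kernel `e^{-i L(v, ξ)}` along `w`
produces the factor `-i L(w, ξ)`. -/
theorem functional_mul_paramFourier (hD : UniqueDiffOn ℝ D)
    (hg : RapidlyDecreasing D g) (w : V) {y : EB} (hy : y ∈ D) (ξ : V') :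
    (L w ξ : ℂ) * paramFourier ν L g (y, ξ) = paramFourier ν L
      (fun p => -Complex.I * fderivWithin ℝ g (D ×ˢ univ) p ((0 : EB), w)) (y, ξ) := by
  have hg' := hg.fderivWithin_apply hD ((0 : EB), w)
  have hi := hg.integrable_fourier ν L hy ξ
  have h := integral_bilinear_hasFDerivAt_right_eq_neg_left_of_integrable (μ := ν) (v := w)
    (B := ContinuousLinearMap.mul ℝ ℂ)
    (f := fun v => Complex.exp (-Complex.I * (L v ξ : ℂ)))
    (f' := fun v => (L.flip ξ).smulRight (Complex.exp (-Complex.I * (L v ξ : ℂ)) * -Complex.I))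
    (g := fun v => g (y, v))
    (g' := fun v => (fderivWithin ℝ g (D ×ˢ univ) (y, v)).comp (ContinuousLinearMap.inr ℝ EB V))
    ?_ ?_ ?_ (fun v _ => hasFDerivAt_exp_neg_I_mul (L.flip ξ) v)
    (fun v _ => hg.hasFDerivAt_apply hy v)
  · simp only [ContinuousLinearMap.mul_apply', ContinuousLinearMap.comp_apply,
      ContinuousLinearMap.inr_apply, ContinuousLinearMap.smulRight_apply,
      ContinuousLinearMap.flip_apply] at h
    have e1 : paramFourier ν L (fun p => -Complex.I * fderivWithin ℝ g (D ×ˢ univ) p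
        ((0 : EB), w)) (y, ξ) = -Complex.I * ∫ v, Complex.exp (-Complex.I * (L v ξ : ℂ)) *
          fderivWithin ℝ g (D ×ˢ univ) (y, v) ((0 : EB), w) ∂ν := by
      rw [paramFourier, ← integral_const_mul]
      exact integral_congr_ae (.of_forall fun v => by ring)
    rw [e1, h]
    have e2 : ∫ v, L w ξ • (Complex.exp (-Complex.I * (L v ξ : ℂ)) * -Complex.I) * g (y, v) ∂ν =
        (-Complex.I * (L w ξ : ℂ)) * paramFourier ν L g (y, ξ) := by
      rw [paramFourier, ← integral_const_mul]
      refine integral_congr_ae (.of_forall fun v => ?_)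
      simp only [Complex.real_smul]
      ring
    rw [e2]
    linear_combination (L w ξ : ℂ) * paramFourier ν L g (y, ξ) * Complex.I_sq
  · refine (hi.const_mul ((L w ξ : ℂ) * -Complex.I)).congr (.of_forall fun v => ?_)
    simp only [ContinuousLinearMap.mul_apply', ContinuousLinearMap.smulRight_apply,
      ContinuousLinearMap.flip_apply, Complex.real_smul]
    ring
  · exact hg'.integrable_fourier ν L hy ξ
  · exact hi

/-- The derivative of the integrand of the Fourier integral. -/
def fourierIntegrandDeriv (D : Set EB) (g : EB × V → ℂ) (p : EB × V') (v : V) :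
    EB × V' →L[ℝ] ℂ :=
  Complex.exp (-Complex.I * (L v p.2 : ℂ)) •
    (((fderivWithin ℝ g (D ×ˢ univ) (p.1, v)).comp
      ((ContinuousLinearMap.inl ℝ EB V).comp (ContinuousLinearMap.fst ℝ EB V'))) +
      ((L v).comp (ContinuousLinearMap.snd ℝ EB V')).smulRight (-Complex.I * g (p.1, v)))

theorem norm_fourierIntegrandDeriv_le (D : Set EB) (g : EB × V → ℂ) (p : EB × V') (v : V) :
    ‖fourierIntegrandDeriv L D g p v‖ ≤
      ‖fderivWithin ℝ g (D ×ˢ univ) (p.1, v)‖ + ‖L‖ * (‖v‖ * ‖g (p.1, v)‖) := by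
  rw [fourierIntegrandDeriv, norm_smul, norm_exp_neg_I_mul, one_mul]
  refine (norm_add_le _ _).trans (add_le_add ?_ ?_)
  · refine ContinuousLinearMap.opNorm_le_bound _ (norm_nonneg _) fun e => ?_
    refine ((fderivWithin ℝ g (D ×ˢ univ) (p.1, v)).le_opNorm _).trans ?_
    gcongr
    change ‖(e.1, (0 : V))‖ ≤ ‖e‖
    rw [Prod.norm_mk, norm_zero]
    exact max_le (norm_fst_le e) (norm_nonneg e)
  · refine ContinuousLinearMap.opNorm_le_bound _ (by positivity) fun e => ?_
    simp only [ContinuousLinearMap.smulRight_apply, ContinuousLinearMap.comp_apply,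
      ContinuousLinearMap.coe_snd', norm_smul, norm_mul, norm_neg, Complex.norm_I, one_mul]
    calc ‖L v e.2‖ * ‖g (p.1, v)‖ ≤ ‖L‖ * ‖v‖ * ‖e‖ * ‖g (p.1, v)‖ := by
          gcongr
          exact (L.le_opNorm₂ v e.2).trans (by gcongr; exact norm_snd_le e)
      _ = _ := by ring

theorem hasFDerivWithinAt_fourierIntegrand (hg : RapidlyDecreasing D g) {p : EB × V'}
    (hp : p.1 ∈ D) (v : V) :
    HasFDerivWithinAt (fun p : EB × V' => Complex.exp (-Complex.I * (L v p.2 : ℂ)) * g (p.1, v))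
      (fourierIntegrandDeriv L D g p v) (D ×ˢ univ) p := by
  have h1 := (hg.differentiableWithinAt hp v).hasFDerivWithinAt
  have h2 : HasFDerivWithinAt (fun p : EB × V' => (p.1, v))
      ((ContinuousLinearMap.inl ℝ EB V).comp (ContinuousLinearMap.fst ℝ EB V')) (D ×ˢ univ) p :=
    (HasFDerivAt.comp (f := fun p : EB × V' => p.1) (g := fun y : EB => (y, v)) p
      (hasFDerivAt_prodMk_left p.1 v) hasFDerivAt_fst).hasFDerivWithinAt
  have hmaps : MapsTo (fun p : EB × V' => (p.1, v)) (D ×ˢ univ) (D ×ˢ univ) :=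
    fun q hq => ⟨hq.1, mem_univ v⟩
  have h3 := h1.comp p h2 hmaps
  have h4 := (hasFDerivAt_exp_neg_I_mul ((L v).comp (ContinuousLinearMap.snd ℝ EB V'))
    p).hasFDerivWithinAt (s := D ×ˢ univ)
  convert! h4.mul h3 using 1
  ext e
  · simp [fourierIntegrandDeriv]
  · simp [fourierIntegrandDeriv]
    ring

/-- The kernel has modulus one, so the derivative of the integrand is dominated independently of
`ξ`, and over a compact convex neighbourhood `K` of the parameter independently of `y`. -/
theorem paramFourier_hasFDerivWithinAt (hD : UniqueDiffOn ℝ D)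
    (hDc : ∀ y ∈ D, ∃ K ⊆ D, IsCompact K ∧ Convex ℝ K ∧ K ∈ nhdsWithin y D)
    (hg : RapidlyDecreasing D g) (p : EB × V') (hp : p ∈ D ×ˢ (univ : Set V')) :
    Integrable (fourierIntegrandDeriv L D g p) ν ∧
    HasFDerivWithinAt (paramFourier ν L g) (∫ v, fourierIntegrandDeriv L D g p v ∂ν)
      (D ×ˢ univ) p := by
  obtain ⟨K, hKD, hK, hKc, hKn⟩ := hDc p.1 hp.1
  obtain ⟨B₁, hB₁, h₁⟩ := hg.exists_integrable_bound ν hK hKD 0 1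
  obtain ⟨B₂, hB₂, h₂⟩ := hg.exists_integrable_bound ν hK hKD 1 0
  have hKp : p.1 ∈ K := mem_of_mem_nhdsWithin hp.1 hKn
  have hbd : ∀ v, ∀ q ∈ K ×ˢ (univ : Set V'), ‖fourierIntegrandDeriv L D g q v‖ ≤
      B₁ v + ‖L‖ * B₂ v := by
    intro v q hq
    refine (norm_fourierIntegrandDeriv_le L D g q v).trans (add_le_add ?_ ?_)
    · have h3 := h₁ q.1 hq.1 v
      have hmem : (q.1, v) ∈ D ×ˢ (univ : Set V) := ⟨hKD hq.1, mem_univ v⟩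
      have hs : UniqueDiffOn ℝ (D ×ˢ (univ : Set V)) := hD.prod uniqueDiffOn_univ
      rwa [pow_zero, one_mul, ← zero_add 1, ← norm_iteratedFDerivWithin_fderivWithin
        hs hmem, norm_iteratedFDerivWithin_zero] at h3
    · have h3 := h₂ q.1 hq.1 v
      rw [pow_one, norm_iteratedFDerivWithin_zero] at h3
      gcongr
  have hmeas : AEStronglyMeasurable (fourierIntegrandDeriv L D g p) ν := by
    refine Continuous.aestronglyMeasurable ?_
    have h3 := hg.continuous_fderivWithin hD hp.1
    have h4 := hg.continuous_apply hp.1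
    have h5 := continuous_fourierKernel L p.2
    refine h5.smul (Continuous.add ?_ ?_)
    · exact h3.clm_comp continuous_const
    · have h6 : Continuous fun v : V => (ContinuousLinearMap.smulRightL ℝ (EB × V') ℂ)
          ((L v).comp (ContinuousLinearMap.snd ℝ EB V')) := by
        exact (ContinuousLinearMap.smulRightL ℝ (EB × V') ℂ).continuous.comp
          (L.continuous.clm_comp continuous_const)
      exact h6.clm_apply (continuous_const.mul h4)
  have hbi : Integrable (fun v => B₁ v + ‖L‖ * B₂ v) ν := hB₁.add (hB₂.const_mul _)
  refine ⟨hbi.mono' hmeas (.of_forall fun v => hbd v p ⟨hKp, mem_univ _⟩), ?_⟩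
  refine hasFDerivWithinAt_integral_of_dominated (t := K ×ˢ univ) ?_ ⟨hKp, mem_univ _⟩
    (hKc.prod convex_univ) (fun q hq => hg.integrable_fourier ν L (hKD hq.1) q.2) hmeas hbd hbi
    (fun v q hq => (hasFDerivWithinAt_fourierIntegrand L hg (hKD hq.1) v).mono
      (prod_mono hKD subset_rfl))
  rw [show p = (p.1, p.2) from rfl, nhdsWithin_prod_eq]
  exact Filter.prod_mem_prod hKn (by simp)

/-- Fourier integrals of families of rapidly decreasing functions are of the same kind. -/
theorem RapidlyDecreasing.paramFourier [FiniteDimensional ℝ EB] (hD : UniqueDiffOn ℝ D)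
    (hDc : ∀ y ∈ D, ∃ K ⊆ D, IsCompact K ∧ Convex ℝ K ∧ K ∈ nhdsWithin y D)
    (hL : ∀ l : V' →L[ℝ] ℝ, ∃ w, ∀ ξ, L w ξ = l ξ) (hg : RapidlyDecreasing D g) :
    RapidlyDecreasing D (paramFourier ν L g) := by
  -- The stable class consists of all Fourier integrals. Multiplication by `l = L w` corresponds to
  -- `-i ∂_w` under the integral, and the derivative in a direction `e` to adding `∂_{e.1} g` and
  -- `-i L(·, e.2) g`. Surjectivity of `L` onto the functionals is what makes every `l` available.
  refine RapidlyDecreasing.of_class hD {G | ∃ g, RapidlyDecreasing D g ∧ G = _root_.paramFourier ν L g}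
    ?_ ?_ ?_ _ ⟨g, hg, rfl⟩
  · rintro _ ⟨g, hg, rfl⟩ K hK hKD
    obtain ⟨B, hB, h⟩ := hg.exists_integrable_bound ν hK hKD 0 0
    refine ⟨∫ v, B v ∂ν, fun y hy ξ => norm_integral_le_of_norm_le hB (.of_forall fun v => ?_)⟩
    rw [norm_mul, norm_exp_neg_I_mul, one_mul]
    simpa using h y hy v
  · rintro _ ⟨g, hg, rfl⟩ l
    obtain ⟨w, hw⟩ := hL l
    refine ⟨_, ⟨_, RapidlyDecreasing.mul hD (g := fun _ => -Complex.I)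
      (ModeratelyGrowing.fst hD (f := fun _ => -Complex.I) contDiffOn_const)
      (hg.fderivWithin_apply hD ((0 : EB), w)), rfl⟩, fun y hy ξ => ?_⟩
    rw [← functional_mul_paramFourier ν L hD hg w hy ξ, hw]
  · rintro _ ⟨g, hg, rfl⟩
    refine ⟨_, fun p hp => (paramFourier_hasFDerivWithinAt ν L hD hDc hg p hp).2, fun e => ?_⟩
    have hl : ModeratelyGrowing D (fun p : EB × V => -Complex.I * (L p.2 e.2 : ℂ)) := by
      refine ModeratelyGrowing.snd hD (f := fun v => -Complex.I * (L v e.2 : ℂ)) ?_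
      have h1 := ((L.flip e.2).smulRight (-Complex.I)).hasTemperateGrowth
      convert! h1 using 1
      ext v
      simp [mul_comm]
    refine ⟨_, ⟨_, (hg.fderivWithin_apply hD (e.1, (0 : V))).add hD (RapidlyDecreasing.mul hD hl hg), rfl⟩,
      fun p hp => ?_⟩
    rw [ContinuousLinearMap.integral_apply
      (paramFourier_hasFDerivWithinAt ν L hD hDc hg p hp).1, _root_.paramFourier]
    refine integral_congr_ae (.of_forall fun v => ?_)
    simp only [fourierIntegrandDeriv, smul_add, Pi.add_apply, add_apply,
      smul_apply, ContinuousLinearMap.comp_apply,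
      ContinuousLinearMap.coe_fst', ContinuousLinearMap.inl_apply,
      ContinuousLinearMap.smulRight_apply, ContinuousLinearMap.coe_snd', Complex.real_smul,
      smul_eq_mul]
    ring

end ParamFourier

/-! ### Fourier inversion and convolution for a vector space and its dual -/

section DualFourier

open FourierTransform

theorem exists_map_eq_smul_volume {W : Type*} [AddCommGroup W] [Module ℝ W]
    [TopologicalSpace W] [MeasurableSpace W] [BorelSpace W] [IsTopologicalAddGroup W]
    {V : Type*} [NormedAddCommGroup V]
    [InnerProductSpace ℝ V] [FiniteDimensional ℝ V] [MeasurableSpace V] [BorelSpace V]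
    (m : Measure W) [m.IsAddHaarMeasure] (T : W ≃L[ℝ] V) :
    ∃ c : ℝ, 0 < c ∧ m.map T = ENNReal.ofReal c • (volume : Measure V) := by
  have : (m.map T).IsAddHaarMeasure := T.isAddHaarMeasure_map m
  refine ⟨(Measure.addHaarScalarFactor (m.map T) (volume : Measure V) : ℝ), ?_, ?_⟩
  · exact_mod_cast Measure.addHaarScalarFactor_pos_of_isAddHaarMeasure _ _
  · rw [ENNReal.ofReal_coe_nnreal]
    exact Measure.isAddLeftInvariant_eq_smul _ _

theorem integral_comp_of_map_eq_smul {W V : Type*} [TopologicalSpace W] [MeasurableSpace W]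
    [BorelSpace W] [TopologicalSpace V] [MeasurableSpace V] [BorelSpace V] {m : Measure W}
    {n : Measure V} (T : W ≃ₜ V) {c : ℝ} (hc : 0 ≤ c) (h : m.map T = ENNReal.ofReal c • n)
    (φ : V → ℂ) : ∫ w, φ (T w) ∂m = c * ∫ v, φ v ∂n := by
  rw [← T.measurableEmbedding.integral_map, h, integral_smul_measure,
    ENNReal.toReal_ofReal hc, Complex.real_smul]

theorem integrable_comp_iff_of_map_eq_smul {W V : Type*} [TopologicalSpace W] [MeasurableSpace W]
    [BorelSpace W] [TopologicalSpace V] [MeasurableSpace V] [BorelSpace V] {m : Measure W}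
    {n : Measure V} (T : W ≃ₜ V) {c : ℝ} (hc : 0 < c) (h : m.map T = ENNReal.ofReal c • n)
    (φ : V → ℂ) : Integrable (fun w => φ (T w)) m ↔ Integrable φ n := by
  have h1 := T.measurableEmbedding.integrable_map_iff (μ := m) (g := φ)
  rw [h, integrable_smul_measure (by simpa using hc) ENNReal.ofReal_ne_top] at h1
  exact h1.symm

variable (F : Type*) [NormedAddCommGroup F] [NormedSpace ℝ F] [FiniteDimensional ℝ F]

/-- The pairing of `F` with its dual. -/
def evalPairing : F →L[ℝ] (F →L[ℝ] ℝ) →L[ℝ] ℝ := (ContinuousLinearMap.id ℝ (F →L[ℝ] ℝ)).flip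

/-- The negative of the pairing of the dual of `F` with `F`. -/
def negPairing : (F →L[ℝ] ℝ) →L[ℝ] F →L[ℝ] ℝ := -ContinuousLinearMap.id ℝ (F →L[ℝ] ℝ)

variable {F}

@[simp] theorem evalPairing_apply (v : F) (ξ : F →L[ℝ] ℝ) : evalPairing F v ξ = ξ v := rfl

@[simp] theorem negPairing_apply (v : F) (ξ : F →L[ℝ] ℝ) : negPairing F ξ v = -ξ v := rfl

theorem evalPairing_surjective (l : (F →L[ℝ] ℝ) →L[ℝ] ℝ) :
    ∃ w, ∀ ξ, evalPairing F w ξ = l ξ := by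
  obtain ⟨w, hw⟩ := (Module.evalEquiv ℝ F).surjective
    (l.toLinearMap.comp (LinearMap.toContinuousLinearMap : (F →ₗ[ℝ] ℝ) ≃ₗ[ℝ] _).toLinearMap)
  refine ⟨w, fun ξ => ?_⟩
  have h := LinearMap.congr_fun hw (ξ : F →ₗ[ℝ] ℝ)
  simpa using! h

theorem negPairing_surjective (l : F →L[ℝ] ℝ) : ∃ ξ, ∀ w, negPairing F ξ w = l w :=
  ⟨-l, fun w => by simp⟩

/-- A Euclidean space together with compatible coordinates on `F` and on its dual. -/
theorem exists_dual_coordinates (T : F ≃L[ℝ] EuclideanSpace ℝ (Fin (Module.finrank ℝ F))) :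
    ∃ A : EuclideanSpace ℝ (Fin (Module.finrank ℝ F)) ≃L[ℝ] (F →L[ℝ] ℝ),
      ∀ a v, A a v = 2 * Real.pi * inner ℝ (T v) a := by
  have hpi : (2 * Real.pi) ≠ 0 := by positivity
  let V := EuclideanSpace ℝ (Fin (Module.finrank ℝ F))
  let e : V ≃L[ℝ] (V →L[ℝ] ℝ) := (InnerProductSpace.toDual ℝ V).toContinuousLinearEquiv
  refine ⟨(ContinuousLinearEquiv.smulLeft (Units.mk0 (2 * Real.pi) hpi)).trans
    (e.trans (T.symm.arrowCongr (ContinuousLinearEquiv.refl ℝ ℝ))), fun a v => ?_⟩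
  change InnerProductSpace.toDual ℝ V ((2 * Real.pi) • a) (T v) = _
  rw [InnerProductSpace.toDual_apply_apply, real_inner_comm, inner_smul_right]

variable [MeasurableSpace F] [BorelSpace F]

/-- Fourier inversion between a finite dimensional space and its dual, for arbitrary Haar
measures. -/
theorem exists_fourier_inversion_constant (lam : Measure F) [lam.IsAddHaarMeasure]
    (ν : Measure (F →L[ℝ] ℝ)) [ν.IsAddHaarMeasure] :
    ∃ κ : ℝ, 0 < κ ∧
    (∀ H : (F →L[ℝ] ℝ) → ℂ, Continuous H → Integrable H ν →
      Integrable (fun v => ∫ ξ, Complex.exp (-Complex.I * (negPairing F ξ v : ℂ)) * H ξ ∂ν) lam →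
      ∀ ξ, ∫ v, Complex.exp (-Complex.I * (ξ v : ℂ)) *
        (∫ ξ, Complex.exp (-Complex.I * (negPairing F ξ v : ℂ)) * H ξ ∂ν) ∂lam = κ * H ξ) ∧
    (∀ g : F → ℂ, Continuous g → Integrable g lam →
      Integrable (fun ξ : F →L[ℝ] ℝ => ∫ v, Complex.exp (-Complex.I * (ξ v : ℂ)) * g v ∂lam) ν →
      ∀ v, ∫ ξ, Complex.exp (-Complex.I * (negPairing F ξ v : ℂ)) *
        (∫ v, Complex.exp (-Complex.I * (ξ v : ℂ)) * g v ∂lam) ∂ν = κ * g v) := by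
  let T : F ≃L[ℝ] EuclideanSpace ℝ (Fin (Module.finrank ℝ F)) := toEuclidean
  obtain ⟨A, hA⟩ := exists_dual_coordinates T
  obtain ⟨c, hc, hT⟩ := exists_map_eq_smul_volume lam T
  obtain ⟨c', hc', hA'⟩ := exists_map_eq_smul_volume ν A.symm
  -- The coordinates `T` and `A` turn the pairing into `2π` times the inner product, which is the
  -- normalization of `𝓕`.
  have key1 : ∀ g : F → ℂ, ∀ a, ∫ v, Complex.exp (-Complex.I * (A a v : ℂ)) * g v ∂lam =
      c * 𝓕 (fun u => g (T.symm u)) a := by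
    intro g a
    rw [Real.fourier_eq', ← integral_comp_of_map_eq_smul T.toHomeomorph hc.le hT]
    refine integral_congr_ae (.of_forall fun v => ?_)
    simp only [ContinuousLinearEquiv.coe_toHomeomorph, ContinuousLinearEquiv.symm_apply_apply,
      smul_eq_mul, hA]
    congr 2
    push_cast
    ring
  have key2 : ∀ H : (F →L[ℝ] ℝ) → ℂ, ∀ v,
      ∫ ξ, Complex.exp (-Complex.I * (negPairing F ξ v : ℂ)) * H ξ ∂ν =
      c' * 𝓕⁻ (fun a => H (A a)) (T v) := by
    intro H v
    rw [Real.fourierInv_eq', ← integral_comp_of_map_eq_smul A.symm.toHomeomorph hc'.le hA']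
    refine integral_congr_ae (.of_forall fun ξ => ?_)
    have h1 : (ξ v : ℝ) = 2 * Real.pi * inner ℝ (T v) (A.symm ξ) := by
      rw [← hA, ContinuousLinearEquiv.apply_symm_apply]
    simp only [ContinuousLinearEquiv.coe_toHomeomorph, ContinuousLinearEquiv.apply_symm_apply,
      smul_eq_mul, negPairing_apply, h1, real_inner_comm (T v)]
    congr 2
    push_cast
    ring
  have hcne : (c : ℂ) ≠ 0 := by exact_mod_cast hc.ne'
  have hcne' : (c' : ℂ) ≠ 0 := by exact_mod_cast hc'.ne'
  -- `κ` is the product of the densities of the two Haar measures relative to Lebesgue measure in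
  -- the coordinates `T` and `A.symm`.
  refine ⟨c * c', by positivity, fun H hHc hHi hi ξ => ?_, fun g hgc hgi hi v => ?_⟩
  · obtain ⟨a, rfl⟩ := A.surjective ξ
    simp only [key2] at hi ⊢
    rw [key1]
    simp only [ContinuousLinearEquiv.apply_symm_apply]
    have hHA : Integrable (fun a => H (A a)) := by
      have := (integrable_comp_iff_of_map_eq_smul A.symm.toHomeomorph hc' hA'
        (fun a => H (A a))).1
      simp only [ContinuousLinearEquiv.coe_toHomeomorph,
        ContinuousLinearEquiv.apply_symm_apply] at this
      exact this hHi
    have hi2 : Integrable (𝓕⁻ (fun a => H (A a))) := by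
      have h1 := (integrable_comp_iff_of_map_eq_smul T.toHomeomorph hc hT
        (fun u => c' * 𝓕⁻ (fun a => H (A a)) u)).1 hi
      exact (integrable_const_mul_iff (IsUnit.mk0 _ hcne') _).1 h1
    have hi3 : Integrable (𝓕 (fun a => H (A a))) := by
      have := hi2.comp_neg
      simpa only [Real.fourierInv_eq_fourier_neg, neg_neg] using this
    have h2 := congr_fun ((hHc.comp A.continuous).fourier_fourierInv_eq hHA hi3) a
    have h3 : 𝓕 (fun u => (c' : ℂ) * 𝓕⁻ (fun a => H (A a)) u) a =
        c' * 𝓕 (𝓕⁻ (fun a => H (A a))) a := by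
      rw [Real.fourier_eq', Real.fourier_eq', ← integral_const_mul]
      refine integral_congr_ae (.of_forall fun u => ?_)
      simp only [smul_eq_mul]
      ring
    rw [h3]
    change _ * (_ * 𝓕 (𝓕⁻ (H ∘ A)) a) = _
    rw [h2, Function.comp_apply]
    push_cast
    ring
  · rw [key2]
    simp only [key1]
    have hgT : Integrable (fun u => g (T.symm u)) := by
      have := (integrable_comp_iff_of_map_eq_smul T.toHomeomorph hc hT
        (fun u => g (T.symm u))).1
      simp only [ContinuousLinearEquiv.coe_toHomeomorph,
        ContinuousLinearEquiv.symm_apply_apply] at this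
      exact this hgi
    have hi2 : Integrable (𝓕 (fun u => g (T.symm u))) := by
      have h1 := (integrable_comp_iff_of_map_eq_smul A.symm.toHomeomorph hc' hA'
        (fun a => c * 𝓕 (fun u => g (T.symm u)) a)).1
      simp only [ContinuousLinearEquiv.coe_toHomeomorph, ← key1,
        ContinuousLinearEquiv.apply_symm_apply] at h1
      have h2 := h1 hi
      simp only [key1] at h2
      exact (integrable_const_mul_iff (IsUnit.mk0 _ hcne) _).1 h2
    have h2 := congr_fun ((hgc.comp T.symm.continuous).fourierInv_fourier_eq hgT hi2) (T v)
    have h3 : 𝓕⁻ (fun a => (c : ℂ) * 𝓕 (fun u => g (T.symm u)) a) (T v) =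
        c * 𝓕⁻ (𝓕 (fun u => g (T.symm u))) (T v) := by
      rw [Real.fourierInv_eq', Real.fourierInv_eq', ← integral_const_mul]
      refine integral_congr_ae (.of_forall fun u => ?_)
      simp only [smul_eq_mul]
      ring
    rw [h3]
    change _ * (_ * 𝓕⁻ (𝓕 (g ∘ T.symm)) (T v)) = _
    rw [h2, Function.comp_apply, ContinuousLinearEquiv.symm_apply_apply]
    push_cast
    ring

open Convolution in
-- Since `v ↦ e^{-i ξ(v)}` is multiplicative, multiplying by it commutes with convolution, and the
-- integral of a convolution is the product of the integrals. Boundedness of `f` makes the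
-- convolution exist at every point, not just almost everywhere, and makes it continuous.
theorem fourier_convolution_dual (lam : Measure F) [lam.IsAddHaarMeasure] {f g : F → ℂ}
    (hf : Continuous f) (hfb : ∃ C, ∀ v, ‖f v‖ ≤ C) (hfi : Integrable f lam)
    (hg : Continuous g) (hgi : Integrable g lam) :
    (∀ v, Integrable (fun w => f (v - w) * g w) lam) ∧
    Continuous (fun v => ∫ w, f (v - w) * g w ∂lam) ∧
    Integrable (fun v => ∫ w, f (v - w) * g w ∂lam) lam ∧
    ∀ ξ : F →L[ℝ] ℝ,
      ∫ v, Complex.exp (-Complex.I * (ξ v : ℂ)) * (∫ w, f (v - w) * g w ∂lam) ∂lam =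
      (∫ v, Complex.exp (-Complex.I * (ξ v : ℂ)) * f v ∂lam) *
      ∫ v, Complex.exp (-Complex.I * (ξ v : ℂ)) * g v ∂lam := by
  have e : ∀ f g : F → ℂ, (fun v => ∫ w, f (v - w) * g w ∂lam) =
      (g ⋆[ContinuousLinearMap.mul ℝ ℂ, lam] f) := by
    intro f g
    funext v
    rw [convolution_def]
    exact integral_congr_ae (.of_forall fun w => mul_comm _ _)
  obtain ⟨C, hC⟩ := hfb
  refine ⟨fun v => ?_, ?_, ?_, fun ξ => ?_⟩
  · refine (hgi.norm.const_mul C).mono' ?_ (.of_forall fun w => ?_)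
    · exact ((hf.comp (by fun_prop)).mul hg).aestronglyMeasurable
    · rw [norm_mul]
      gcongr
      exact hC _
  · rw [e]
    refine BddAbove.continuous_convolution_right_of_integrable _ ?_ hgi hf
    exact ⟨C, by rintro _ ⟨v, rfl⟩; exact hC v⟩
  · rw [e]
    exact hgi.integrable_convolution _ hfi
  · have hm : ∀ h : F → ℂ, Continuous h → Integrable h lam →
        Integrable (fun v => Complex.exp (-Complex.I * (ξ v : ℂ)) * h v) lam := by
      intro h hc hi
      refine hi.mono (Continuous.aestronglyMeasurable ?_) (.of_forall fun v => ?_)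
      · have := ξ.continuous
        fun_prop
      · rw [norm_mul, norm_exp_neg_I_mul, one_mul]
    have h1 := integral_convolution (ContinuousLinearMap.mul ℝ ℂ) (hm g hg hgi) (hm f hf hfi)
    rw [← e] at h1
    simp only [ContinuousLinearMap.mul_apply'] at h1
    rw [mul_comm, ← h1]
    refine integral_congr_ae (.of_forall fun v => ?_)
    simp only [← integral_const_mul]
    refine integral_congr_ae (.of_forall fun w => ?_)
    simp only [map_sub]
    rw [show -Complex.I * (ξ v : ℂ) = -Complex.I * ((ξ v - ξ w : ℝ) : ℂ) +
      -Complex.I * (ξ w : ℂ) by push_cast; ring, Complex.exp_add]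
    ring

end DualFourier

/-! ### Functions on the total space in local trivializations -/

section BundleLocal

variable {EB : Type*} [NormedAddCommGroup EB] [NormedSpace ℝ EB]
  {HB : Type*} [TopologicalSpace HB] (I : ModelWithCorners ℝ EB HB)
  {X : Type*} [TopologicalSpace X] [ChartedSpace HB X]
  {F : Type*} [NormedAddCommGroup F] [NormedSpace ℝ F]
  {E : X → Type*} [∀ x, AddCommGroup (E x)] [∀ x, Module ℝ (E x)]
  [∀ x, TopologicalSpace (E x)] [TopologicalSpace (TotalSpace F E)]
  [FiberBundle F E] [VectorBundle ℝ F E]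

variable (F E) in
theorem bundleChartDomain_eq_inter (x₀ : X) :
    ∃ W : Set EB, IsOpen W ∧ bundleChartDomain I F E x₀ = W ∩ range I := by
  refine ⟨I.symm ⁻¹' ((chartAt HB x₀).target ∩
    (chartAt HB x₀).symm ⁻¹' (trivializationAt F E x₀).baseSet), ?_, ?_⟩
  · exact ((chartAt HB x₀).symm.isOpen_inter_preimage
      (trivializationAt F E x₀).open_baseSet).preimage I.continuous_symm
  · rw [bundleChartDomain, extChartAt_target, extChartAt_coe_symm]
    ext y
    simp only [mem_inter_iff, mem_preimage, Function.comp_apply]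
    tauto

variable (F E) in
-- The range of a model with corners is closed and convex, so its intersection with a small closed
-- ball is compact and convex. This supplies the sets on which the mean value inequality is applied.
theorem bundleChartDomain_exists_convex_nhds [FiniteDimensional ℝ EB] (x₀ : X) :
    ∀ y ∈ bundleChartDomain I F E x₀, ∃ K ⊆ bundleChartDomain I F E x₀,
      IsCompact K ∧ Convex ℝ K ∧ K ∈ nhdsWithin y (bundleChartDomain I F E x₀) := by
  obtain ⟨W, hW, hD⟩ := bundleChartDomain_eq_inter I F E x₀
  intro y hy
  rw [hD] at hy ⊢
  obtain ⟨r, hr, hrW⟩ := Metric.nhds_basis_closedBall.mem_iff.1 (hW.mem_nhds hy.1)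
  refine ⟨Metric.closedBall y r ∩ range I, inter_subset_inter_left _ hrW,
    (isCompact_closedBall y r).inter_right I.isClosed_range,
    (convex_closedBall y r).inter I.convex_range, ?_⟩
  exact Filter.inter_mem (mem_nhdsWithin_of_mem_nhds (Metric.closedBall_mem_nhds y hr))
    (Filter.mem_of_superset self_mem_nhdsWithin inter_subset_right)

theorem bundleLocalRep_apply (f : TotalSpace F E → ℂ) (x₀ : X) {y : EB}
    (hy : y ∈ bundleChartDomain I F E x₀) (u : F) :
    bundleLocalRep I f x₀ (y, u) = f ⟨(extChartAt I x₀).symm y,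
      (((trivializationAt F E x₀).continuousLinearEquivAt ℝ ((extChartAt I x₀).symm y)
        hy.2).symm u)⟩ := by
  rw [bundleLocalRep, ← Trivialization.mk_symm _ hy.2]
  rfl

theorem mem_bundleChartDomain {x₀ x : X} (hx : x ∈ (extChartAt I x₀).source)
    (hx' : x ∈ (trivializationAt F E x₀).baseSet) :
    extChartAt I x₀ x ∈ bundleChartDomain I F E x₀ := by
  refine ⟨(extChartAt I x₀).map_source hx, ?_⟩
  rw [mem_preimage, (extChartAt I x₀).left_inv hx]
  exact hx'

theorem mem_bundleChartDomain_self (x : X) :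
    extChartAt I x x ∈ bundleChartDomain I F E x :=
  mem_bundleChartDomain I (mem_extChartAt_source x) (FiberBundle.mem_baseSet_trivializationAt F E x)

theorem eq_bundleLocalRep (f : TotalSpace F E → ℂ) {x₀ : X} {p : TotalSpace F E}
    (hp : p.proj ∈ (extChartAt I x₀).source) (hp' : p.proj ∈ (trivializationAt F E x₀).baseSet) :
    f p = bundleLocalRep I f x₀ (extChartAt I x₀ p.proj, (trivializationAt F E x₀ p).2) := by
  rw [bundleLocalRep, (extChartAt I x₀).left_inv hp]
  congr 1
  have h := (trivializationAt F E x₀).mem_source.2 hp'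
  rw [← (trivializationAt F E x₀).coe_fst h]
  exact ((trivializationAt F E x₀).left_inv h).symm

variable [IsManifold I ∞ X] [ContMDiffVectorBundle ∞ F E I]

theorem contMDiffOn_bundle_coordinates (x₀ : X) :
    ContMDiffOn (I.prod 𝓘(ℝ, F)) 𝓘(ℝ, EB × F) ∞
      (fun p : TotalSpace F E => (extChartAt I x₀ p.proj, (trivializationAt F E x₀ p).2))
      (TotalSpace.proj ⁻¹' ((extChartAt I x₀).source ∩ (trivializationAt F E x₀).baseSet)) := by
  have h1 : ContMDiffOn (I.prod 𝓘(ℝ, F)) 𝓘(ℝ, EB) ∞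
      (fun p : TotalSpace F E => extChartAt I x₀ p.proj)
      (TotalSpace.proj ⁻¹' ((extChartAt I x₀).source ∩ (trivializationAt F E x₀).baseSet)) := by
    refine (contMDiffOn_extChartAt (n := ∞)).comp (contMDiff_proj E).contMDiffOn ?_
    intro p hp
    rw [← extChartAt_source (I := I)]
    exact hp.1
  have hsub : TotalSpace.proj ⁻¹' ((extChartAt I x₀).source ∩ (trivializationAt F E x₀).baseSet) ⊆
      (trivializationAt F E x₀).source :=
    fun p hp => (trivializationAt F E x₀).mem_source.2 hp.2
  have h2 := (Trivialization.contMDiffOn (IB := I) (n := ∞) (trivializationAt F E x₀)).mono hsub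
  exact h1.prodMk_space (contMDiff_snd.comp_contMDiffOn h2)

theorem contMDiff_of_bundleLocalRep {f : TotalSpace F E → ℂ}
    (hf : ∀ x₀, ContDiffOn ℝ ∞ (bundleLocalRep I f x₀)
      (bundleChartDomain I F E x₀ ×ˢ univ)) :
    ContMDiff (I.prod 𝓘(ℝ, F)) 𝓘(ℝ, ℂ) ∞ f := by
  intro p
  set x₀ := p.proj
  set U : Set (TotalSpace F E) :=
    TotalSpace.proj ⁻¹' ((extChartAt I x₀).source ∩ (trivializationAt F E x₀).baseSet) with hU
  have hUo : IsOpen U := ((isOpen_extChartAt_source x₀).inter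
    (trivializationAt F E x₀).open_baseSet).preimage (FiberBundle.continuous_proj F E)
  have hpU : p ∈ U := ⟨mem_extChartAt_source x₀, FiberBundle.mem_baseSet_trivializationAt F E x₀⟩
  have h1 : ContMDiffOn (I.prod 𝓘(ℝ, F)) 𝓘(ℝ, ℂ) ∞ (fun p : TotalSpace F E =>
      bundleLocalRep I f x₀ (extChartAt I x₀ p.proj, (trivializationAt F E x₀ p).2)) U :=
    (hf x₀).contMDiffOn.comp (contMDiffOn_bundle_coordinates I x₀)
      (fun q hq => ⟨mem_bundleChartDomain I hq.1 hq.2, mem_univ _⟩)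
  exact (h1.congr fun q hq => eq_bundleLocalRep I f hq.1 hq.2).contMDiffAt (hUo.mem_nhds hpU)

/-- Smoothness on the total space can be checked in trivializing charts; this reduces the analysis
on the bundle to families on the model fibre. -/
theorem isBundleSchwartz_iff {f : TotalSpace F E → ℂ} : IsBundleSchwartz I f ↔
    (∃ K : Set X, IsCompact K ∧ ∀ p : TotalSpace F E, p.proj ∉ K → f p = 0) ∧
    ∀ x₀, RapidlyDecreasing (bundleChartDomain I F E x₀) (bundleLocalRep I f x₀) := by
  refine ⟨fun h => ⟨h.support, fun x₀ => ⟨bundleLocalRep_contDiffOn I h.smooth x₀, h.decay x₀⟩⟩,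
    fun h => ⟨contMDiff_of_bundleLocalRep I fun x₀ => (h.2 x₀).contDiffOn, h.1,
      fun x₀ => (h.2 x₀).decay⟩⟩

theorem contDiffOn_comp_extChartAt_symm {ρ : X → ℝ} {x₀ : X}
    (hρ : ContMDiffOn I 𝓘(ℝ, ℝ) ∞ ρ (trivializationAt F E x₀).baseSet) :
    ContDiffOn ℝ ∞ (fun y => ρ ((extChartAt I x₀).symm y)) (bundleChartDomain I F E x₀) := by
  rw [← contMDiffOn_iff_contDiffOn]
  exact hρ.comp ((contMDiffOn_extChartAt_symm x₀).mono fun y hy => hy.1) fun y hy => hy.2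

end BundleLocal

/-! ### The dual bundle in local trivializations -/

section DualLocal

variable {EB : Type*} [NormedAddCommGroup EB] [NormedSpace ℝ EB]
  {HB : Type*} [TopologicalSpace HB] (I : ModelWithCorners ℝ EB HB)
  {X : Type*} [TopologicalSpace X] [ChartedSpace HB X]
  {F : Type*} [NormedAddCommGroup F] [NormedSpace ℝ F]
  {E : X → Type*} [∀ x, AddCommGroup (E x)] [∀ x, Module ℝ (E x)]
  [∀ x, TopologicalSpace (E x)] [∀ x, IsTopologicalAddGroup (E x)]
  [∀ x, ContinuousSMul ℝ (E x)] [TopologicalSpace (TotalSpace F E)]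
  [FiberBundle F E] [VectorBundle ℝ F E]

theorem bundleChartDomain_dual (x₀ : X) :
    bundleChartDomain I (F →L[ℝ] ℝ) (DualBundle E) x₀ = bundleChartDomain I F E x₀ := by
  ext y
  simp [bundleChartDomain]

/-- The trivialization of the dual bundle is the transpose inverse of that of `E`, so a model
covector is pulled back along the fibre coordinate. -/
theorem bundleLocalRep_dual_apply (H : TotalSpace (F →L[ℝ] ℝ) (DualBundle E) → ℂ) (x₀ : X)
    {y : EB} (hy : y ∈ bundleChartDomain I F E x₀) (ξ : F →L[ℝ] ℝ) :
    bundleLocalRep I H x₀ (y, ξ) = H ⟨(extChartAt I x₀).symm y,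
      ξ.comp ((trivializationAt F E x₀).continuousLinearEquivAt ℝ ((extChartAt I x₀).symm y)
        hy.2 : E ((extChartAt I x₀).symm y) →L[ℝ] F)⟩ := by
  rw [bundleLocalRep]
  congr 1
  set x := (extChartAt I x₀).symm y
  set t := trivializationAt (F →L[ℝ] ℝ) (DualBundle E) x₀
  have hx : x ∈ t.baseSet := by
    simp only [t, hom_trivializationAt_baseSet]
    exact ⟨hy.2, by simp⟩
  have h2 : t ⟨x, ξ.comp ((trivializationAt F E x₀).continuousLinearEquivAt ℝ x
      hy.2 : E x →L[ℝ] F)⟩ = (x, ξ) := by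
    simp only [t, hom_trivializationAt_apply]
    refine Prod.ext rfl ?_
    ext v
    simp [ContinuousLinearMap.inCoordinates, Trivialization.coe_continuousLinearEquivAt_eq']
    exact congrArg ξ (Trivialization.continuousLinearMapAt_symmL _ hy.2 v)
  rw [← h2]
  exact t.left_inv (t.mem_source.2 hx)

theorem dual_trivialization_snd {x₀ x : X} (hx : x ∈ (trivializationAt F E x₀).baseSet)
    (ζ : DualBundle E x) :
    (trivializationAt (F →L[ℝ] ℝ) (DualBundle E) x₀ ⟨x, ζ⟩).2 = ζ.comp
      (((trivializationAt F E x₀).continuousLinearEquivAt ℝ x hx).symm : F →L[ℝ] E x) := by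
  rw [hom_trivializationAt_apply]
  ext v
  rw [Trivialization.symm_continuousLinearEquivAt_eq']
  simp [ContinuousLinearMap.inCoordinates]

end DualLocal

/-! ### The Fourier transform on a single fibre -/

section FibreFourier

variable {F : Type*} [NormedAddCommGroup F] [NormedSpace ℝ F] [FiniteDimensional ℝ F]
  [MeasurableSpace F] [BorelSpace F]
  {W : Type*} [AddCommGroup W] [Module ℝ W] [TopologicalSpace W] [MeasurableSpace W]
  [BorelSpace W] (e : W ≃L[ℝ] F) {m : Measure W} {r : ℝ} (hr : 0 < r)
  (hm : m.map e.toHomeomorph = ENNReal.ofReal r • Measure.addHaar (G := F))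

include hr hm

theorem integral_fourier_comp_equiv (u : F → ℂ) (ζ : W →L[ℝ] ℝ) :
    ∫ w, Complex.exp (-Complex.I * (ζ w : ℂ)) * u (e w) ∂m =
      r * ∫ v, Complex.exp (-Complex.I * ((ζ.comp (e.symm : F →L[ℝ] W) v : ℝ) : ℂ)) * u v
        ∂(Measure.addHaar (G := F)) := by
  rw [← integral_comp_of_map_eq_smul e.toHomeomorph hr.le hm]
  refine integral_congr_ae (.of_forall fun w => ?_)
  simp

/-- Both functions are recovered from their common transform by the inversion formula, up to the
same nonzero constant `κ`. As the transforms agree, integrability needs to be known for one of them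
only. -/
theorem fibre_fourier_injective {u₁ u₂ : W → ℂ} (h₁ : Continuous u₁) (h₂ : Continuous u₂)
    (hi₁ : Integrable u₁ m) (hi₂ : Integrable u₂ m)
    (h : ∀ ζ : W →L[ℝ] ℝ, ∫ w, Complex.exp (-Complex.I * (ζ w : ℂ)) * u₁ w ∂m =
      ∫ w, Complex.exp (-Complex.I * (ζ w : ℂ)) * u₂ w ∂m)
    (hi : Integrable (fun ξ : F →L[ℝ] ℝ => ∫ w, Complex.exp (-Complex.I *
      ((ξ.comp (e : W →L[ℝ] F) w : ℝ) : ℂ)) * u₁ w ∂m)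
      (Measure.addHaar (G := F →L[ℝ] ℝ))) : u₁ = u₂ := by
  obtain ⟨κ, hκ, -, hinv⟩ := exists_fourier_inversion_constant (Measure.addHaar (G := F))
    (Measure.addHaar (G := F →L[ℝ] ℝ))
  have hF : ∀ u : W → ℂ, ∀ ξ : F →L[ℝ] ℝ, ∫ w, Complex.exp (-Complex.I *
      ((ξ.comp (e : W →L[ℝ] F) w : ℝ) : ℂ)) * u w ∂m =
      r * ∫ v, Complex.exp (-Complex.I * (ξ v : ℂ)) * u (e.symm v)
        ∂(Measure.addHaar (G := F)) := by
    intro u ξ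
    have := integral_fourier_comp_equiv e hr hm (fun v => u (e.symm v))
      (ξ.comp (e : W →L[ℝ] F))
    simpa using this
  have hrne : (r : ℂ) ≠ 0 := by exact_mod_cast hr.ne'
  have hint : ∀ u : W → ℂ, Integrable u m →
      Integrable (fun v => u (e.symm v)) (Measure.addHaar (G := F)) := by
    intro u hu
    refine (integrable_comp_iff_of_map_eq_smul e.toHomeomorph hr hm _).1 ?_
    simpa using hu
  have heq : ∀ ξ : F →L[ℝ] ℝ, ∫ v, Complex.exp (-Complex.I * (ξ v : ℂ)) * u₁ (e.symm v)
        ∂(Measure.addHaar (G := F)) = ∫ v, Complex.exp (-Complex.I * (ξ v : ℂ)) * u₂ (e.symm v)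
        ∂(Measure.addHaar (G := F)) := by
    intro ξ
    have := h (ξ.comp (e : W →L[ℝ] F))
    rw [hF, hF] at this
    exact mul_left_cancel₀ hrne this
  have hi' : Integrable (fun ξ : F →L[ℝ] ℝ => ∫ v, Complex.exp (-Complex.I * (ξ v : ℂ)) *
      u₁ (e.symm v) ∂(Measure.addHaar (G := F))) (Measure.addHaar (G := F →L[ℝ] ℝ)) := by
    simp only [hF] at hi
    exact (integrable_const_mul_iff (IsUnit.mk0 _ hrne) _).1 hi
  have k1 := hinv (fun v => u₁ (e.symm v)) (h₁.comp e.symm.continuous) (hint _ hi₁) hi'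
  have k2 := hinv (fun v => u₂ (e.symm v)) (h₂.comp e.symm.continuous) (hint _ hi₂)
    (by simpa only [heq] using hi')
  have hκne : (κ : ℂ) ≠ 0 := by exact_mod_cast hκ.ne'
  funext w
  have k3 := (k1 (e w)).symm.trans ((by simp only [heq] : _ = _).trans (k2 (e w)))
  simpa using mul_left_cancel₀ hκne k3

theorem fibre_convolution {f g : W → ℂ} (hf : Continuous f) (hfb : ∃ C, ∀ v, ‖f v‖ ≤ C)
    (hfi : Integrable f m) (hg : Continuous g) (hgi : Integrable g m) :
    (∀ v, Integrable (fun w => f (v - w) * g w) m) ∧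
    Continuous (fun v => ∫ w, f (v - w) * g w ∂m) ∧
    Integrable (fun v => ∫ w, f (v - w) * g w ∂m) m ∧
    ∀ ζ : W →L[ℝ] ℝ,
      ∫ v, Complex.exp (-Complex.I * (ζ v : ℂ)) * (∫ w, f (v - w) * g w ∂m) ∂m =
      (∫ v, Complex.exp (-Complex.I * (ζ v : ℂ)) * f v ∂m) *
      ∫ v, Complex.exp (-Complex.I * (ζ v : ℂ)) * g v ∂m := by
  have hint : ∀ u : W → ℂ, Integrable u m →
      Integrable (fun v => u (e.symm v)) (Measure.addHaar (G := F)) := by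
    intro u hu
    refine (integrable_comp_iff_of_map_eq_smul e.toHomeomorph hr hm _).1 ?_
    simpa using hu
  obtain ⟨C, hC⟩ := hfb
  obtain ⟨h1, h2, h3, h4⟩ := fourier_convolution_dual (Measure.addHaar (G := F))
    (hf.comp e.symm.continuous) ⟨C, fun v => hC _⟩ (hint f hfi) (hg.comp e.symm.continuous)
    (hint g hgi)
  simp only [Function.comp_apply, map_sub] at h1 h2 h3 h4
  have hconv : ∀ v, ∫ w, f (v - w) * g w ∂m = r * ∫ w, f (e.symm (e v) - e.symm w) *
      g (e.symm w) ∂(Measure.addHaar (G := F)) := by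
    intro v
    rw [← integral_comp_of_map_eq_smul e.toHomeomorph hr.le hm]
    simp
  refine ⟨fun v => ?_, ?_, ?_, fun ζ => ?_⟩
  · have := (integrable_comp_iff_of_map_eq_smul e.toHomeomorph hr hm _).2 (h1 (e v))
    simpa using this
  · simp only [hconv]
    exact continuous_const.mul (h2.comp e.continuous)
  · simp only [hconv]
    exact ((integrable_comp_iff_of_map_eq_smul e.toHomeomorph hr hm _).2 h3).const_mul _
  · have k := h4 (ζ.comp (e.symm : F →L[ℝ] W))
    have k0 := integral_fourier_comp_equiv e hr hm (fun v => (r : ℂ) *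
      ∫ w, f (e.symm v - e.symm w) * g (e.symm w) ∂(Measure.addHaar (G := F))) ζ
    have k1 := integral_fourier_comp_equiv e hr hm (fun v => f (e.symm v)) ζ
    have k2 := integral_fourier_comp_equiv e hr hm (fun v => g (e.symm v)) ζ
    simp only [ContinuousLinearEquiv.symm_apply_apply] at k1 k2
    simp only [hconv]
    rw [k0, k1, k2]
    have k3 : ∀ v : F, Complex.exp (-Complex.I * ((ζ.comp (e.symm : F →L[ℝ] W) v : ℝ) : ℂ)) *
        ((r : ℂ) * ∫ w, f (e.symm v - e.symm w) * g (e.symm w) ∂(Measure.addHaar (G := F))) =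
        r * (Complex.exp (-Complex.I * ((ζ.comp (e.symm : F →L[ℝ] W) v : ℝ) : ℂ)) *
          ∫ w, f (e.symm v - e.symm w) * g (e.symm w) ∂(Measure.addHaar (G := F))) :=
      fun v => by ring
    simp only [k3]
    rw [integral_const_mul, k]
    ring

end FibreFourier

/-! ### The Fourier transform on a vector bundle -/

section BundleFourier

variable {EB : Type*} [NormedAddCommGroup EB] [NormedSpace ℝ EB] [FiniteDimensional ℝ EB]
    {HB : Type*} [TopologicalSpace HB] {I : ModelWithCorners ℝ EB HB}
    {X : Type*} [TopologicalSpace X] [ChartedSpace HB X]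
    {F : Type*} [NormedAddCommGroup F] [NormedSpace ℝ F] [FiniteDimensional ℝ F]
    [MeasurableSpace F] [BorelSpace F]
    {E : X → Type*} [∀ x, AddCommGroup (E x)] [∀ x, Module ℝ (E x)]
    [∀ x, TopologicalSpace (E x)] [∀ x, IsTopologicalAddGroup (E x)]
    [∀ x, ContinuousSMul ℝ (E x)] [∀ x, MeasurableSpace (E x)] [∀ x, BorelSpace (E x)]
    [TopologicalSpace (TotalSpace F E)] [FiberBundle F E] [VectorBundle ℝ F E]
    {μ : ∀ x, Measure (E x)}

theorem haar_map_equiv {ρ : X → ℝ} {x₀ : X} (hρ : ∀ x ∈ (trivializationAt F E x₀).baseSet,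
    0 < ρ x ∧ (μ x).map ((trivializationAt F E x₀).continuousLinearMapAt ℝ x) =
        ENNReal.ofReal (ρ x) • Measure.addHaar (G := F)) {x : X}
    (hx : x ∈ (trivializationAt F E x₀).baseSet) :
    (μ x).map ((trivializationAt F E x₀).continuousLinearEquivAt ℝ x hx).toHomeomorph =
      ENNReal.ofReal (ρ x) • Measure.addHaar (G := F) := by
  rw [← (hρ x hx).2, ← Trivialization.coe_continuousLinearEquivAt_eq _ hx]
  rfl

/-- Change of variables along the fibre coordinate; the measure `μ` enters only through its smooth
density `ρ`. -/
theorem bundleLocalRep_bundleFourier {ρ : X → ℝ} {x₀ : X}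
    (hρ : ∀ x ∈ (trivializationAt F E x₀).baseSet,
    0 < ρ x ∧ (μ x).map ((trivializationAt F E x₀).continuousLinearMapAt ℝ x) =
        ENNReal.ofReal (ρ x) • Measure.addHaar (G := F)) (f : TotalSpace F E → ℂ) {y : EB}
    (hy : y ∈ bundleChartDomain I F E x₀) (ξ : F →L[ℝ] ℝ) :
    bundleLocalRep I (bundleFourier μ f) x₀ (y, ξ) = ρ ((extChartAt I x₀).symm y) *
      paramFourier Measure.addHaar (evalPairing F) (bundleLocalRep I f x₀) (y, ξ) := by
  rw [bundleLocalRep_dual_apply I _ x₀ hy, bundleFourier, paramFourier]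
  set x := (extChartAt I x₀).symm y
  set e := (trivializationAt F E x₀).continuousLinearEquivAt ℝ x hy.2
  have h := integral_fourier_comp_equiv e (hρ x hy.2).1 (haar_map_equiv hρ hy.2)
    (fun v => f ⟨x, e.symm v⟩) (ξ.comp (e : E x →L[ℝ] F))
  simp only [ContinuousLinearEquiv.symm_apply_apply] at h
  refine h.trans ?_
  congr 1
  refine integral_congr_ae (.of_forall fun v => ?_)
  simp only [ContinuousLinearMap.comp_apply, ContinuousLinearEquiv.coe_coe,
    ContinuousLinearEquiv.apply_symm_apply, evalPairing_apply]
  rw [bundleLocalRep_apply I f x₀ hy]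

end BundleFourier

/-! ### Bijectivity of the bundle Fourier transform and the convolution algebra -/

section BundleFourierIso

variable {EB : Type*} [NormedAddCommGroup EB] [NormedSpace ℝ EB] [FiniteDimensional ℝ EB]
    {HB : Type*} [TopologicalSpace HB] {I : ModelWithCorners ℝ EB HB}
    {X : Type*} [TopologicalSpace X] [ChartedSpace HB X] [IsManifold I ∞ X]
    {F : Type*} [NormedAddCommGroup F] [NormedSpace ℝ F] [FiniteDimensional ℝ F]
    [MeasurableSpace F] [BorelSpace F]
    {E : X → Type*} [∀ x, AddCommGroup (E x)] [∀ x, Module ℝ (E x)]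
    [∀ x, TopologicalSpace (E x)] [∀ x, IsTopologicalAddGroup (E x)]
    [∀ x, ContinuousSMul ℝ (E x)] [∀ x, MeasurableSpace (E x)] [∀ x, BorelSpace (E x)]
    [TopologicalSpace (TotalSpace F E)] [FiberBundle F E] [VectorBundle ℝ F E]
    [ContMDiffVectorBundle ∞ F E I]
    {μ : ∀ x, Measure (E x)}

theorem bundleFourier_mem (hμ : IsSmoothHaarSystem I F μ) {f : TotalSpace F E → ℂ}
    (hf : IsBundleSchwartz I f) : IsBundleSchwartz I (bundleFourier μ f) := by
  rw [isBundleSchwartz_iff] at hf ⊢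
  obtain ⟨⟨K, hK, hKf⟩, hloc⟩ := hf
  refine ⟨⟨K, hK, fun q hq => ?_⟩, fun x₀ => ?_⟩
  · rw [bundleFourier]
    simp only [fun v => hKf ⟨q.proj, v⟩ hq, mul_zero, integral_zero]
  · obtain ⟨ρ, hρs, hρ⟩ := hμ x₀
    rw [bundleChartDomain_dual]
    have hD := bundleChartDomain_uniqueDiffOn I F E x₀
    have h1 := (hloc x₀).paramFourier Measure.addHaar (evalPairing F) hD
      (bundleChartDomain_exists_convex_nhds I F E x₀) evalPairing_surjective
    have h2 : ContDiffOn ℝ ∞ (fun y => (ρ ((extChartAt I x₀).symm y) : ℂ))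
        (bundleChartDomain I F E x₀) :=
      Complex.ofRealCLM.contDiff.comp_contDiffOn (contDiffOn_comp_extChartAt_symm I hρs)
    refine (RapidlyDecreasing.mul hD (ModeratelyGrowing.fst hD h2) h1).congr ?_
    rintro ⟨y, ξ⟩ ⟨hy, -⟩
    exact bundleLocalRep_bundleFourier hρ f hy ξ

theorem eq_bundleLocalRep_fibre (f : TotalSpace F E → ℂ) (x : X) (v : E x) :
    f ⟨x, v⟩ = bundleLocalRep I f x (extChartAt I x x,
      (trivializationAt F E x).continuousLinearEquivAt ℝ x
        (FiberBundle.mem_baseSet_trivializationAt F E x) v) :=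
  eq_bundleLocalRep I f (mem_extChartAt_source x) (FiberBundle.mem_baseSet_trivializationAt F E x)

theorem RapidlyDecreasing.fibre {x₀ x : X} {ρ : X → ℝ}
    (hρ : ∀ x ∈ (trivializationAt F E x₀).baseSet,
    0 < ρ x ∧ (μ x).map ((trivializationAt F E x₀).continuousLinearMapAt ℝ x) =
        ENNReal.ofReal (ρ x) • Measure.addHaar (G := F)) {g : EB × F → ℂ}
    (hg : RapidlyDecreasing (bundleChartDomain I F E x₀) g)
    (hx : x ∈ (trivializationAt F E x₀).baseSet) {y : EB}
    (hy : y ∈ bundleChartDomain I F E x₀) :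
    Continuous (fun v : E x => g (y, (trivializationAt F E x₀).continuousLinearEquivAt ℝ x hx v)) ∧
    Integrable (fun v : E x => g (y, (trivializationAt F E x₀).continuousLinearEquivAt ℝ x hx v))
      (μ x) ∧
    ∃ C, ∀ v : E x,
      ‖g (y, (trivializationAt F E x₀).continuousLinearEquivAt ℝ x hx v)‖ ≤ C := by
  refine ⟨(hg.continuous_apply hy).comp (ContinuousLinearEquiv.continuous _), ?_, ?_⟩
  · exact (integrable_comp_iff_of_map_eq_smul _ (hρ x hx).1 (haar_map_equiv hρ hx) _).2
      (hg.integrable Measure.addHaar hy)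
  · obtain ⟨C, hC⟩ := hg.decay {y} isCompact_singleton (singleton_subset_iff.2 hy) 0 0
    refine ⟨C, fun v => ?_⟩
    simpa using hC y rfl _

theorem IsBundleSchwartz.fibre (hμ : IsSmoothHaarSystem I F μ) {f : TotalSpace F E → ℂ}
    (hf : IsBundleSchwartz I f) (x : X) :
    Continuous (fun v : E x => f ⟨x, v⟩) ∧ Integrable (fun v : E x => f ⟨x, v⟩) (μ x) ∧
    ∃ C, ∀ v : E x, ‖f ⟨x, v⟩‖ ≤ C := by
  obtain ⟨ρ, -, hρ⟩ := hμ x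
  simp only [eq_bundleLocalRep_fibre (I := I) f]
  exact (((isBundleSchwartz_iff I).1 hf).2 x).fibre hρ _ (mem_bundleChartDomain_self I x)

/-- The values of a function on the dual bundle over `x`, in a trivialization. -/
theorem bundleLocalRep_dual_fibre (H : TotalSpace (F →L[ℝ] ℝ) (DualBundle E) → ℂ) {x₀ x : X}
    (hx : x ∈ (extChartAt I x₀).source) (hx' : x ∈ (trivializationAt F E x₀).baseSet)
    (ζ : DualBundle E x) : H ⟨x, ζ⟩ = bundleLocalRep I H x₀ (extChartAt I x₀ x,
      ζ.comp (((trivializationAt F E x₀).continuousLinearEquivAt ℝ x hx').symm :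
        F →L[ℝ] E x)) := by
  rw [← dual_trivialization_snd]
  exact eq_bundleLocalRep I H (p := ⟨x, ζ⟩) hx (by simpa using hx')

theorem IsBundleSchwartz.fibre_dual_integrable {H : TotalSpace (F →L[ℝ] ℝ) (DualBundle E) → ℂ}
    (hH : IsBundleSchwartz I H) {x₀ x : X} (hx : x ∈ (extChartAt I x₀).source)
    (hx' : x ∈ (trivializationAt F E x₀).baseSet) :
    Integrable (fun ξ : F →L[ℝ] ℝ => H ⟨x, ξ.comp
      ((trivializationAt F E x₀).continuousLinearEquivAt ℝ x hx' : E x →L[ℝ] F)⟩)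
      (Measure.addHaar (G := F →L[ℝ] ℝ)) := by
  have h := ((isBundleSchwartz_iff I).1 hH).2 x₀
  rw [bundleChartDomain_dual] at h
  refine (h.integrable Measure.addHaar (mem_bundleChartDomain I hx hx')).congr
    (.of_forall fun ξ => ?_)
  simp only []
  rw [bundleLocalRep_dual_fibre (I := I) H hx hx']
  congr 2
  refine ContinuousLinearMap.ext fun v => congrArg ξ ?_
  exact (((trivializationAt F E x₀).continuousLinearEquivAt ℝ x hx').apply_symm_apply v).symm

/-- Uniqueness on one fibre, with `H` providing integrability of the common transform. It serves to
glue local preimages and to recognize convolutions. -/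
theorem fibre_eq_of_fourier_eq (hμ : IsSmoothHaarSystem I F μ) {x : X} {u₁ u₂ : E x → ℂ}
    (h₁ : Continuous u₁) (h₂ : Continuous u₂)
    (hi₁ : Integrable u₁ (μ x)) (hi₂ : Integrable u₂ (μ x))
    {H : TotalSpace (F →L[ℝ] ℝ) (DualBundle E) → ℂ} (hH : IsBundleSchwartz I H)
    (hu₁ : ∀ ζ : E x →L[ℝ] ℝ, ∫ w, Complex.exp (-Complex.I * (ζ w : ℂ)) * u₁ w ∂(μ x) = H ⟨x, ζ⟩)
    (hu₂ : ∀ ζ : E x →L[ℝ] ℝ, ∫ w, Complex.exp (-Complex.I * (ζ w : ℂ)) * u₂ w ∂(μ x) = H ⟨x, ζ⟩) :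
    u₁ = u₂ := by
  obtain ⟨ρ, -, hρ⟩ := hμ x
  have hx := FiberBundle.mem_baseSet_trivializationAt F E x
  refine fibre_fourier_injective _ (hρ x hx).1 (haar_map_equiv hρ hx) h₁ h₂ hi₁ hi₂
    (fun ζ => (hu₁ ζ).trans (hu₂ ζ).symm) ?_
  refine (hH.fibre_dual_integrable (mem_extChartAt_source x) hx).congr (.of_forall fun ξ => ?_)
  exact (hu₁ _).symm

theorem bundleFourier_injective (hμ : IsSmoothHaarSystem I F μ) {f g : TotalSpace F E → ℂ}
    (hf : IsBundleSchwartz I f) (hg : IsBundleSchwartz I g)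
    (h : bundleFourier μ f = bundleFourier μ g) : f = g := by
  funext ⟨x, v⟩
  obtain ⟨hf1, hf2, -⟩ := hf.fibre hμ x
  obtain ⟨hg1, hg2, -⟩ := hg.fibre hμ x
  exact congr_fun (fibre_eq_of_fourier_eq hμ hf1 hg1 hf2 hg2 (bundleFourier_mem hμ hf)
    (fun ζ => rfl) (fun ζ => (congr_fun h ⟨x, ζ⟩).symm)) v

/-- Inversion is carried out in each chart separately. No transformation rule for the local
preimages is computed: fibrewise injectivity forces them to agree. -/
theorem exists_bundleFourier_eq (hμ : IsSmoothHaarSystem I F μ)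
    {H : TotalSpace (F →L[ℝ] ℝ) (DualBundle E) → ℂ} (hH : IsBundleSchwartz I H) :
    ∃ f : TotalSpace F E → ℂ, IsBundleSchwartz I f ∧ bundleFourier μ f = H := by
  obtain ⟨κ, hκ, hinv, -⟩ := exists_fourier_inversion_constant (Measure.addHaar (G := F))
    (Measure.addHaar (G := F →L[ℝ] ℝ))
  have hκne : (κ : ℂ) ≠ 0 := by exact_mod_cast hκ.ne'
  choose ρ hρs hρ using hμ
  have hHloc : ∀ x₀, RapidlyDecreasing (bundleChartDomain I F E x₀) (bundleLocalRep I H x₀) := by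
    intro x₀
    have h := ((isBundleSchwartz_iff I).1 hH).2 x₀
    rwa [bundleChartDomain_dual] at h
  let P : X → EB × F → ℂ := fun x₀ =>
    paramFourier (Measure.addHaar (G := F →L[ℝ] ℝ)) (negPairing F) (bundleLocalRep I H x₀)
  -- The factor `κ` comes from the inversion formula for the fixed Haar measures, and `ρ` from the
  -- density of `μ` in this trivialization.
  let G : X → EB × F → ℂ := fun x₀ p =>
    ((κ * ρ x₀ ((extChartAt I x₀).symm p.1) : ℝ) : ℂ)⁻¹ * P x₀ p
  have hP : ∀ x₀, RapidlyDecreasing (bundleChartDomain I F E x₀) (P x₀) := fun x₀ =>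
    (hHloc x₀).paramFourier Measure.addHaar (negPairing F) (bundleChartDomain_uniqueDiffOn I F E x₀)
      (bundleChartDomain_exists_convex_nhds I F E x₀) negPairing_surjective
  have hG : ∀ x₀, RapidlyDecreasing (bundleChartDomain I F E x₀) (G x₀) := by
    intro x₀
    have hD := bundleChartDomain_uniqueDiffOn I F E x₀
    have h2 : ContDiffOn ℝ ∞ (fun y => ((κ * ρ x₀ ((extChartAt I x₀).symm y) : ℝ) : ℂ)⁻¹)
        (bundleChartDomain I F E x₀) := by
      refine (Complex.ofRealCLM.contDiff.comp_contDiffOn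
        (contDiffOn_const.mul (contDiffOn_comp_extChartAt_symm I (hρs x₀)))).inv ?_
      intro y hy
      exact Complex.ofReal_ne_zero.2 (mul_pos hκ (hρ x₀ _ hy.2).1).ne'
    exact RapidlyDecreasing.mul hD (ModeratelyGrowing.fst hD h2) (hP x₀)
  have hGF : ∀ x₀, ∀ y ∈ bundleChartDomain I F E x₀, ∀ ξ : F →L[ℝ] ℝ,
      ρ x₀ ((extChartAt I x₀).symm y) *
        ∫ v, Complex.exp (-Complex.I * (ξ v : ℂ)) * G x₀ (y, v) ∂(Measure.addHaar (G := F)) =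
      bundleLocalRep I H x₀ (y, ξ) := by
    intro x₀ y hy ξ
    have h1 := hinv (fun ξ => bundleLocalRep I H x₀ (y, ξ)) ((hHloc x₀).continuous_apply hy)
      ((hHloc x₀).integrable Measure.addHaar hy) ((hP x₀).integrable Measure.addHaar hy) ξ
    have hρne : (ρ x₀ ((extChartAt I x₀).symm y) : ℂ) ≠ 0 := by
      exact_mod_cast (hρ x₀ _ hy.2).1.ne'
    have h2 : ∀ v, Complex.exp (-Complex.I * (ξ v : ℂ)) * G x₀ (y, v) =
        ((κ * ρ x₀ ((extChartAt I x₀).symm y) : ℝ) : ℂ)⁻¹ *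
          (Complex.exp (-Complex.I * (ξ v : ℂ)) * P x₀ (y, v)) := fun v => by
      simp only [G]
      ring
    simp only [h2]
    rw [integral_const_mul]
    change _ * (_ * ∫ v, Complex.exp (-Complex.I * (ξ v : ℂ)) * (∫ ξ, Complex.exp (-Complex.I *
      (negPairing F ξ v : ℂ)) * bundleLocalRep I H x₀ (y, ξ) ∂_) ∂_) = _
    rw [h1]
    push_cast
    field_simp
  have hA : ∀ x₀ x, ∀ (_ : x ∈ (extChartAt I x₀).source)
      (hx' : x ∈ (trivializationAt F E x₀).baseSet), ∀ ζ : E x →L[ℝ] ℝ,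
      ∫ w, Complex.exp (-Complex.I * (ζ w : ℂ)) * G x₀ (extChartAt I x₀ x,
        (trivializationAt F E x₀).continuousLinearEquivAt ℝ x hx' w) ∂(μ x) = H ⟨x, ζ⟩ := by
    intro x₀ x hx hx' ζ
    rw [integral_fourier_comp_equiv _ (hρ x₀ x hx').1 (haar_map_equiv (hρ x₀) hx')
      (fun v => G x₀ (extChartAt I x₀ x, v)), bundleLocalRep_dual_fibre (I := I) H hx hx',
      ← hGF x₀ _ (mem_bundleChartDomain I hx hx'), (extChartAt I x₀).left_inv hx]
  -- Each point is computed in the chart centred at its own base point. This choice varies without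
  -- continuity, and `hfG` shows that any other chart around the base point gives the same value;
  -- smoothness follows from that.
  let f : TotalSpace F E → ℂ := fun p =>
    G p.proj (extChartAt I p.proj p.proj, (trivializationAt F E p.proj).continuousLinearEquivAt ℝ
      p.proj (FiberBundle.mem_baseSet_trivializationAt F E p.proj) p.snd)
  have hμ : IsSmoothHaarSystem I F μ := fun x₀ => ⟨ρ x₀, hρs x₀, hρ x₀⟩
  have hfG : ∀ x₀ x, ∀ (_ : x ∈ (extChartAt I x₀).source)
      (hx' : x ∈ (trivializationAt F E x₀).baseSet), ∀ v : E x, f ⟨x, v⟩ =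
      G x₀ (extChartAt I x₀ x,
        (trivializationAt F E x₀).continuousLinearEquivAt ℝ x hx' v) := by
    intro x₀ x hx hx' v
    have hb := FiberBundle.mem_baseSet_trivializationAt F E x
    obtain ⟨a1, a2, -⟩ := (hG x).fibre (hρ x) hb (mem_bundleChartDomain_self I x)
    obtain ⟨b1, b2, -⟩ := (hG x₀).fibre (hρ x₀) hx' (mem_bundleChartDomain I hx hx')
    exact congr_fun (fibre_eq_of_fourier_eq hμ a1 b1 a2 b2 hH
      (hA x x (mem_extChartAt_source x) hb) (hA x₀ x hx hx')) v
  refine ⟨f, (isBundleSchwartz_iff I).2 ⟨?_, fun x₀ => (hG x₀).congr ?_⟩, ?_⟩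
  · obtain ⟨K, hK, hKH⟩ := hH.support
    refine ⟨K, hK, fun p hp => ?_⟩
    have h0 : ∀ ξ, bundleLocalRep I H p.proj (extChartAt I p.proj p.proj, ξ) = 0 := by
      intro ξ
      rw [bundleLocalRep_dual_apply I H p.proj (mem_bundleChartDomain_self I p.proj)]
      apply hKH
      simpa only [extChartAt_to_inv] using hp
    simp only [f, G, P, paramFourier, h0, mul_zero, integral_zero]
  · rintro ⟨y, u⟩ ⟨hy, -⟩
    rw [bundleLocalRep_apply I f x₀ hy,
      hfG x₀ _ ((extChartAt I x₀).map_target hy.1) hy.2, (extChartAt I x₀).right_inv hy.1,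
      ContinuousLinearEquiv.apply_symm_apply]
  · funext ⟨x, ζ⟩
    rw [← hA x x (mem_extChartAt_source x) (FiberBundle.mem_baseSet_trivializationAt F E x) ζ]
    rfl

/-- Smoothness and decay of the convolution are not estimated directly. The product of the
transforms is Schwartz and so has a Schwartz preimage `k`; on every fibre the convolution is
continuous and integrable with the same transform, so it equals `k`. -/
theorem bundleConv_fourier (hμ : IsSmoothHaarSystem I F μ) {f g : TotalSpace F E → ℂ}
    (hf : IsBundleSchwartz I f) (hg : IsBundleSchwartz I g) :
    (∀ p : TotalSpace F E,
      Integrable (fun w : E p.proj => f ⟨p.proj, p.snd - w⟩ * g ⟨p.proj, w⟩) (μ p.proj)) ∧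
    IsBundleSchwartz I (bundleConv μ f g) ∧
    bundleFourier μ (bundleConv μ f g) = bundleFourier μ f * bundleFourier μ g := by
  have hfib : ∀ x : X, (∀ v : E x, Integrable (fun w => f ⟨x, v - w⟩ * g ⟨x, w⟩) (μ x)) ∧
      Continuous (fun v : E x => ∫ w, f ⟨x, v - w⟩ * g ⟨x, w⟩ ∂(μ x)) ∧
      Integrable (fun v : E x => ∫ w, f ⟨x, v - w⟩ * g ⟨x, w⟩ ∂(μ x)) (μ x) ∧
      ∀ ζ : E x →L[ℝ] ℝ, ∫ v, Complex.exp (-Complex.I * (ζ v : ℂ)) *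
        (∫ w, f ⟨x, v - w⟩ * g ⟨x, w⟩ ∂(μ x)) ∂(μ x) =
        (bundleFourier μ f * bundleFourier μ g) ⟨x, ζ⟩ := fun x => by
    obtain ⟨ρ, -, hρ⟩ := hμ x
    have hx := FiberBundle.mem_baseSet_trivializationAt F E x
    obtain ⟨hf1, hf2, hf3⟩ := hf.fibre hμ x
    obtain ⟨hg1, hg2, -⟩ := hg.fibre hμ x
    exact fibre_convolution _ (hρ x hx).1 (haar_map_equiv hρ hx) hf1 hf3 hf2 hg1 hg2
  obtain ⟨k, hk, hkF⟩ := exists_bundleFourier_eq hμ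
    ((bundleFourier_mem hμ hf).mul I (bundleFourier_mem hμ hg))
  have hkc : bundleConv μ f g = k := by
    funext ⟨x, v⟩
    obtain ⟨-, h2, h3, h4⟩ := hfib x
    obtain ⟨k1, k2, -⟩ := hk.fibre hμ x
    exact congr_fun (fibre_eq_of_fourier_eq hμ h2 k1 h3 k2
      ((bundleFourier_mem hμ hf).mul I (bundleFourier_mem hμ hg)) h4
      (fun ζ => congr_fun hkF ⟨x, ζ⟩)) v
  exact ⟨fun p => (hfib p.proj).1 p.snd, hkc ▸ hk, hkc ▸ hkF⟩

theorem isConvolutionAlgebra (hμ : IsSmoothHaarSystem I F μ) :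
    IsConvolutionAlgebra (F := F) I μ where
  conv_mem f hf g hg := (bundleConv_fourier hμ hf hg).2.1
  integrable f hf g hg := (bundleConv_fourier hμ hf hg).1
  conv_assoc f hf g hg k hk := by
    obtain ⟨-, m1, e1⟩ := bundleConv_fourier hμ hf hg
    obtain ⟨-, m2, e2⟩ := bundleConv_fourier hμ hg hk
    obtain ⟨-, m3, e3⟩ := bundleConv_fourier hμ m1 hk
    obtain ⟨-, m4, e4⟩ := bundleConv_fourier hμ hf m2
    refine bundleFourier_injective hμ m3 m4 ?_
    rw [e3, e4, e1, e2, mul_assoc]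

end BundleFourierIso

/-! ### Smooth functional calculus for rapidly decreasing functions -/

section SmoothCalculus

open Filter Topology

/-- Iterated derivatives are computed componentwise, and the norm on the product is the maximum of
those of the components. -/
theorem norm_iteratedFDerivWithin_pi_le {H : Type*} [NormedAddCommGroup H] [NormedSpace ℝ H]
    {κ : Type*} [Fintype κ] {G : Type*} [NormedAddCommGroup G] [NormedSpace ℝ G]
    {u : H → κ → G} {s : Set H} {n : ℕ} (hu : ∀ i, ContDiffOn ℝ ∞ (fun p => u p i) s)
    (hs : UniqueDiffOn ℝ s) {x : H} (hx : x ∈ s) {C : ℝ} (hC0 : 0 ≤ C)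
    (hC : ∀ i, ‖iteratedFDerivWithin ℝ n (fun p => u p i) s x‖ ≤ C) :
    ‖iteratedFDerivWithin ℝ n u s x‖ ≤ C := by
  refine ContinuousMultilinearMap.opNorm_le_bound hC0 fun m => ?_
  rw [pi_norm_le_iff_of_nonneg (by positivity)]
  intro i
  have h := (ContinuousLinearMap.proj (R := ℝ) (φ := fun _ : κ => G) i).iteratedFDerivWithin_comp_left
    ((contDiffOn_pi.2 hu) x hx) hs hx (i := n) (by exact_mod_cast le_top)
  have h' : iteratedFDerivWithin ℝ n (fun p => u p i) s x m =
      iteratedFDerivWithin ℝ n u s x m i := by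
    change iteratedFDerivWithin ℝ n
      (ContinuousLinearMap.proj (R := ℝ) (φ := fun _ : κ => G) i ∘ u) s x m = _
    rw [h]
    rfl
  rw [← h']
  exact (ContinuousMultilinearMap.le_opNorm _ m).trans
    (mul_le_mul_of_nonneg_right (hC i) (Finset.prod_nonneg fun _ _ => norm_nonneg _))

/-- Near `0` the linear bound is differentiability there; at distance at least `δ` from `0` it
follows from boundedness of `h` on `C`. -/
theorem exists_norm_le_mul_norm_of_isCompact {H G : Type*} [NormedAddCommGroup H] [NormedSpace ℝ H]
    [NormedAddCommGroup G] [NormedSpace ℝ G] {h : H → G} {C : Set H} (hC : IsCompact C)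
    (hcont : ContinuousOn h C) (h0 : h 0 = 0) (hd : DifferentiableAt ℝ h 0) :
    ∃ M, 0 ≤ M ∧ ∀ z ∈ C, ‖h z‖ ≤ M * ‖z‖ := by
  have hO := hd.isBigO_sub
  simp only [h0, sub_zero] at hO
  obtain ⟨M₁, hM₁⟩ := hO.bound
  obtain ⟨δ, hδ, hball⟩ := Metric.eventually_nhds_iff_ball.1 hM₁
  obtain ⟨M₂, hM₂⟩ := hC.exists_bound_of_continuousOn hcont
  refine ⟨max M₁ 0 + max M₂ 0 / δ, by positivity, fun z hz => ?_⟩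
  by_cases hzδ : z ∈ Metric.ball (0 : H) δ
  · refine (hball z hzδ).trans (mul_le_mul_of_nonneg_right ?_ (norm_nonneg z))
    have : 0 ≤ max M₂ 0 / δ := by positivity
    linarith [le_max_left M₁ 0]
  · rw [mem_ball_zero_iff, not_lt] at hzδ
    have h1 : max M₂ 0 ≤ max M₂ 0 / δ * ‖z‖ := by
      rw [div_mul_eq_mul_div, le_div_iff₀ hδ]
      gcongr
    have h2 : 0 ≤ max M₁ 0 * ‖z‖ := by positivity
    rw [add_mul]
    linarith [hM₂ z hz, le_max_left M₂ 0]

variable {EB : Type*} [NormedAddCommGroup EB] [NormedSpace ℝ EB]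
  {V : Type*} [NormedAddCommGroup V] [NormedSpace ℝ V]

theorem RapidlyDecreasing.comp {D : Set EB} (hD : UniqueDiffOn ℝ D) {κ : Type*} [Fintype κ]
    {u : EB × V → κ → ℂ} (hu : ∀ i, RapidlyDecreasing D (fun p => u p i)) {Ω C : Set (κ → ℂ)}
    (hΩ : IsOpen Ω) (hC : IsCompact C) (hCΩ : C ⊆ Ω) (h0C : (0 : κ → ℂ) ∈ C)
    (huC : ∀ p, u p ∈ C) {h : (κ → ℂ) → ℂ} (hh : ContDiffOn ℝ ∞ h Ω) (h0 : h 0 = 0) :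
    RapidlyDecreasing D (fun p => h (u p)) := by
  have hus : ContDiffOn ℝ ∞ u (D ×ˢ univ) := contDiffOn_pi.2 fun i => (hu i).contDiffOn
  have hmaps : MapsTo u (D ×ˢ univ) Ω := fun p _ => hCΩ (huC p)
  have hDu := hD.prod (uniqueDiffOn_univ (𝕜 := ℝ) (E := V))
  refine ⟨hh.comp hus hmaps, fun K hK hKD k n => ?_⟩
  have hbd : ∀ k n : ℕ, ∃ B : ℝ, 0 ≤ B ∧ ∀ y ∈ K, ∀ v : V,
      (1 + ‖v‖) ^ k * ‖iteratedFDerivWithin ℝ n u (D ×ˢ univ) (y, v)‖ ≤ B := by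
    intro k n
    choose B hB0 hB using fun i => (hu i).exists_bound hK hKD k n
    refine ⟨∑ i, B i, Finset.sum_nonneg fun i _ => hB0 i, fun y hy v => ?_⟩
    have hpos : (0 : ℝ) < (1 + ‖v‖) ^ k := by positivity
    rw [mul_comm, ← le_div_iff₀ hpos]
    refine norm_iteratedFDerivWithin_pi_le (fun i => (hu i).contDiffOn) hDu ⟨hKD hy, mem_univ _⟩
      (div_nonneg (Finset.sum_nonneg fun i _ => hB0 i) hpos.le) fun i => ?_
    rw [le_div_iff₀ hpos, mul_comm]
    exact (hB i y hy v).trans (Finset.single_le_sum (fun i _ => hB0 i) (Finset.mem_univ i))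
  -- Order zero is separate: there `h 0 = 0` gives `‖h (u p)‖ ≤ M ‖u p‖`. In positive order every
  -- term of the chain rule contains a derivative of `u`, which supplies the decay.
  rcases Nat.eq_zero_or_pos n with rfl | hn
  · obtain ⟨M, hM0, hM⟩ := exists_norm_le_mul_norm_of_isCompact hC (hh.continuousOn.mono hCΩ) h0
      ((hh.contDiffAt (hΩ.mem_nhds (hCΩ h0C))).differentiableAt (by simp))
    obtain ⟨B, hB0, hB⟩ := hbd k 0
    refine ⟨M * B, fun y hy v => ?_⟩
    have h1 := hB y hy v
    rw [norm_iteratedFDerivWithin_zero] at h1 ⊢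
    calc ‖v‖ ^ k * ‖h (u (y, v))‖ ≤ (1 + ‖v‖) ^ k * (M * ‖u (y, v)‖) := by
          gcongr
          · linarith
          · exact hM _ (huC _)
      _ = M * ((1 + ‖v‖) ^ k * ‖u (y, v)‖) := by ring
      _ ≤ M * B := by gcongr
  · have hH : ∀ i : ℕ, ∃ A, ∀ z ∈ C, ‖iteratedFDerivWithin ℝ i h Ω z‖ ≤ A := fun i =>
      hC.exists_bound_of_continuousOn ((hh.continuousOn_iteratedFDerivWithin
        (by exact_mod_cast le_top) hΩ.uniqueDiffOn).mono hCΩ)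
    choose A hA using hH
    -- The Faà di Bruno estimate needs the `i`-th derivative of `u` to be at most the `i`-th power
    -- of one number, here `B' / (1 + ‖v‖) ^ k`; hence decay of order `k * i`. Taking `B' ≥ 1`
    -- ensures `B i ≤ B' ≤ B' ^ i`.
    choose B hB0 hB using fun i : ℕ => hbd (k * i) i
    set A' := ∑ i ∈ Finset.range (n + 1), |A i|
    set B' := 1 + ∑ i ∈ Finset.range (n + 1), B i with hB'
    have hB'1 : 1 ≤ B' := by
      have : 0 ≤ ∑ i ∈ Finset.range (n + 1), B i := Finset.sum_nonneg fun i _ => hB0 i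
      linarith
    have hA'0 : 0 ≤ A' := Finset.sum_nonneg fun i _ => abs_nonneg _
    refine ⟨n.factorial * A' * B' ^ n, fun y hy v => ?_⟩
    have hv : (1 : ℝ) ≤ 1 + ‖v‖ := by linarith [norm_nonneg v]
    have hpos : (0 : ℝ) < (1 + ‖v‖) ^ k := by positivity
    have h1 := norm_iteratedFDerivWithin_comp_le (n := n) hh hus (by exact_mod_cast le_top)
      hΩ.uniqueDiffOn hDu hmaps (x := (y, v)) ⟨hKD hy, mem_univ _⟩ (C := A')
      (D := B' / (1 + ‖v‖) ^ k)
      (fun i hi => (hA i _ (huC _)).trans ((le_abs_self _).trans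
        (Finset.single_le_sum (f := fun i => |A i|) (fun i _ => abs_nonneg _)
          (Finset.mem_range.2 (Nat.lt_succ_of_le hi)))))
      (fun i hi1 hi => by
        rw [div_pow, ← pow_mul, le_div_iff₀ (by positivity), mul_comm]
        refine (hB i y hy v).trans ?_
        refine le_trans ?_ (le_self_pow₀ hB'1 (by omega))
        have := Finset.single_le_sum (f := B) (fun i _ => hB0 i)
          (Finset.mem_range.2 (Nat.lt_succ_of_le hi))
        linarith)
    refine (mul_le_mul_of_nonneg_left h1 (by positivity)).trans ?_
    rw [div_pow, ← pow_mul]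
    have h2 : ‖v‖ ^ k ≤ (1 + ‖v‖) ^ (k * n) :=
      (pow_le_pow_left₀ (norm_nonneg v) (by linarith) k).trans
        (pow_le_pow_right₀ hv (Nat.le_mul_of_pos_right k hn))
    rw [mul_div_assoc', mul_div_assoc', div_le_iff₀ (by positivity), mul_comm]
    exact mul_le_mul_of_nonneg_left h2 (by positivity)

end SmoothCalculus

/-! ### Vanishing at infinity and smooth functional calculus on the total space -/

section SchwartzCalculus

open Filter Topology

variable {EB : Type*} [NormedAddCommGroup EB] [NormedSpace ℝ EB] [FiniteDimensional ℝ EB]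
    {HB : Type*} [TopologicalSpace HB] {I : ModelWithCorners ℝ EB HB}
    {X : Type*} [TopologicalSpace X] [ChartedSpace HB X] [IsManifold I ∞ X]
    {F : Type*} [NormedAddCommGroup F] [NormedSpace ℝ F] [FiniteDimensional ℝ F]
    {E : X → Type*} [∀ x, AddCommGroup (E x)] [∀ x, Module ℝ (E x)]
    [∀ x, TopologicalSpace (E x)]
    [TopologicalSpace (TotalSpace F E)] [FiberBundle F E] [VectorBundle ℝ F E]
    [ContMDiffVectorBundle ∞ F E I]

/-- The part of the total space over a compact set contained in a trivializing open set, with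
fibre coordinates of norm at most `R`, is compact. -/
theorem isCompact_bundle_tube {x₀ : X} {N : Set X} (hN : IsCompact N)
    (hNb : N ⊆ (trivializationAt F E x₀).baseSet) (R : ℝ) :
    IsCompact {p : TotalSpace F E | p.proj ∈ N ∧ ‖(trivializationAt F E x₀ p).2‖ ≤ R} := by
  have h1 : {p : TotalSpace F E | p.proj ∈ N ∧ ‖(trivializationAt F E x₀ p).2‖ ≤ R} =
      (trivializationAt F E x₀).toOpenPartialHomeomorph.symm '' (N ×ˢ Metric.closedBall 0 R) := by
    ext p
    constructor
    · rintro ⟨hp, hR⟩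
      have hs := (trivializationAt F E x₀).mem_source.2 (hNb hp)
      refine ⟨trivializationAt F E x₀ p, ⟨?_, mem_closedBall_zero_iff.2 hR⟩,
        (trivializationAt F E x₀).left_inv hs⟩
      rw [(trivializationAt F E x₀).coe_fst hs]
      exact hp
    · rintro ⟨⟨x, v⟩, ⟨hx, hv⟩, rfl⟩
      have ht : (x, v) ∈ (trivializationAt F E x₀).target :=
        (trivializationAt F E x₀).mem_target.2 (hNb hx)
      refine ⟨?_, ?_⟩
      · rw [(trivializationAt F E x₀).proj_symm_apply ht]
        exact hx
      · rw [(trivializationAt F E x₀).apply_symm_apply ht]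
        exact mem_closedBall_zero_iff.1 hv
  rw [h1]
  refine (hN.prod (isCompact_closedBall _ _)).image_of_continuousOn ?_
  refine (trivializationAt F E x₀).toOpenPartialHomeomorph.continuousOn_symm.mono ?_
  rintro ⟨x, v⟩ ⟨hx, -⟩
  exact (trivializationAt F E x₀).mem_target.2 (hNb hx)

/-- The compact set `K` is covered by finitely many compact trivializing sets `N x`. Over `N x` the
product of the fibre norm with `‖f‖` is at most `C x`, so `‖f‖ ≥ ε` can occur only in a compact tube
of radius `C x / ε`. -/
theorem IsBundleSchwartz.tendsto_cocompact {f : TotalSpace F E → ℂ} (hf : IsBundleSchwartz I f) :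
    Tendsto f (cocompact (TotalSpace F E)) (𝓝 0) := by
  have : LocallyCompactSpace X := Manifold.locallyCompact_of_finiteDimensional I
  obtain ⟨⟨K, hK, hKf⟩, hloc⟩ := (isBundleSchwartz_iff I).1 hf
  have hN : ∀ x : X, ∃ N ∈ 𝓝 x, IsCompact N ∧
      N ⊆ (extChartAt I x).source ∩ (trivializationAt F E x).baseSet := by
    intro x
    obtain ⟨N, hN, hNs, hNc⟩ := local_compact_nhds
      (((isOpen_extChartAt_source (I := I) x).inter (trivializationAt F E x).open_baseSet).mem_nhds
      ⟨mem_extChartAt_source x, FiberBundle.mem_baseSet_trivializationAt F E x⟩)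
    exact ⟨N, hN, hNc, hNs⟩
  choose N hNn hNc hNs using hN
  obtain ⟨t, -, ht⟩ := hK.elim_nhds_subcover N fun x _ => hNn x
  rw [Metric.tendsto_nhds]
  intro ε hε
  have hbd : ∀ x : X, ∃ C : ℝ, ∀ p : TotalSpace F E, p.proj ∈ N x →
      ‖(trivializationAt F E x p).2‖ * ‖f p‖ ≤ C := by
    intro x
    obtain ⟨C, hC⟩ := (hloc x).decay (extChartAt I x '' N x)
      ((hNc x).image_of_continuousOn
        ((continuousOn_extChartAt x).mono fun z hz => (hNs x hz).1))
      (by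
        rintro _ ⟨z, hz, rfl⟩
        exact mem_bundleChartDomain I (hNs x hz).1 (hNs x hz).2) 1 0
    refine ⟨C, fun p hp => ?_⟩
    have h1 := hC _ (mem_image_of_mem _ hp) (trivializationAt F E x p).2
    rwa [norm_iteratedFDerivWithin_zero, pow_one,
      ← eq_bundleLocalRep I f (hNs x hp).1 (hNs x hp).2] at h1
  choose C hC using hbd
  have hcomp : IsCompact (⋃ x ∈ t, {p : TotalSpace F E | p.proj ∈ N x ∧
      ‖(trivializationAt F E x p).2‖ ≤ C x / ε}) :=
    t.isCompact_biUnion fun x _ => isCompact_bundle_tube (hNc x) (fun z hz => (hNs x hz).2) _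
  refine mem_of_superset hcomp.compl_mem_cocompact fun p hp => ?_
  rw [mem_ofPred_eq, dist_zero_right]
  by_cases hpK : p.proj ∈ K
  · obtain ⟨x, hx, hpx⟩ := mem_iUnion₂.1 (ht hpK)
    by_contra! hfp
    refine hp (mem_iUnion₂.2 ⟨x, hx, hpx, ?_⟩)
    rw [le_div_iff₀ hε]
    exact (mul_le_mul_of_nonneg_left hfp (norm_nonneg _)).trans (hC x p hpx)
  · rw [hKf p hpK, norm_zero]
    exact hε

theorem IsBundleSchwartz.continuous {f : TotalSpace F E → ℂ} (hf : IsBundleSchwartz I f) :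
    Continuous f := hf.smooth.continuous

/-- Since `u` vanishes at infinity, its values together with `0` form a compact subset of `Ω`. The
derivatives of `h` are therefore uniformly bounded along `u`, and `h 0 = 0` keeps the support over a
compact set of the base. -/
theorem IsBundleSchwartz.comp {κ : Type*} [Fintype κ] {u : TotalSpace F E → κ → ℂ}
    (hu : ∀ i, IsBundleSchwartz I (fun p => u p i)) {Ω : Set (κ → ℂ)} (hΩ : IsOpen Ω)
    (h0Ω : (0 : κ → ℂ) ∈ Ω) (huΩ : ∀ p, u p ∈ Ω) {h : (κ → ℂ) → ℂ} (hh : ContDiffOn ℝ ∞ h Ω)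
    (h0 : h 0 = 0) : IsBundleSchwartz I (fun p => h (u p)) := by
  have hC : IsCompact (insert (0 : κ → ℂ) (range u)) :=
    Filter.Tendsto.isCompact_insert_range_of_cocompact
      (tendsto_pi_nhds.2 fun i => (hu i).tendsto_cocompact)
      (continuous_pi fun i => (hu i).continuous)
  rw [isBundleSchwartz_iff]
  constructor
  · choose K hK hKu using fun i => (hu i).support
    refine ⟨⋃ i, K i, isCompact_iUnion hK, fun p hp => ?_⟩
    have : u p = 0 := funext fun i => hKu i p fun hpi => hp (mem_iUnion.2 ⟨i, hpi⟩)
    change h (u p) = 0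
    rw [this, h0]
  · intro x₀
    refine RapidlyDecreasing.comp (bundleChartDomain_uniqueDiffOn I F E x₀)
      (u := fun q i => bundleLocalRep I (fun p => u p i) x₀ q)
      (fun i => ((isBundleSchwartz_iff I).1 (hu i)).2 x₀) hΩ hC
      (insert_subset h0Ω (range_subset_iff.2 huΩ)) (mem_insert _ _)
      (fun q => mem_insert_of_mem _ (mem_range_self _)) hh h0

/-- Smooth functions can be applied to families of functions that differ from constants by
Schwartz functions. -/
theorem IsBundleSchwartz.comp_sub {κ : Type*} [Fintype κ] {w : TotalSpace F E → κ → ℂ} {c : κ → ℂ}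
    (hw : ∀ i, IsBundleSchwartz I (fun p => w p i - c i)) {Ω : Set (κ → ℂ)} (hΩ : IsOpen Ω)
    (hcΩ : c ∈ Ω) (hwΩ : ∀ p, w p ∈ Ω) {h : (κ → ℂ) → ℂ} (hh : ContDiffOn ℝ ∞ h Ω) :
    IsBundleSchwartz I (fun p => h (w p) - h c) := by
  have h1 := IsBundleSchwartz.comp (u := fun p => w p - c) hw
    (Ω := (fun z => z + c) ⁻¹' Ω) (hΩ.preimage (by fun_prop)) (by simpa using hcΩ)
    (fun p => by simpa using hwΩ p) (h := fun z => h (z + c) - h c)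
    ((hh.comp (g := h) (f := fun z => z + c) (by fun_prop) fun z hz => hz).sub contDiffOn_const) (by simp)
  simpa using h1

end SchwartzCalculus

/-! ### Density of the Schwartz functions -/

section SchwartzDensity

open Filter Topology

theorem Bundle.TotalSpace.t2Space {X F : Type*} {E : X → Type*} [TopologicalSpace X] [T2Space X]
    [TopologicalSpace F] [T2Space F] [∀ x, TopologicalSpace (E x)] [TopologicalSpace (TotalSpace F E)]
    [FiberBundle F E] : T2Space (TotalSpace F E) := by
  refine ⟨fun p q hpq => ?_⟩
  by_cases h : p.proj = q.proj
  · set e := trivializationAt F E p.proj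
    have hp : p ∈ e.source := e.mem_source.2 (FiberBundle.mem_baseSet_trivializationAt F E _)
    have hq : q ∈ e.source := e.mem_source.2 (h ▸ FiberBundle.mem_baseSet_trivializationAt F E _)
    obtain ⟨A, B, hA, hB, hpA, hqB, hAB⟩ := t2_separation (e.injOn.ne hp hq hpq)
    refine ⟨e.source ∩ e ⁻¹' A, e.source ∩ e ⁻¹' B,
      e.continuousOn_toFun.isOpen_inter_preimage e.open_source hA,
      e.continuousOn_toFun.isOpen_inter_preimage e.open_source hB, ⟨hp, hpA⟩, ⟨hq, hqB⟩, ?_⟩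
    exact (hAB.preimage e).mono inter_subset_right inter_subset_right
  · obtain ⟨A, B, hA, hB, hpA, hqB, hAB⟩ := t2_separation h
    exact ⟨_, _, hA.preimage (FiberBundle.continuous_proj F E),
      hB.preimage (FiberBundle.continuous_proj F E), hpA, hqB, hAB.preimage _⟩

variable {EB : Type*} [NormedAddCommGroup EB] [NormedSpace ℝ EB] [FiniteDimensional ℝ EB]
    {HB : Type*} [TopologicalSpace HB] {I : ModelWithCorners ℝ EB HB}
    {X : Type*} [TopologicalSpace X] [ChartedSpace HB X] [IsManifold I ∞ X] [T2Space X]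
    {F : Type*} [NormedAddCommGroup F] [NormedSpace ℝ F] [FiniteDimensional ℝ F]
    {E : X → Type*} [∀ x, AddCommGroup (E x)] [∀ x, Module ℝ (E x)]
    [∀ x, TopologicalSpace (E x)]
    [TopologicalSpace (TotalSpace F E)] [FiberBundle F E] [VectorBundle ℝ F E]
    [ContMDiffVectorBundle ∞ F E I]

/-- Over a compact set `K` of the chart the support corresponds to a compact set of coordinates,
where the weighted derivative is bounded by continuity. Off the support the function vanishes
locally, and so do its derivatives. -/
theorem isBundleSchwartz_of_hasCompactSupport {f : TotalSpace F E → ℂ}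
    (hf : ContMDiff (I.prod 𝓘(ℝ, F)) 𝓘(ℝ, ℂ) ∞ f) (hc : HasCompactSupport f) :
    IsBundleSchwartz I f := by
  refine ⟨hf, ⟨TotalSpace.proj '' tsupport f,
    hc.isCompact.image (FiberBundle.continuous_proj F E), fun p hp => ?_⟩, fun x₀ K hK hKD k n => ?_⟩
  · by_contra h
    exact hp (mem_image_of_mem _ (subset_tsupport f h))
  set D := bundleChartDomain I F E x₀
  set e := trivializationAt F E x₀
  set Ψ : EB × F → TotalSpace F E :=
    fun p => e.toOpenPartialHomeomorph.symm ((extChartAt I x₀).symm p.1, p.2)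
  have htarget : ∀ p ∈ D ×ˢ (univ : Set F), ((extChartAt I x₀).symm p.1, p.2) ∈ e.target :=
    fun p hp => e.mem_target.2 hp.1.2
  have hΨ : ContinuousOn Ψ (D ×ˢ univ) := by
    refine e.toOpenPartialHomeomorph.continuousOn_symm.comp ?_ htarget
    exact ((continuousOn_extChartAt_symm x₀).comp continuousOn_fst fun p hp => hp.1.1).prodMk
      continuousOn_snd
  have hg := bundleLocalRep_contDiffOn I hf x₀
  have hDu := bundleChartDomain_prod_uniqueDiffOn I F E x₀
  set S : Set (TotalSpace F E) := tsupport f ∩ TotalSpace.proj ⁻¹' ((extChartAt I x₀).symm '' K)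
  have hS : IsCompact S := by
    refine hc.isCompact.inter_right (IsClosed.preimage (FiberBundle.continuous_proj F E) ?_)
    exact (hK.image_of_continuousOn ((continuousOn_extChartAt_symm x₀).mono
      fun y hy => (hKD hy).1)).isClosed
  have hSsub : S ⊆ TotalSpace.proj ⁻¹' ((extChartAt I x₀).source ∩ e.baseSet) := by
    rintro p ⟨-, y, hy, hyp⟩
    rw [mem_preimage, ← hyp]
    exact ⟨(extChartAt I x₀).map_target (hKD hy).1, (hKD hy).2⟩
  have hT := hS.image_of_continuousOn ((contMDiffOn_bundle_coordinates I x₀).continuousOn.mono hSsub)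
  have hTsub : (fun p : TotalSpace F E => (extChartAt I x₀ p.proj, (e p).2)) '' S ⊆ D ×ˢ univ := by
    rintro _ ⟨p, hp, rfl⟩
    exact ⟨mem_bundleChartDomain I (hSsub hp).1 (hSsub hp).2, mem_univ _⟩
  have hcont : ContinuousOn (fun q : EB × F => ‖q.2‖ ^ k *
      ‖iteratedFDerivWithin ℝ n (bundleLocalRep I f x₀) (D ×ˢ univ) q‖) (D ×ˢ univ) := by
    have := (hg.continuousOn_iteratedFDerivWithin (m := n) (by exact_mod_cast le_top) hDu).norm
    exact ((continuous_snd.norm.pow k).continuousOn).mul this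
  obtain ⟨C, hC⟩ := hT.exists_bound_of_continuousOn (hcont.mono hTsub)
  refine ⟨max C 0, fun y hy v => ?_⟩
  have hmem : (y, v) ∈ D ×ˢ (univ : Set F) := ⟨hKD hy, mem_univ _⟩
  by_cases h : Ψ (y, v) ∈ tsupport f
  · have hproj : (Ψ (y, v)).proj = (extChartAt I x₀).symm y := e.proj_symm_apply (htarget _ hmem)
    have hsnd : (e (Ψ (y, v))).2 = v := congrArg Prod.snd (e.apply_symm_apply (htarget _ hmem))
    have h1 := hC (y, v) ⟨Ψ (y, v), ⟨h, ?_⟩, ?_⟩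
    · exact (le_abs_self _).trans (h1.trans (le_max_left _ _))
    · rw [mem_preimage, hproj]
      exact mem_image_of_mem _ hy
    · exact Prod.ext (by simp only [hproj, (extChartAt I x₀).right_inv (hKD hy).1]) hsnd
  · have h0 : bundleLocalRep I f x₀ =ᶠ[𝓝[D ×ˢ univ] (y, v)] fun _ => 0 :=
      (hΨ _ hmem).eventually (notMem_tsupport_iff_eventuallyEq.1 h)
    rw [h0.iteratedFDerivWithin_eq (h0.eq_of_nhdsWithin hmem)]
    rw [show iteratedFDerivWithin ℝ n (fun _ : EB × F => (0 : ℂ)) = 0 from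
      funext fun _ => iteratedFDerivWithin_fun_zero]
    simp

theorem isBundleSchwartz_conj {f : TotalSpace F E → ℂ} (hf : IsBundleSchwartz I f) :
    IsBundleSchwartz I (fun p => starRingEnd ℂ (f p)) :=
  IsBundleSchwartz.comp (κ := Unit) (u := fun p _ => f p) (fun _ => hf) isOpen_univ (mem_univ _)
    (fun _ => mem_univ _) (h := fun z => starRingEnd ℂ (z ()))
    (Complex.conjCLE.contDiff.comp (contDiff_apply ℝ ℂ ())).contDiffOn (by simp)

variable (I F E) in
/-- The continuous functions on the one-point compactification of the total space that differ from
their value at infinity by a Schwartz function. -/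
def schwartzOnePoint : StarSubalgebra ℂ C(OnePoint (TotalSpace F E), ℂ) where
  carrier := {φ | IsBundleSchwartz I (fun p : TotalSpace F E => φ p - φ OnePoint.infty)}
  mul_mem' {φ ψ} hφ hψ := by
    have h := ((hφ.mul I hψ).add I (hψ.smul I (φ OnePoint.infty))).add I
      (hφ.smul I (ψ OnePoint.infty))
    refine (congrArg (IsBundleSchwartz I) (funext fun p => ?_)).mp h
    simp only [ContinuousMap.mul_apply, Pi.add_apply, Pi.mul_apply, Pi.smul_apply, smul_eq_mul]
    ring
  add_mem' {φ ψ} hφ hψ := by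
    have h := hφ.add I hψ
    refine (congrArg (IsBundleSchwartz I) (funext fun p => ?_)).mp h
    simp only [ContinuousMap.add_apply, Pi.add_apply]
    ring
  algebraMap_mem' c := by
    refine (congrArg (IsBundleSchwartz I) (funext fun p => ?_)).mp (IsBundleSchwartz.zero I)
    simp
  star_mem' {φ} hφ := by
    refine (congrArg (IsBundleSchwartz I) (funext fun p => ?_)).mp (isBundleSchwartz_conj hφ)
    simp

/-- A bump function on the total space, equal to `1` at the finite point and vanishing at the other
point, extends by `0` at infinity. -/
theorem schwartzOnePoint_separatesPoints :
    (schwartzOnePoint I F E).SeparatesPoints := by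
  have : T2Space (TotalSpace F E) := TotalSpace.t2Space
  have key : ∀ (p : TotalSpace F E) (q : OnePoint (TotalSpace F E)), (p : OnePoint _) ≠ q →
      ∃ f ∈ (fun φ : C(OnePoint (TotalSpace F E), ℂ) => (φ : OnePoint (TotalSpace F E) → ℂ)) ''
        (schwartzOnePoint I F E : Set C(OnePoint (TotalSpace F E), ℂ)), f p ≠ f q := by
    intro p q hpq
    set s : Set (TotalSpace F E) := {r | (r : OnePoint (TotalSpace F E)) ≠ q}
    have hs : s ∈ 𝓝 p := by
      rcases q with _ | q
      · exact Filter.mem_of_superset univ_mem fun r _ => OnePoint.coe_ne_infty r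
      · refine Filter.mem_of_superset (isOpen_compl_singleton.mem_nhds
          (x := p) (s := {q}ᶜ) fun h => hpq (congrArg _ h)) fun r hr h => hr ?_
        exact OnePoint.coe_injective h
    obtain ⟨ρ, -, hρ⟩ := (SmoothBumpFunction.nhds_basis_support (I := I.prod 𝓘(ℝ, F)) hs).mem_iff.1 hs
    have hsm : ContMDiff (I.prod 𝓘(ℝ, F)) 𝓘(ℝ, ℂ) ∞ (fun r : TotalSpace F E => (ρ r : ℂ)) :=
      Complex.ofRealCLM.contDiff.contMDiff.comp ρ.contMDiff
    have hc : HasCompactSupport (fun r : TotalSpace F E => (ρ r : ℂ)) :=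
      ρ.hasCompactSupport.comp_left Complex.ofReal_zero
    have hS := isBundleSchwartz_of_hasCompactSupport hsm hc
    set φ : C(OnePoint (TotalSpace F E), ℂ) := OnePoint.continuousMapMk ⟨_, hS.continuous⟩ 0
      (hS.tendsto_cocompact.mono_left coclosedCompact_eq_cocompact.le)
    refine ⟨φ, ⟨φ, ?_, rfl⟩, ?_⟩
    · change IsBundleSchwartz I (fun r : TotalSpace F E => (ρ r : ℂ) - 0)
      simpa using hS
    · have h1 : φ p = 1 := by
        change (ρ p : ℂ) = 1
        rw [ρ.eq_one, Complex.ofReal_one]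
      have h2 : φ q = 0 := by
        rcases q with _ | q
        · rfl
        · change (ρ q : ℂ) = 0
          rw [Complex.ofReal_eq_zero]
          by_contra h
          exact hρ h rfl
      simp [h1, h2]
  intro p q hpq
  rcases p with _ | p
  · rcases q with _ | q
    · exact absurd rfl hpq
    · obtain ⟨f, hf, hfp⟩ := key q _ hpq.symm
      exact ⟨f, hf, hfp.symm⟩
  · exact key p q hpq

variable (I) in
-- Stone–Weierstrass on the one-point compactification. The approximant may have a nonzero value at
-- infinity; subtracting it costs the second `ε / 2`.
theorem exists_isBundleSchwartz_norm_sub_lt (b : C₀(TotalSpace F E, ℂ)) {ε : ℝ} (hε : 0 < ε) :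
    ∃ g, IsBundleSchwartz I g ∧ ∀ p, ‖g p - b p‖ < ε := by
  have : T2Space (TotalSpace F E) := TotalSpace.t2Space
  set B : C(OnePoint (TotalSpace F E), ℂ) := OnePoint.continuousMapMk b.toContinuousMap 0
    (b.zero_at_infty'.mono_left coclosedCompact_eq_cocompact.le)
  have hB : B ∈ (schwartzOnePoint I F E).topologicalClosure := by
    rw [ContinuousMap.starSubalgebra_topologicalClosure_eq_top_of_separatesPoints _
      schwartzOnePoint_separatesPoints]
    exact StarSubalgebra.mem_top
  obtain ⟨φ, hφ, hφB⟩ := Metric.mem_closure_iff.1 hB (ε / 2) (half_pos hε)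
  have hd : ∀ x, ‖φ x - B x‖ < ε / 2 := fun x => by
    rw [← dist_eq_norm, dist_comm]
    exact (ContinuousMap.dist_apply_le_dist x).trans_lt hφB
  refine ⟨_, hφ, fun p => ?_⟩
  have h1 := hd p
  have h2 := hd OnePoint.infty
  change ‖φ p - b p‖ < ε / 2 at h1
  change ‖φ OnePoint.infty - 0‖ < ε / 2 at h2
  rw [sub_zero] at h2
  calc ‖φ p - φ OnePoint.infty - b p‖ = ‖(φ p - b p) - φ OnePoint.infty‖ := by ring_nf
    _ ≤ ‖φ p - b p‖ + ‖φ OnePoint.infty‖ := norm_sub_le _ _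
    _ < ε := by linarith

end SchwartzDensity

/-! ### Equivalence of idempotent matrices and `K₀` -/

section KTheoryMap

namespace IdempotentMatrix

variable {R S : Type*} [Ring R] [Ring S]

theorem Equivalent.symm {p q : IdempotentMatrix R} (h : p.Equivalent q) : q.Equivalent p := by
  obtain ⟨u, v, huv, hvu⟩ := h
  exact ⟨v, u, hvu, huv⟩

/-- The composites give `p²` and `r²`, so idempotency removes any need to normalize `u` and `v` by
`p u q = u`. -/
theorem Equivalent.trans {p q r : IdempotentMatrix R} (h : p.Equivalent q) (h' : q.Equivalent r) :
    p.Equivalent r := by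
  obtain ⟨u, v, huv, hvu⟩ := h
  obtain ⟨u', v', huv', hvu'⟩ := h'
  refine ⟨u * u', v' * v, ?_, ?_⟩
  · calc u * u' * (v' * v) = u * (u' * v') * v := by simp only [Matrix.mul_assoc]
      _ = (u * v) * (u * v) := by rw [huv', ← hvu]; simp only [Matrix.mul_assoc]
      _ = p.2.1 := by rw [huv]; exact p.2.2.eq
  · calc v' * v * (u * u') = v' * (v * u) * u' := by simp only [Matrix.mul_assoc]
      _ = (v' * u') * (v' * u') := by rw [hvu, ← huv']; simp only [Matrix.mul_assoc]
      _ = r.2.1 := by rw [hvu']; exact r.2.2.eq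

theorem fromBlocks_submatrix_mul {a b c d k l : ℕ} (u : Matrix (Fin a) (Fin b) R)
    (u' : Matrix (Fin c) (Fin d) R) (v : Matrix (Fin b) (Fin k) R) (v' : Matrix (Fin d) (Fin l) R) :
    (Matrix.fromBlocks u 0 0 u').submatrix finSumFinEquiv.symm finSumFinEquiv.symm *
      (Matrix.fromBlocks v 0 0 v').submatrix finSumFinEquiv.symm finSumFinEquiv.symm =
    (Matrix.fromBlocks (u * v) 0 0 (u' * v')).submatrix
      (finSumFinEquiv (m := a) (n := c)).symm (finSumFinEquiv (m := k) (n := l)).symm := by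
  rw [Matrix.submatrix_mul_equiv, Matrix.fromBlocks_multiply]
  simp

theorem Equivalent.directSum {p q p' q' : IdempotentMatrix R} (h : p.Equivalent p')
    (h' : q.Equivalent q') : (p.directSum q).Equivalent (p'.directSum q') := by
  obtain ⟨u, v, huv, hvu⟩ := h
  obtain ⟨u', v', huv', hvu'⟩ := h'
  refine ⟨(Matrix.fromBlocks u 0 0 u').submatrix finSumFinEquiv.symm finSumFinEquiv.symm,
    (Matrix.fromBlocks v 0 0 v').submatrix finSumFinEquiv.symm finSumFinEquiv.symm, ?_, ?_⟩
  · exact (fromBlocks_submatrix_mul u u' v v').trans (by rw [huv, huv']; rfl)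
  · exact (fromBlocks_submatrix_mul v v' u u').trans (by rw [hvu, hvu']; rfl)

theorem map_directSum (f : R →+* S) (p q : IdempotentMatrix R) :
    (p.directSum q).map f = (p.map f).directSum (q.map f) := by
  refine Sigma.ext rfl (heq_of_eq (Subtype.ext ?_))
  have h0 : (Matrix.fromBlocks p.2.1 0 0 q.2.1).map f =
      Matrix.fromBlocks (p.2.1.map f) 0 0 (q.2.1.map f) := by
    rw [Matrix.fromBlocks_map]
    simp
  exact congrArg (fun m => Matrix.submatrix m (finSumFinEquiv (m := p.1) (n := q.1)).symm
    (finSumFinEquiv (m := p.1) (n := q.1)).symm) h0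

theorem Equivalent.mk_eq {p q : IdempotentMatrix R} (h : p.Equivalent q) :
    (QuotientAddGroup.mk (FreeAbelianGroup.of p) : K0Unital R) =
      QuotientAddGroup.mk (FreeAbelianGroup.of q) := by
  rw [QuotientAddGroup.eq_iff_sub_mem]
  exact AddSubgroup.subset_closure (Or.inl ⟨p, q, h, rfl⟩)

theorem mk_directSum (p q : IdempotentMatrix R) :
    (QuotientAddGroup.mk (FreeAbelianGroup.of (p.directSum q)) : K0Unital R) =
      QuotientAddGroup.mk (FreeAbelianGroup.of p) + QuotientAddGroup.mk (FreeAbelianGroup.of q) := by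
  rw [← QuotientAddGroup.mk_add, QuotientAddGroup.eq_iff_sub_mem]
  exact AddSubgroup.subset_closure (Or.inr ⟨p, q, rfl⟩)

end IdempotentMatrix

open IdempotentMatrix in
-- The inverse sends `[p]` to the class of a chosen lift `s p`. Reflection of equivalence along `j`
-- makes this independent of the choice and compatible with both kinds of relations.
theorem K0Unital.map_bijective {R S : Type*} [Ring R] [Ring S] (j : R →+* S)
    (hs : ∀ p : IdempotentMatrix S, ∃ e : IdempotentMatrix R, (e.map j).Equivalent p)
    (hi : ∀ e e' : IdempotentMatrix R, (e.map j).Equivalent (e'.map j) → e.Equivalent e') :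
    Function.Bijective (K0Unital.map j) := by
  choose s hs using hs
  set L : FreeAbelianGroup (IdempotentMatrix S) →+ K0Unital R :=
    FreeAbelianGroup.lift fun p => QuotientAddGroup.mk (FreeAbelianGroup.of (s p)) with hL
  have hker : K0Relations S ≤ L.ker := by
    rw [K0Relations, AddSubgroup.closure_le]
    rintro z (⟨p, q, h, rfl⟩ | ⟨p, q, rfl⟩)
    · have := (hi (s p) (s q) (((hs p).trans h).trans (hs q).symm)).mk_eq
      simp [hL, this]
    · have h1 : ((s (p.directSum q)).map j).Equivalent (((s p).directSum (s q)).map j) := by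
        rw [map_directSum]
        exact (hs _).trans ((hs p).directSum (hs q)).symm
      have := (hi _ _ h1).mk_eq
      simp [hL, this, mk_directSum]
  set T : K0Unital S →+ K0Unital R := QuotientAddGroup.lift (K0Relations S) L hker
  have h1 : ∀ x, T (K0Unital.map j x) = x := by
    intro x
    induction x using QuotientAddGroup.induction_on with
    | H x =>
      change L (FreeAbelianGroup.map (IdempotentMatrix.map j) x) = _
      induction x using FreeAbelianGroup.induction_on with
      | zero => simp
      | of p =>
        have := (hi _ _ (hs (p.map j))).mk_eq
        simpa [hL] using this
      | neg p h => simpa using h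
      | add x y hx hy => simp only [map_add, hx, hy, QuotientAddGroup.mk_add]
  have h2 : ∀ y, K0Unital.map j (T y) = y := by
    intro y
    induction y using QuotientAddGroup.induction_on with
    | H y =>
      change K0Unital.map j (L y) = _
      induction y using FreeAbelianGroup.induction_on with
      | zero => simp
      | of p =>
        have h3 : K0Unital.map j (QuotientAddGroup.mk (FreeAbelianGroup.of (s p))) =
          QuotientAddGroup.mk (FreeAbelianGroup.of ((s p).map j)) := rfl
        simpa [hL, h3] using (hs p).mk_eq
      | neg p h => simpa using h
      | add x y hx hy => simp only [map_add, hx, hy, QuotientAddGroup.mk_add]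
  exact ⟨Function.LeftInverse.injective h1, Function.RightInverse.surjective h2⟩

variable {A B : Type*} [NonUnitalRing A] [Module ℂ A] [IsScalarTower ℂ A A] [SMulCommClass ℂ A A]
  [NonUnitalRing B] [Module ℂ B] [IsScalarTower ℂ B B] [SMulCommClass ℂ B B]

theorem unitizationMap_fst (φ : A →ₙₐ[ℂ] B) (x : Unitization ℂ A) :
    (unitizationMap φ x).fst = x.fst := by
  simp [unitizationMap, Unitization.algebraMap_eq_inl]

theorem unitizationMap_snd (φ : A →ₙₐ[ℂ] B) (x : Unitization ℂ A) :
    (unitizationMap φ x).snd = φ x.snd := by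
  simp [unitizationMap, Unitization.algebraMap_eq_inl]

/-- The map commutes with the augmentations to `ℂ`, so a bijection of the unital groups restricts to
their kernels. -/
theorem K0.map_bijective (φ : A →ₙₐ[ℂ] B) (h : Function.Bijective
    (K0Unital.map (unitizationMap φ : Unitization ℂ A →+* Unitization ℂ B))) :
    Function.Bijective (K0.map φ) := by
  refine ⟨fun x y hxy => Subtype.ext (h.1 (congrArg Subtype.val hxy)), fun y => ?_⟩
  obtain ⟨x, hx⟩ := h.2 y.1
  refine ⟨⟨x, ?_⟩, Subtype.ext hx⟩
  have e : (Unitization.fstHom ℂ B : Unitization ℂ B →+* ℂ).comp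
      (unitizationMap φ : Unitization ℂ A →+* Unitization ℂ B) =
      (Unitization.fstHom ℂ A : Unitization ℂ A →+* ℂ) :=
    RingHom.ext fun x => unitizationMap_fst φ x
  have h2 := y.2
  change K0Unital.map (Unitization.fstHom ℂ A : Unitization ℂ A →+* ℂ) x = 0
  change K0Unital.map (Unitization.fstHom ℂ B : Unitization ℂ B →+* ℂ) y.1 = 0 at h2
  rw [← hx, K0Unital.map_map, e] at h2
  exact h2

end KTheoryMap

/-! ### Idempotents in a normed ring -/

section CloseIdempotents

/-- Two idempotents that are close to each other are equivalent. -/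
theorem exists_mul_eq_of_idempotent_close {R : Type*} [NormedRing R] [CompleteSpace R]
    {p q : R} (hp : p * p = p) (hq : q * q = q) (h : ‖(2 * q - 1) * (p - q)‖ < 1) :
    ∃ u v : R, u * v = q ∧ v * u = p := by
  -- This element satisfies `q x = x p` and equals `1 + (2q - 1)(p - q)`; closeness makes it
  -- invertible, so it conjugates `p` to `q`.
  set x := q * p + (1 - q) * (1 - p) with hx
  have h1 : x = 1 - -((2 * q - 1) * (p - q)) := by
    have : (2 * q - 1) * (p - q) = 2 * (q * p) - 2 * (q * q) - p + q := by noncomm_ring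
    rw [this, hq, hx]
    noncomm_ring
  have h2 : IsUnit x := by
    rw [h1]
    exact isUnit_one_sub_of_norm_lt_one (by rwa [norm_neg])
  obtain ⟨y, hy⟩ := h2
  have hqx : q * x = x * p := by
    have e1 : q * x = q * p := by
      calc q * x = (q * q) * p + (q - q * q) * (1 - p) := by rw [hx]; noncomm_ring
        _ = q * p := by rw [hq, sub_self, zero_mul, add_zero]
    have e2 : x * p = q * p := by
      calc x * p = q * (p * p) + (1 - q) * (p - p * p) := by rw [hx]; noncomm_ring
        _ = q * p := by rw [hp, sub_self, mul_zero, add_zero]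
    rw [e1, e2]
  have hqp : (↑y⁻¹ : R) * q * x = p := by
    rw [mul_assoc, hqx, ← hy, Units.inv_mul_cancel_left]
  refine ⟨q * x, (↑y⁻¹ : R) * q, ?_, ?_⟩
  · rw [mul_assoc, ← mul_assoc x, ← hy, Units.mul_inv, one_mul, hq]
  · rw [mul_assoc, ← mul_assoc q, hq, ← mul_assoc, hqp]

end CloseIdempotents

/-! ### The smooth retraction onto idempotents in a Banach algebra -/

section InvSqrt

open Filter Topology

/-- The coefficients of the power series of `(1 - y)^(-1/2)`. -/
def invSqrtCoeff (n : ℕ) : ℝ := (-1) ^ n * Ring.choose (-1 / 2 : ℝ) n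

theorem invSqrtCoeff_zero : invSqrtCoeff 0 = 1 := by simp [invSqrtCoeff]

/-- Consecutive coefficients have ratio `(n + 1/2) / (n + 1)`, which is less than one. -/
theorem abs_invSqrtCoeff_le (n : ℕ) : |invSqrtCoeff n| ≤ 1 := by
  rw [invSqrtCoeff, abs_mul, abs_pow, abs_neg, abs_one, one_pow, one_mul]
  induction n with
  | zero => simp
  | succ n ih =>
    have h : ((n : ℝ) + 1) * Ring.choose (-1 / 2 : ℝ) (n + 1) =
        (-1 / 2 - n) * Ring.choose (-1 / 2 : ℝ) n := by
      have h0 := Ring.choose_smul_choose (-1 / 2 : ℝ) (Nat.le_succ n)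
      rw [Nat.succ_eq_add_one, Nat.choose_succ_self_right, Nat.add_sub_cancel_left,
        Ring.choose_one_right, nsmul_eq_mul] at h0
      push_cast at h0
      rw [h0, mul_comm]
    have h1 : Ring.choose (-1 / 2 : ℝ) (n + 1) =
        ((-1 / 2 - n) / (n + 1)) * Ring.choose (-1 / 2 : ℝ) n := by
      field_simp
      field_simp at h
      linarith
    rw [h1, abs_mul]
    have h2 : |(-1 / 2 - (n : ℝ)) / (n + 1)| ≤ 1 := by
      rw [abs_div, div_le_one (by positivity), abs_of_neg (by linarith [n.cast_nonneg (α := ℝ)]),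
        abs_of_pos (by positivity)]
      linarith
    exact mul_le_one₀ h2 (abs_nonneg _) ih

/-- The Chu–Vandermonde identity with `-1/2 + -1/2 = -1`: the square of the series is the geometric
series. -/
theorem sum_invSqrtCoeff_mul (n : ℕ) :
    ∑ ij ∈ Finset.HasAntidiagonal.antidiagonal n, invSqrtCoeff ij.1 * invSqrtCoeff ij.2 = 1 := by
  have h := Ring.add_choose_eq (R := ℝ) n (Commute.all (-1 / 2 : ℝ) (-1 / 2))
  have h1 : Ring.choose (-1 / 2 + -1 / 2 : ℝ) n = (-1) ^ n := by
    rw [show (-1 / 2 + -1 / 2 : ℝ) = -1 by norm_num, Ring.choose_neg, add_sub_cancel_left,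
      Ring.choose_natCast, Nat.choose_self, Int.negOnePow_def, Units.smul_def]
    simp
  rw [h1] at h
  calc _ = ∑ ij ∈ Finset.HasAntidiagonal.antidiagonal n, (-1) ^ n *
        (Ring.choose (-1 / 2 : ℝ) ij.1 * Ring.choose (-1 / 2 : ℝ) ij.2) := by
        refine Finset.sum_congr rfl fun ij hij => ?_
        rw [← Finset.HasAntidiagonal.mem_antidiagonal.1 hij, pow_add, invSqrtCoeff, invSqrtCoeff]
        ring
    _ = 1 := by rw [← Finset.mul_sum, ← h, ← mul_pow]; simp

variable {R : Type*} [NormedRing R] [NormedAlgebra ℝ R]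

/-- The sum of the power series of `(1 - y)^(-1/2)`. -/
def invSqrtSum (y : R) : R := ∑' n, invSqrtCoeff n • y ^ n

/-- The constant covers the exponent `0`, because the operator norm on matrices of size zero has
`‖1‖ = 0` and no normalization of `‖1‖` is assumed. -/
theorem norm_pow_le_max_mul (y : R) (n : ℕ) : ‖y ^ n‖ ≤ max 1 ‖(1 : R)‖ * ‖y‖ ^ n := by
  rcases Nat.eq_zero_or_pos n with rfl | hn
  · simp
  · exact (norm_pow_le' y hn).trans
      (le_mul_of_one_le_left (by positivity) (le_max_left _ _))

theorem summable_norm_invSqrt {y : R} (hy : ‖y‖ < 1) :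
    Summable fun n => ‖invSqrtCoeff n • y ^ n‖ := by
  refine Summable.of_nonneg_of_le (fun _ => norm_nonneg _) (fun n => ?_)
    ((summable_geometric_of_lt_one (norm_nonneg y) hy).mul_left (max 1 ‖(1 : R)‖))
  rw [norm_smul, Real.norm_eq_abs]
  exact (mul_le_of_le_one_left (norm_nonneg _) (abs_invSqrtCoeff_le n)).trans
    (norm_pow_le_max_mul y n)

theorem invSqrtSum_zero : invSqrtSum (0 : R) = 1 := by
  rw [invSqrtSum, tsum_eq_single 0 fun n hn => by simp [hn]]
  simp [invSqrtCoeff_zero]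

variable [CompleteSpace R]

theorem invSqrtSum_mul_self {y : R} (hy : ‖y‖ < 1) :
    (1 - y) * (invSqrtSum y * invSqrtSum y) = 1 := by
  have hs := summable_norm_invSqrt hy
  rw [invSqrtSum, tsum_mul_tsum_eq_tsum_sum_antidiagonal_of_summable_norm hs hs]
  have : ∀ n, ∑ kl ∈ Finset.HasAntidiagonal.antidiagonal n, invSqrtCoeff kl.1 • y ^ kl.1 *
      invSqrtCoeff kl.2 • y ^ kl.2 = y ^ n := by
    intro n
    rw [Finset.sum_congr rfl (g := fun kl => (invSqrtCoeff kl.1 * invSqrtCoeff kl.2) • y ^ n),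
      ← Finset.sum_smul, sum_invSqrtCoeff_mul, one_smul]
    intro kl hkl
    rw [smul_mul_smul_comm, ← pow_add, Finset.HasAntidiagonal.mem_antidiagonal.1 hkl]
  simp only [this]
  exact mul_neg_geom_series y (by simpa using hy)

theorem Commute.invSqrtSum_right {a y : R} (h : Commute a y) : Commute a (invSqrtSum y) :=
  Commute.tsum_right a fun n => (h.pow_right n).smul_right _

/-- Bounded coefficients give a power series of radius at least one, analytic on the unit ball. -/
theorem invSqrtSum_contDiffOn : ContDiffOn ℝ ∞ (invSqrtSum : R → R) (Metric.ball 0 1) := by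
  set p := FormalMultilinearSeries.ofScalars R invSqrtCoeff with hp
  have hr : ((1 : NNReal) : ENNReal) ≤ p.radius := by
    refine p.le_radius_of_bound (max 1 ‖p 0‖) fun n => ?_
    rw [NNReal.coe_one, one_pow, mul_one]
    rcases Nat.eq_zero_or_pos n with rfl | hn
    · exact le_max_right _ _
    · exact (FormalMultilinearSeries.ofScalars_norm_le R invSqrtCoeff n hn).trans
        ((abs_invSqrtCoeff_le n).trans (le_max_left _ _))
  have h1 := p.hasFPowerSeriesOnBall (lt_of_lt_of_le (by simp) hr)
  have h2 : (invSqrtSum : R → R) = p.sum := by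
    ext y
    rw [hp]
    exact (FormalMultilinearSeries.ofScalars_sum_eq invSqrtCoeff y).symm
  rw [h2]
  refine (h1.analyticOnNhd.contDiffOn_of_completeSpace).mono ?_
  rw [← NNReal.coe_one, ← Metric.eball_coe]
  exact Metric.eball_subset_eball hr

theorem map_invSqrtSum {S : Type*} [NormedRing S] [NormedAlgebra ℝ S] {φ : R →ₐ[ℝ] S}
    (hφ : Continuous φ) {y : R} (hy : ‖y‖ < 1) : φ (invSqrtSum y) = invSqrtSum (φ y) := by
  rw [invSqrtSum, (summable_norm_invSqrt hy).of_norm.map_tsum φ hφ]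
  simp [invSqrtSum]

/-- A smooth map that sends elements close to an idempotent to idempotents. -/
def idempotentRetract (a : R) : R :=
  (1 / 2 : ℝ) • (1 + (2 * a - 1) * invSqrtSum (1 - (2 * a - 1) * (2 * a - 1)))

variable (R) in
/-- The domain of `idempotentRetract`. -/
def nearIdempotents : Set R := {a | ‖1 - (2 * a - 1) * (2 * a - 1)‖ < 1}

theorem isOpen_nearIdempotents : IsOpen (nearIdempotents R) :=
  isOpen_lt (by fun_prop) continuous_const

theorem idempotent_mem_nearIdempotents {p : R} (hp : p * p = p) : p ∈ nearIdempotents R := by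
  have : (2 * p - 1) * (2 * p - 1) = 1 + 4 * (p * p) - 4 * p := by noncomm_ring
  rw [nearIdempotents, mem_ofPred_eq, this, hp]
  simp

/-- With `t = 2a - 1` and `s = (t²)^(-1/2)`, which commutes with `t`, the product `t s` is an
involution, the sign of `t`. Hence `(1 + t s) / 2` is idempotent. -/
theorem idempotentRetract_mul_self {a : R} (ha : a ∈ nearIdempotents R) :
    idempotentRetract a * idempotentRetract a = idempotentRetract a := by
  set t := 2 * a - 1 with ht
  have hc : Commute t (invSqrtSum (1 - t * t)) :=
    Commute.invSqrtSum_right ((Commute.one_right t).sub_right ((Commute.refl t).mul_right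
      (Commute.refl t)))
  have h1 := invSqrtSum_mul_self ha
  rw [← ht, sub_sub_cancel] at h1
  rw [idempotentRetract, ← ht]
  set s := invSqrtSum (1 - t * t)
  have h2 : (t * s) * (t * s) = 1 := by
    rw [hc.symm.mul_mul_mul_comm]
    exact h1
  rw [smul_mul_smul_comm]
  have h3 : (1 + t * s) * (1 + t * s) = (2 : ℝ) • (1 + t * s) := by
    have : (1 + t * s) * (1 + t * s) = 1 + 2 * (t * s) + (t * s) * (t * s) := by noncomm_ring
    rw [this, h2, two_smul]
    noncomm_ring
  rw [h3, smul_smul]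
  norm_num

theorem idempotentRetract_of_idempotent {p : R} (hp : p * p = p) : idempotentRetract p = p := by
  have : (2 * p - 1) * (2 * p - 1) = 1 + 4 * (p * p) - 4 * p := by noncomm_ring
  rw [idempotentRetract, this, hp]
  have h2 : (1 : R) + (2 * p - 1) * 1 = (2 : ℝ) • p := by rw [two_smul]; noncomm_ring
  rw [add_sub_cancel_right, sub_self, invSqrtSum_zero, h2, smul_smul]
  norm_num

theorem idempotentRetract_contDiffOn :
    ContDiffOn ℝ ∞ (idempotentRetract : R → R) (nearIdempotents R) := by
  have h1 : ContDiff ℝ ∞ (fun a : R => 2 * a - 1) := by fun_prop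
  have h2 : ContDiff ℝ ∞ (fun a : R => 1 - (2 * a - 1) * (2 * a - 1)) := by fun_prop
  have h3 : ContDiffOn ℝ ∞ (fun a : R => invSqrtSum (1 - (2 * a - 1) * (2 * a - 1)))
      (nearIdempotents R) :=
    invSqrtSum_contDiffOn.comp h2.contDiffOn fun a ha => mem_ball_zero_iff.2 ha
  exact (contDiffOn_const.add (h1.contDiffOn.mul h3)).const_smul (1 / 2 : ℝ)

theorem map_idempotentRetract {S : Type*} [NormedRing S] [NormedAlgebra ℝ S] {φ : R →ₐ[ℝ] S}
    (hφ : Continuous φ) {a : R} (ha : a ∈ nearIdempotents R) :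
    φ (idempotentRetract a) = idempotentRetract (φ a) := by
  have h2 : φ (2 * a - 1) = 2 * φ a - 1 := by rw [map_sub, map_mul, map_one, map_ofNat]
  have h3 := map_invSqrtSum hφ ha
  rw [map_sub, map_mul, map_one, h2] at h3
  unfold idempotentRetract
  rw [map_smul φ, map_add, map_mul, map_one, h2, h3]

end InvSqrt

/-! ### Smoothness of Cauchy integrals -/

section CauchySmooth

open Filter Topology

variable {R : Type*} [NormedRing R] [NormedAlgebra ℂ R] [CompleteSpace R]

theorem contDiffOn_ringInverse : ContDiffOn ℝ ∞ (Ring.inverse : R → R) {x | IsUnit x} := by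
  rintro x ⟨u, rfl⟩
  exact (contDiffAt_ringInverse ℝ u).contDiffWithinAt

/-- Cauchy integrals are smooth functions of the algebra element. -/
theorem contDiffOn_integral_resolvent (ℓ : R →L[ℂ] ℂ) {γ c : ℝ → ℂ}
    (hγ : ContinuousOn γ (Icc 0 1)) (hc : ContinuousOn c (Icc 0 1)) :
    IsOpen {M : R | ∀ t ∈ Icc (0 : ℝ) 1, IsUnit (algebraMap ℂ R (γ t) - M)} ∧
    ContDiffOn ℝ ∞ (fun M : R => ∫ t in (0 : ℝ)..1, c t * ℓ (resolvent M (γ t)))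
      {M | ∀ t ∈ Icc (0 : ℝ) 1, IsUnit (algebraMap ℂ R (γ t) - M)} := by
  set J := Icc (0 : ℝ) 1
  have hγJ : Continuous (J.domRestrict γ) := hγ.domRestrict
  have hcJ : Continuous (J.domRestrict c) := hc.domRestrict
  -- All resolvents along the curve are inverted at once: `γ - M` is an element of the Banach
  -- algebra `C(J, R)` depending affinely on `M`. Inversion is smooth there, units are the pointwise
  -- invertible functions, and integration is a bounded functional.
  set g₀ : C(J, R) := ⟨fun t => algebraMap ℂ R (γ t), (algebraMapCLM ℂ R).continuous.comp hγJ⟩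
  set T : R → C(J, R) := fun M => g₀ - ContinuousMap.const J M with hT
  have hTs : ContDiff ℝ ∞ T :=
    contDiff_const.sub (ContinuousLinearMap.const (R := ℝ) (M := R) J).contDiff
  have hset : {M : R | ∀ t ∈ J, IsUnit (algebraMap ℂ R (γ t) - M)} = T ⁻¹' {x | IsUnit x} := by
    ext M
    rw [mem_preimage, mem_ofPred_eq, mem_ofPred_eq, ContinuousMap.isUnit_iff_forall_isUnit]
    exact ⟨fun h t => h t t.2, fun h t ht => h ⟨t, ht⟩⟩
  rw [hset]
  refine ⟨Units.isOpen.preimage hTs.continuous, ?_⟩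
  -- Projecting onto `J` extends functions on `J` continuously to the line, so that interval
  -- integrals apply to them.
  set p : ℝ → J := projIcc 0 1 zero_le_one
  set cJ : C(J, ℂ) := ⟨J.domRestrict c, hcJ⟩
  have hcont : ∀ g : C(J, R), Continuous fun t => cJ (p t) * ℓ (g (p t)) := fun g =>
    (cJ.continuous.comp continuous_projIcc).mul
      (ℓ.continuous.comp (g.continuous.comp continuous_projIcc))
  set L : C(J, R) →L[ℝ] ℂ := LinearMap.mkContinuous
    { toFun := fun g => ∫ t in (0 : ℝ)..1, cJ (p t) * ℓ (g (p t))
      map_add' := fun g h => by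
        rw [← intervalIntegral.integral_add ((hcont g).intervalIntegrable _ _)
          ((hcont h).intervalIntegrable _ _)]
        simp only [ContinuousMap.add_apply, map_add, mul_add]
      map_smul' := fun r g => by
        rw [RingHom.id_apply, ← intervalIntegral.integral_smul]
        refine intervalIntegral.integral_congr fun t _ => ?_
        simp only [ContinuousMap.smul_apply]
        rw [← mul_smul_comm]
        congr 1
        exact ContinuousLinearMap.map_smul_of_tower ℓ r _ } (‖cJ‖ * ‖ℓ‖) (fun g => by
      refine (intervalIntegral.norm_integral_le_of_norm_le_const (C := ‖cJ‖ * ‖ℓ‖ * ‖g‖)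
        fun t _ => ?_).trans (by simp)
      rw [norm_mul, mul_assoc]
      gcongr
      · exact cJ.norm_coe_le_norm _
      · exact (ℓ.le_opNorm _).trans (by gcongr; exact g.norm_coe_le_norm _))
  have hL : ContDiffOn ℝ ∞ (fun M => L (Ring.inverse (T M))) (T ⁻¹' {x | IsUnit x}) :=
    L.contDiff.comp_contDiffOn (contDiffOn_ringInverse.comp hTs.contDiffOn fun M hM => hM)
  refine hL.congr fun M hM => ?_
  change _ = ∫ t in (0 : ℝ)..1, cJ (p t) * ℓ (Ring.inverse (T M) (p t))
  refine intervalIntegral.integral_congr fun t ht => ?_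
  rw [uIcc_of_le zero_le_one] at ht
  have hp : p t = ⟨t, ht⟩ := projIcc_of_mem _ ht
  have h1 : Ring.inverse (T M) ⟨t, ht⟩ = resolvent M (γ t) := by
    obtain ⟨u, hu⟩ : IsUnit (T M) := hM
    set v : Rˣ := ⟨(u : C(J, R)) ⟨t, ht⟩, (↑u⁻¹ : C(J, R)) ⟨t, ht⟩,
      by rw [← ContinuousMap.mul_apply, Units.mul_inv, ContinuousMap.one_apply],
      by rw [← ContinuousMap.mul_apply, Units.inv_mul, ContinuousMap.one_apply]⟩
    have hv : (v : R) = algebraMap ℂ R (γ t) - M := congrArg (fun g : C(J, R) => g ⟨t, ht⟩) hu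
    rw [← hu, Ring.inverse_unit, resolvent, ← hv, Ring.inverse_unit]
    rfl
  change c t * ℓ (resolvent M (γ t)) = cJ (p t) * ℓ (Ring.inverse (T M) (p t))
  rw [hp, h1]
  rfl

end CauchySmooth

/-! ### Characters of the unitization of `C₀` -/

section UnitizationEval

variable {Y : Type*} [TopologicalSpace Y]

/-- Evaluation at a point as a character of the algebra of functions with adjoined unit. -/
def evalUnitization (q : Y) : Unitization ℂ C₀(Y, ℂ) →ₐ[ℂ] ℂ :=
  Unitization.lift
    { toFun := fun b => b q
      map_smul' := fun _ _ => rfl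
      map_zero' := rfl
      map_add' := fun _ _ => rfl
      map_mul' := fun _ _ => rfl }

theorem evalUnitization_apply (q : Y) (x : Unitization ℂ C₀(Y, ℂ)) :
    evalUnitization q x = x.fst + x.snd q := by
  simp [evalUnitization]
  rfl

theorem snd_apply_eq_evalUnitization_sub (q : Y) (x : Unitization ℂ C₀(Y, ℂ)) :
    x.snd q = evalUnitization q x - Unitization.fstHom ℂ C₀(Y, ℂ) x := by
  rw [evalUnitization_apply, Unitization.fstHom_apply, add_sub_cancel_left]

/-- Evaluation is a character of the unitization, and characters take values in the spectrum. -/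
theorem apply_mem_quasispectrum (b : C₀(Y, ℂ)) (q : Y) : b q ∈ quasispectrum ℂ b := by
  rw [Unitization.quasispectrum_eq_spectrum_inr' ℂ ℂ]
  have h := AlgHom.apply_mem_spectrum (evalUnitization q) (b : Unitization ℂ C₀(Y, ℂ))
  rwa [evalUnitization_apply, Unitization.fst_inr, zero_add, Unitization.snd_inr] at h

theorem map_resolvent {R A B : Type*} [CommSemiring R] [Ring A] [Algebra R A] [Ring B] [Algebra R B]
    (φ : A →ₐ[R] B) {a : A} {z : R} (hz : z ∉ spectrum R a) :
    φ (resolvent a z) = resolvent (φ a) z := by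
  obtain ⟨u, hu⟩ := spectrum.notMem_iff.1 hz
  have h : (Units.map (φ : A →* B) u : B) = algebraMap R B z - φ a := by
    rw [Units.coe_map, hu]
    simp
  rw [resolvent, resolvent, ← hu, ← h, Ring.inverse_unit, Ring.inverse_unit]
  rfl

end UnitizationEval

/-! ### Holomorphic functional calculus for Schwartz functions -/

section SchwartzHolomorphic

open Filter Topology
open scoped Matrix.Norms.Operator

variable {EB : Type*} [NormedAddCommGroup EB] [NormedSpace ℝ EB] [FiniteDimensional ℝ EB]
    {HB : Type*} [TopologicalSpace HB] {I : ModelWithCorners ℝ EB HB}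
    {X : Type*} [TopologicalSpace X] [ChartedSpace HB X] [IsManifold I ∞ X]
    {F : Type*} [NormedAddCommGroup F] [NormedSpace ℝ F] [FiniteDimensional ℝ F]
    {E : X → Type*} [∀ x, AddCommGroup (E x)] [∀ x, Module ℝ (E x)]
    [∀ x, TopologicalSpace (E x)]
    [TopologicalSpace (TotalSpace F E)] [FiberBundle F E] [VectorBundle ℝ F E]
    [ContMDiffVectorBundle ∞ F E I]

/-- Lets `h` live on a space such as the matrices with their operator norm instead of on tuples; `L`
is continuous by finite dimension. -/
theorem IsBundleSchwartz.comp_linear_sub {κ : Type*} [Fintype κ] {G : Type*}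
    [NormedAddCommGroup G] [NormedSpace ℝ G] (L : (κ → ℂ) →ₗ[ℝ] G)
    {w : TotalSpace F E → κ → ℂ} {c : κ → ℂ}
    (hw : ∀ i, IsBundleSchwartz I (fun p => w p i - c i)) {Ω : Set G} (hΩ : IsOpen Ω)
    (hcΩ : L c ∈ Ω) (hwΩ : ∀ p, L (w p) ∈ Ω) {h : G → ℂ} (hh : ContDiffOn ℝ ∞ h Ω) :
    IsBundleSchwartz I (fun p => h (L (w p)) - h (L c)) := by
  have hL : Continuous L := L.continuous_of_finiteDimensional
  have hL' : ContDiff ℝ ∞ L := (⟨L, hL⟩ : (κ → ℂ) →L[ℝ] G).contDiff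
  exact IsBundleSchwartz.comp_sub hw (hΩ.preimage hL) hcΩ hwΩ
    (h := fun z => h (L z)) (hh.comp hL'.contDiffOn fun z hz => hz)

/-- Smooth functions of matrices of functions that differ from constants by Schwartz functions. -/
theorem IsBundleSchwartz.comp_matrix {n : ℕ}
    {a : Matrix (Fin n) (Fin n) (Unitization ℂ C₀(TotalSpace F E, ℂ))}
    (ha : ∀ i k, IsBundleSchwartz I (a i k).snd) {Ω : Set (Matrix (Fin n) (Fin n) ℂ)}
    (hΩ : IsOpen Ω) (hcΩ : (Unitization.fstHom ℂ _).mapMatrix a ∈ Ω)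
    (haΩ : ∀ p, (evalUnitization p).mapMatrix a ∈ Ω) {h : Matrix (Fin n) (Fin n) ℂ → ℂ}
    (hh : ContDiffOn ℝ ∞ h Ω) :
    IsBundleSchwartz I (fun p => h ((evalUnitization p).mapMatrix a) -
      h ((Unitization.fstHom ℂ _).mapMatrix a)) := by
  set L : (Fin n × Fin n → ℂ) →ₗ[ℝ] Matrix (Fin n) (Fin n) ℂ :=
    { toFun := fun z => Matrix.of fun i k => z (i, k)
      map_add' := fun _ _ => rfl
      map_smul' := fun _ _ => rfl }
  refine IsBundleSchwartz.comp_linear_sub L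
    (w := fun p ik => evalUnitization p (a ik.1 ik.2))
    (c := fun ik => Unitization.fstHom ℂ _ (a ik.1 ik.2)) (fun ik => ?_) hΩ hcΩ haΩ hh
  refine (congrArg (IsBundleSchwartz I) (funext fun p => ?_)).mp (ha ik.1 ik.2)
  exact snd_apply_eq_evalUnitization_sub p _

/-- A matrix over the unitization of `C₀` whose values are smooth functions of the values of a
matrix of Schwartz functions has entries that differ from constants by Schwartz functions. -/
theorem isBundleSchwartz_snd_of_eval_eq {n : ℕ}
    {a : Matrix (Fin n) (Fin n) (Unitization ℂ C₀(TotalSpace F E, ℂ))}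
    (ha : ∀ i k, IsBundleSchwartz I (a i k).snd) {Ω : Set (Matrix (Fin n) (Fin n) ℂ)}
    (hΩ : IsOpen Ω) (hcΩ : (Unitization.fstHom ℂ _).mapMatrix a ∈ Ω)
    (haΩ : ∀ p, (evalUnitization p).mapMatrix a ∈ Ω) {h : Matrix (Fin n) (Fin n) ℂ → ℂ}
    (hh : ContDiffOn ℝ ∞ h Ω) {x : Unitization ℂ C₀(TotalSpace F E, ℂ)}
    (hx : ∀ p, evalUnitization p x = h ((evalUnitization p).mapMatrix a))
    (hx' : Unitization.fstHom ℂ _ x = h ((Unitization.fstHom ℂ _).mapMatrix a)) :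
    IsBundleSchwartz I x.snd := by
  refine (congrArg (IsBundleSchwartz I) (funext fun p => ?_)).mp
    (IsBundleSchwartz.comp_matrix ha hΩ hcΩ haΩ hh)
  rw [snd_apply_eq_evalUnitization_sub, hx, hx']

/-- Evaluation at a point or at infinity commutes with the integral and with resolvents. Each value
is thus the Cauchy integral of a complex matrix, a fixed smooth function on the open set of matrices
whose spectrum avoids the curve. -/
theorem isBundleSchwartz_cauchy_term {n : ℕ}
    {a : Matrix (Fin n) (Fin n) (Unitization ℂ C₀(TotalSpace F E, ℂ))}
    (ha : ∀ i k, IsBundleSchwartz I (a i k).snd) {U : Set ℂ} {f : ℂ → ℂ} (hf : ContinuousOn f U)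
    {γ : ℝ → ℂ} (hγ : ContDiffOn ℝ 1 γ (Icc 0 1))
    (hmaps : MapsTo γ (Icc 0 1) (U \ spectrum ℂ a)) (i k : Fin n) :
    IsBundleSchwartz I (∫ t in (0 : ℝ)..1,
      (f (γ t) * deriv γ t) • resolvent a (γ t) i k).snd := by
  -- Without integrability the integral is `0` by convention, which is Schwartz.
  by_cases hint : IntervalIntegrable (fun t => (f (γ t) * deriv γ t) • resolvent a (γ t) i k)
    volume 0 1
  swap
  · rw [intervalIntegral.integral_undef hint]
    exact IsBundleSchwartz.zero I
  -- The derivative within the interval is continuous up to the endpoints and agrees with `deriv γ`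
  -- in the interior, so the integral is unchanged.
  set c : ℝ → ℂ := fun t => f (γ t) * derivWithin γ (Icc 0 1) t
  have hc : ContinuousOn c (Icc 0 1) :=
    (hf.comp hγ.continuousOn fun t ht => (hmaps ht).1).mul
      (hγ.continuousOn_derivWithin (uniqueDiffOn_Icc zero_lt_one) le_rfl)
  set ℓ : Matrix (Fin n) (Fin n) ℂ →L[ℂ] ℂ := LinearMap.toContinuousLinearMap
    (Matrix.entryLinearMap ℂ ℂ i k)
  obtain ⟨hΩ, hh⟩ := contDiffOn_integral_resolvent ℓ hγ.continuousOn hc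
  have hunit : ∀ (χ : Unitization ℂ C₀(TotalSpace F E, ℂ) →ₐ[ℂ] ℂ), ∀ t ∈ Icc (0 : ℝ) 1,
      IsUnit (algebraMap ℂ (Matrix (Fin n) (Fin n) ℂ) (γ t) - χ.mapMatrix a) := by
    intro χ t ht
    have h1 := (spectrum.notMem_iff.1 (hmaps ht).2).map χ.mapMatrix
    rwa [map_sub, AlgHom.commutes] at h1
  have hχ : ∀ (χ : Unitization ℂ C₀(TotalSpace F E, ℂ) →ₐ[ℂ] ℂ),
      χ (∫ t in (0 : ℝ)..1, (f (γ t) * deriv γ t) • resolvent a (γ t) i k) =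
      ∫ t in (0 : ℝ)..1, c t * ℓ (resolvent (χ.mapMatrix a) (γ t)) := by
    intro χ
    have h1 := (χ.toContinuousLinearMap).intervalIntegral_comp_comm hint
    refine h1.symm.trans ?_
    refine intervalIntegral.integral_congr_Ioo_of_le zero_le_one fun t ht => ?_
    have ht' := Ioo_subset_Icc_self ht
    have h2 : derivWithin γ (Icc 0 1) t = deriv γ t :=
      derivWithin_of_mem_nhds (Icc_mem_nhds ht.1 ht.2)
    change χ ((f (γ t) * deriv γ t) • resolvent a (γ t) i k) =
      (f (γ t) * derivWithin γ (Icc 0 1) t) * resolvent (χ.mapMatrix a) (γ t) i k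
    rw [map_smul, h2, ← map_resolvent χ.mapMatrix (hmaps ht').2]
    rfl
  exact isBundleSchwartz_snd_of_eval_eq ha hΩ (hunit _) (fun p => hunit _) hh (fun p => hχ _) (hχ _)

theorem isBundleSchwartz_cauchyCalculus {n m : ℕ}
    {a : Matrix (Fin n) (Fin n) (Unitization ℂ C₀(TotalSpace F E, ℂ))}
    (ha : ∀ i k, IsBundleSchwartz I (a i k).snd) {U : Set ℂ} {f : ℂ → ℂ} (hf : ContinuousOn f U)
    {γ : Fin m → ℝ → ℂ} (hγ : IsContour (spectrum ℂ a) U γ) (i k : Fin n) :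
    IsBundleSchwartz I (cauchyCalculus f γ a i k).snd := by
  have h1 : ((∑ j, ∫ t in (0 : ℝ)..1,
      (f (γ j t) * deriv (γ j) t) • resolvent a (γ j t) i k).snd : TotalSpace F E → ℂ) ∈
      bundleSchwartz I F E := by
    have h2 : ((∑ j, ∫ t in (0 : ℝ)..1,
        (f (γ j t) * deriv (γ j) t) • resolvent a (γ j t) i k).snd : TotalSpace F E → ℂ) =
        ∑ j, ((∫ t in (0 : ℝ)..1,
        (f (γ j t) * deriv (γ j) t) • resolvent a (γ j t) i k).snd : TotalSpace F E → ℂ) := by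
      ext p
      have h3 : ∀ x : Unitization ℂ C₀(TotalSpace F E, ℂ), x.snd p =
          (evalUnitization p).toLinearMap x - (Unitization.fstHom ℂ _).toLinearMap x :=
        snd_apply_eq_evalUnitization_sub p
      simp only [Finset.sum_apply, h3, map_sum, Finset.sum_sub_distrib]
    rw [h2]
    exact Submodule.sum_mem _ fun j _ =>
      isBundleSchwartz_cauchy_term ha hf (hγ.contDiffOn j) (hγ.mapsTo j) i k
  exact (bundleSchwartz I F E).smul_mem ((2 * Real.pi * Complex.I)⁻¹) h1

theorem IsBundleSchwartz.comp_holomorphic {g : TotalSpace F E → ℂ} (hg : IsBundleSchwartz I g)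
    {U : Set ℂ} (hU : IsOpen U) (h0U : (0 : ℂ) ∈ U) (hgU : ∀ p, g p ∈ U) {φ : ℂ → ℂ}
    (hφ : DifferentiableOn ℂ φ U) (h0 : φ 0 = 0) : IsBundleSchwartz I (fun p => φ (g p)) :=
  IsBundleSchwartz.comp (κ := Unit) (u := fun p _ => g p) (fun _ => hg)
    (Ω := (fun z => z ()) ⁻¹' U) (hU.preimage (continuous_apply ())) h0U hgU
    (h := fun z => φ (z ())) (((hφ.contDiffOn hU (n := ∞)).restrict_scalars ℝ).comp
      (contDiff_apply ℝ ℂ ()).contDiffOn fun _ hz => hz) h0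

end SchwartzHolomorphic

/-! ### The density theorem for `K₀` -/

section KTheoryDensity

open Filter Topology
open scoped Matrix.Norms.Operator

/-- An approximate equivalence between `e` and `e'` is made exact by correcting `v` with the inverse
`w` of `u v + (1 - e)`. Left invertibility of `v u + (1 - e')` yields the second identity by
cancellation. -/
theorem Matrix.mul_eq_of_mul_isUnit {R : Type*} [Ring R] {n m : ℕ} {e w : Matrix (Fin n) (Fin n) R}
    {e' y : Matrix (Fin m) (Fin m) R} {u : Matrix (Fin n) (Fin m) R} {v : Matrix (Fin m) (Fin n) R}
    (he : e * e = e) (heu : e * u = u) (hue : u * e' = u) (hve : v * e = v)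
    (hev : e' * v = v) (he' : e' * e' = e') (hw : (u * v + (1 - e)) * w = 1)
    (hy : y * (v * u + (1 - e')) = 1) : u * (v * w) = e ∧ (v * w) * u = e' := by
  have h1 : u * (v * w) = e := by
    calc u * (v * w) = e * ((u * v + (1 - e)) * w) := by
          rw [← Matrix.mul_assoc e, Matrix.mul_add, ← Matrix.mul_assoc e u, heu, Matrix.mul_sub,
            Matrix.mul_one, he, sub_self, add_zero, Matrix.mul_assoc]
      _ = e := by rw [hw, Matrix.mul_one]
  refine ⟨h1, ?_⟩
  have h2 : (v * u + (1 - e')) * (v * w * u) = v * u := by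
    have h3 : (1 - e') * (v * w * u) = 0 := by
      rw [Matrix.mul_assoc v, ← Matrix.mul_assoc _ v, Matrix.sub_mul, Matrix.one_mul, hev, sub_self,
        Matrix.zero_mul]
    calc _ = v * (u * (v * w)) * u := by
          rw [Matrix.add_mul, h3, add_zero]
          simp only [Matrix.mul_assoc]
      _ = v * u := by rw [h1, hve]
  have h4 : (v * u + (1 - e')) * e' = v * u := by
    rw [Matrix.add_mul, Matrix.sub_mul, Matrix.one_mul, he', sub_self, add_zero, Matrix.mul_assoc,
      hue]
  calc v * w * u = y * (v * u + (1 - e')) * (v * w * u) := by rw [hy, Matrix.one_mul]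
    _ = y * ((v * u + (1 - e')) * e') := by rw [Matrix.mul_assoc, h2, h4]
    _ = e' := by rw [← Matrix.mul_assoc, hy, Matrix.one_mul]

theorem Matrix.denseRange_map {R S : Type*} [TopologicalSpace S] {j : R → S} (hj : DenseRange j)
    (m n : Type*) : DenseRange (fun M : Matrix m n R => M.map j) :=
  DenseRange.piMap fun _ => DenseRange.piMap fun _ => hj

theorem Matrix.map_mul_injective {R S : Type*} [Ring R] [Ring S] {j : R →+* S}
    (hj : Function.Injective j) {n m l : ℕ} {a : Matrix (Fin n) (Fin m) R}
    {b : Matrix (Fin m) (Fin l) R} {c : Matrix (Fin n) (Fin l) R}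
    (h : a.map j * b.map j = c.map j) : a * b = c :=
  Matrix.map_injective hj (Matrix.map_mul.trans h)

theorem Matrix.completeSpace_linftyOp (n : ℕ) (S : Type*) [NormedRing S] [CompleteSpace S] :
    @CompleteSpace (Matrix (Fin n) (Fin n) S) PseudoMetricSpace.toUniformSpace :=
  Matrix.instCompleteSpace _ _ _

/-- At `(u, v)` the maps `P` and `Q` both take the value `1`, so they remain invertible for nearby
pairs, some of which come from `R`. Compressing such a pair by `e` and `e'` and pulling the inverses
back to `R` gives an exact equivalence. -/
theorem Matrix.exists_mul_eq_of_denseRange {R S : Type*} [Ring R] [NormedRing S]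
    [CompleteSpace S] (j : R →+* S) (hj : Function.Injective j) (hd : DenseRange j)
    (hinv : ∀ (n : ℕ) (x : Matrix (Fin n) (Fin n) R) (y : Matrix (Fin n) (Fin n) S),
      x.map j * y = 1 → y * x.map j = 1 → ∃ z : Matrix (Fin n) (Fin n) R, z.map j = y)
    {n m : ℕ} {e : Matrix (Fin n) (Fin n) R} {e' : Matrix (Fin m) (Fin m) R} (he : e * e = e)
    (he' : e' * e' = e') {u : Matrix (Fin n) (Fin m) S} {v : Matrix (Fin m) (Fin n) S}
    (huv : u * v = e.map j) (hvu : v * u = e'.map j) :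
    ∃ (u' : Matrix (Fin n) (Fin m) R) (v' : Matrix (Fin m) (Fin n) R),
      u' * v' = e ∧ v' * u' = e' := by
  have := Matrix.completeSpace_linftyOp n S
  have := Matrix.completeSpace_linftyOp m S
  have hej : e.map j * e.map j = e.map j := Matrix.map_mul.symm.trans (congrArg (·.map j) he)
  have hej' : e'.map j * e'.map j = e'.map j :=
    Matrix.map_mul.symm.trans (congrArg (·.map j) he')
  set P : Matrix (Fin n) (Fin m) S × Matrix (Fin m) (Fin n) S → Matrix (Fin n) (Fin n) S :=
    fun z => (e.map j * z.1 * e'.map j) * (e'.map j * z.2 * e.map j) + (1 - e.map j) with hP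
  set Q : Matrix (Fin n) (Fin m) S × Matrix (Fin m) (Fin n) S → Matrix (Fin m) (Fin m) S :=
    fun z => (e'.map j * z.2 * e.map j) * (e.map j * z.1 * e'.map j) + (1 - e'.map j) with hQ
  have hPc : Continuous P := by fun_prop
  have hQc : Continuous Q := by fun_prop
  have hP1 : P (u, v) = 1 := by
    have h1 : (e.map j * u * e'.map j) * (e'.map j * v * e.map j) = e.map j := by
      calc _ = e.map j * u * (e'.map j * e'.map j) * v * e.map j := by
            simp only [Matrix.mul_assoc]
        _ = e.map j * (u * v) * (u * v) * e.map j := by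
            rw [hej', ← hvu]; simp only [Matrix.mul_assoc]
        _ = _ := by rw [huv, hej, hej, hej]
    simp [hP, h1]
  have hQ1 : Q (u, v) = 1 := by
    have h1 : (e'.map j * v * e.map j) * (e.map j * u * e'.map j) = e'.map j := by
      calc _ = e'.map j * v * (e.map j * e.map j) * u * e'.map j := by
            simp only [Matrix.mul_assoc]
        _ = e'.map j * (v * u) * (v * u) * e'.map j := by
            rw [hej, ← huv]; simp only [Matrix.mul_assoc]
        _ = _ := by rw [hvu, hej', hej', hej']
    simp [hQ, h1]
  have hPn : ∀ᶠ z in 𝓝 (u, v), IsUnit (P z) :=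
    hPc.continuousAt.eventually (Units.isOpen.mem_nhds (by rw [hP1]; exact isUnit_one))
  have hQn : ∀ᶠ z in 𝓝 (u, v), IsUnit (Q z) :=
    hQc.continuousAt.eventually (Units.isOpen.mem_nhds (by rw [hQ1]; exact isUnit_one))
  obtain ⟨⟨U, V⟩, ⟨x, hx⟩, ⟨y, hy⟩⟩ := ((Matrix.denseRange_map hd (Fin n) (Fin m)).prodMap
    (Matrix.denseRange_map hd (Fin m) (Fin n))).mem_nhds (hPn.and hQn)
  set u' := e * U * e' with hu'
  set v' := e' * V * e with hv'
  have hx' : (u' * v' + (1 - e)).map j = (x : Matrix (Fin n) (Fin n) S) := by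
    rw [hx]
    simp [hP, hu', hv', Matrix.map_mul, Matrix.map_add, Matrix.map_sub]
  have hy' : (v' * u' + (1 - e')).map j = (y : Matrix (Fin m) (Fin m) S) := by
    rw [hy]
    simp [hQ, hu', hv', Matrix.map_mul, Matrix.map_add, Matrix.map_sub]
  obtain ⟨w, hw⟩ := hinv n (u' * v' + (1 - e)) (↑x⁻¹ : Matrix (Fin n) (Fin n) S)
    (by rw [hx', Units.mul_inv]) (by rw [hx', Units.inv_mul])
  obtain ⟨y₀, hy₀⟩ := hinv m (v' * u' + (1 - e')) (↑y⁻¹ : Matrix (Fin m) (Fin m) S)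
    (by rw [hy', Units.mul_inv]) (by rw [hy', Units.inv_mul])
  refine ⟨u', v' * w, Matrix.mul_eq_of_mul_isUnit (y := y₀) he ?_ ?_ ?_ ?_ he' ?_ ?_⟩
  · rw [hu', Matrix.mul_assoc, ← Matrix.mul_assoc e e, he]
  · rw [hu', Matrix.mul_assoc, he']
  · rw [hv', Matrix.mul_assoc, he]
  · rw [hv', Matrix.mul_assoc, ← Matrix.mul_assoc e' e', he']
  · refine Matrix.map_mul_injective hj ?_
    rw [hx', hw, Units.mul_inv, Matrix.map_one _ (map_zero j) (map_one j)]
  · refine Matrix.map_mul_injective hj ?_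
    rw [hy', hy₀, Units.inv_mul, Matrix.map_one _ (map_zero j) (map_one j)]

/-- A dense subring of a Banach algebra that is closed, for matrices of all sizes, under inversion
and under the retraction onto idempotents has the same `K₀`. -/
theorem K0Unital.map_bijective_of_denseRange {R S : Type*} [Ring R] [NormedRing S]
    [NormedAlgebra ℝ S] [CompleteSpace S] (j : R →+* S) (hj : Function.Injective j)
    (hd : DenseRange j)
    (hinv : ∀ (n : ℕ) (x : Matrix (Fin n) (Fin n) R) (y : Matrix (Fin n) (Fin n) S),
      x.map j * y = 1 → y * x.map j = 1 → ∃ z : Matrix (Fin n) (Fin n) R, z.map j = y)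
    (hret : ∀ (n : ℕ) (x : Matrix (Fin n) (Fin n) R), x.map j ∈ nearIdempotents _ →
      ∃ z : Matrix (Fin n) (Fin n) R, z.map j = idempotentRetract (x.map j)) :
    Function.Bijective (K0Unital.map j) := by
  refine K0Unital.map_bijective j ?_ ?_
  · rintro ⟨n, p, hp⟩
    have := Matrix.completeSpace_linftyOp n S
    have hp' : p * p = p := hp
    have hpn := idempotent_mem_nearIdempotents hp'
    have hopen := isOpen_nearIdempotents (R := Matrix (Fin n) (Fin n) S)
    have hr : ContinuousAt (idempotentRetract : Matrix (Fin n) (Fin n) S → _) p :=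
      idempotentRetract_contDiffOn.continuousOn.continuousAt (hopen.mem_nhds hpn)
    -- This quantity vanishes at `a = p`, so for an approximant `a` from `R` its retraction is close
    -- enough to `p` to be equivalent to it; `hret` puts the retraction in `R`.
    have hG : ContinuousAt (fun a => ‖(2 * idempotentRetract a - 1) * (p - idempotentRetract a)‖)
        p :=
      (((continuousAt_const.mul hr).sub continuousAt_const).mul (continuousAt_const.sub hr)).norm
    have hG1 : ∀ᶠ a in 𝓝 p,
        ‖(2 * idempotentRetract a - 1) * (p - idempotentRetract a)‖ < 1 :=
      hG.eventually_lt continuousAt_const (by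
        rw [idempotentRetract_of_idempotent hp', sub_self, mul_zero, norm_zero]
        exact zero_lt_one)
    obtain ⟨a, ha, haG⟩ := (Matrix.denseRange_map hd (Fin n) (Fin n)).mem_nhds
      (Filter.inter_mem (hopen.mem_nhds hpn) hG1)
    obtain ⟨e, he⟩ := hret n a ha
    have hee := idempotentRetract_mul_self ha
    replace haG : ‖(2 * idempotentRetract (a.map j) - 1) * (p - idempotentRetract (a.map j))‖ < 1 :=
      haG
    rw [← he] at hee haG
    refine ⟨⟨n, e, Matrix.map_mul_injective hj hee⟩, ?_⟩
    exact exists_mul_eq_of_idempotent_close hp' hee haG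
  · rintro ⟨n, e, he⟩ ⟨m, e', he'⟩ ⟨u, v, huv, hvu⟩
    exact Matrix.exists_mul_eq_of_denseRange j hj hd hinv he he' huv hvu

end KTheoryDensity

/-! ### `K₀` of the algebra of Schwartz functions -/

section SchwartzKTheory

open Filter Topology
open scoped Matrix.Norms.Operator

theorem norm_mapMatrix_le {n : ℕ} {B : Type*} [NormedRing B] [NormedAlgebra ℂ B] [CompleteSpace B]
    [NormOneClass B] (χ : B →ₐ[ℂ] ℂ) (a : Matrix (Fin n) (Fin n) B) : ‖χ.mapMatrix a‖ ≤ ‖a‖ := by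
  rw [Matrix.linfty_opNorm_def, Matrix.linfty_opNorm_def, NNReal.coe_le_coe]
  refine Finset.sup_mono_fun fun i _ => Finset.sum_le_sum fun k _ => ?_
  exact AlgHom.norm_apply_le_self χ (a i k)

/-- Characters are contractive, also entrywise on matrices, so they preserve the domain of the
retraction and commute with its power series. -/
theorem mapMatrix_idempotentRetract {n : ℕ} {B : Type*} [NormedRing B] [NormedAlgebra ℂ B]
    [CompleteSpace B] [NormOneClass B] (χ : B →ₐ[ℂ] ℂ) {a : Matrix (Fin n) (Fin n) B}
    (ha : a ∈ nearIdempotents (Matrix (Fin n) (Fin n) B)) :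
    χ.mapMatrix a ∈ nearIdempotents (Matrix (Fin n) (Fin n) ℂ) ∧
    χ.mapMatrix (idempotentRetract a) = idempotentRetract (χ.mapMatrix a) := by
  have := Matrix.completeSpace_linftyOp n B
  have h2 : χ.mapMatrix (2 * a - 1) = 2 * χ.mapMatrix a - 1 := by
    rw [map_sub, map_mul, map_one, map_ofNat]
  constructor
  · rw [nearIdempotents, mem_ofPred_eq, ← h2, ← map_mul, ← map_one χ.mapMatrix, ← map_sub]
    exact (norm_mapMatrix_le χ _).trans_lt ha
  · have hc : Continuous (χ.restrictScalars ℝ).mapMatrix :=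
      (AddMonoidHomClass.continuous_of_bound (χ.mapMatrix (m := Fin n)) 1 fun a => by
        rw [one_mul]; exact norm_mapMatrix_le χ a)
    exact map_idempotentRetract (φ := (χ.restrictScalars ℝ).mapMatrix) hc ha

variable {EB : Type*} [NormedAddCommGroup EB] [NormedSpace ℝ EB] [FiniteDimensional ℝ EB]
    {HB : Type*} [TopologicalSpace HB] {I : ModelWithCorners ℝ EB HB}
    {X : Type*} [TopologicalSpace X] [ChartedSpace HB X] [IsManifold I ∞ X] [T2Space X]
    {F : Type*} [NormedAddCommGroup F] [NormedSpace ℝ F] [FiniteDimensional ℝ F]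
    {E : X → Type*} [∀ x, AddCommGroup (E x)] [∀ x, Module ℝ (E x)]
    [∀ x, TopologicalSpace (E x)]
    [TopologicalSpace (TotalSpace F E)] [FiberBundle F E] [VectorBundle ℝ F E]
    [ContMDiffVectorBundle ∞ F E I]
    {A : Type*} [NonUnitalRing A] [Module ℂ A] [IsScalarTower ℂ A A] [SMulCommClass ℂ A A]

theorem unitizationMap_injective {B : Type*} [NonUnitalRing B] [Module ℂ B] [IsScalarTower ℂ B B]
    [SMulCommClass ℂ B B] {ψ : A →ₙₐ[ℂ] B} (hψ : Function.Injective ψ) :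
    Function.Injective (unitizationMap ψ) := by
  intro x y hxy
  refine Unitization.ext ?_ (hψ ?_)
  · rw [← unitizationMap_fst ψ, hxy, unitizationMap_fst]
  · rw [← unitizationMap_snd ψ, hxy, unitizationMap_snd]

theorem exists_unitizationMap_eq {ψ : A →ₙₐ[ℂ] C₀(TotalSpace F E, ℂ)}
    (hψ : ∀ b : C₀(TotalSpace F E, ℂ), (∃ a, ψ a = b) ↔ IsBundleSchwartz I b)
    (y : Unitization ℂ C₀(TotalSpace F E, ℂ)) :
    (∃ z, unitizationMap ψ z = y) ↔ IsBundleSchwartz I y.snd := by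
  rw [← hψ]
  constructor
  · rintro ⟨z, rfl⟩
    exact ⟨z.snd, (unitizationMap_snd ψ z).symm⟩
  · rintro ⟨a, ha⟩
    refine ⟨⟨y.fst, a⟩, Unitization.ext ?_ ?_⟩
    · exact unitizationMap_fst ψ _
    · exact (unitizationMap_snd ψ _).trans ha

theorem exists_map_unitizationMap_eq {ψ : A →ₙₐ[ℂ] C₀(TotalSpace F E, ℂ)}
    (hψ : ∀ b : C₀(TotalSpace F E, ℂ), (∃ a, ψ a = b) ↔ IsBundleSchwartz I b) {n : ℕ}
    {y : Matrix (Fin n) (Fin n) (Unitization ℂ C₀(TotalSpace F E, ℂ))}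
    (hy : ∀ i k, IsBundleSchwartz I (y i k).snd) :
    ∃ z : Matrix (Fin n) (Fin n) (Unitization ℂ A), z.map (unitizationMap ψ) = y := by
  choose z hz using fun i k => (exists_unitizationMap_eq hψ (y i k)).2 (hy i k)
  exact ⟨Matrix.of z, Matrix.ext hz⟩

/-- The scalar part is matched exactly, so only the part in `C₀` has to be approximated. -/
theorem denseRange_unitizationMap {ψ : A →ₙₐ[ℂ] C₀(TotalSpace F E, ℂ)}
    (hψ : ∀ b : C₀(TotalSpace F E, ℂ), (∃ a, ψ a = b) ↔ IsBundleSchwartz I b) :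
    DenseRange (unitizationMap ψ) := by
  intro y
  rw [Metric.mem_closure_range_iff]
  intro ε hε
  obtain ⟨g, hg, hgy⟩ := exists_isBundleSchwartz_norm_sub_lt I y.snd (half_pos hε)
  set b : C₀(TotalSpace F E, ℂ) := ⟨⟨g, hg.continuous⟩, hg.tendsto_cocompact⟩
  obtain ⟨a, ha⟩ := (hψ b).2 hg
  refine ⟨⟨y.fst, a⟩, ?_⟩
  have h1 : y - unitizationMap ψ ⟨y.fst, a⟩ =
      ((y.snd - b : C₀(TotalSpace F E, ℂ)) : Unitization ℂ C₀(TotalSpace F E, ℂ)) := by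
    refine Unitization.ext ?_ ?_
    · change y.fst - (unitizationMap ψ ⟨y.fst, a⟩).fst = 0
      rw [unitizationMap_fst]
      exact sub_self _
    · change y.snd - (unitizationMap ψ ⟨y.fst, a⟩).snd = y.snd - b
      rw [unitizationMap_snd, ← ha]
  rw [dist_eq_norm, h1, Unitization.norm_inr]
  refine lt_of_le_of_lt ?_ (half_lt_self hε)
  rw [← ZeroAtInftyContinuousMap.norm_toBCF_eq_norm,
    BoundedContinuousFunction.norm_le (half_pos hε).le]
  intro p
  exact (norm_sub_rev _ _).trans_le (hgy p).le

/-- An algebra of Schwartz functions on a vector bundle has the same `K₀` as the algebra of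
continuous functions that vanish at infinity. -/
theorem K0.map_bijective_of_schwartz {ψ : A →ₙₐ[ℂ] C₀(TotalSpace F E, ℂ)}
    (hinj : Function.Injective ψ)
    (hψ : ∀ b : C₀(TotalSpace F E, ℂ), (∃ a, ψ a = b) ↔ IsBundleSchwartz I b) :
    Function.Bijective (K0.map ψ) := by
  refine K0.map_bijective ψ (K0Unital.map_bijective_of_denseRange _
    (unitizationMap_injective hinj) (denseRange_unitizationMap hψ) ?_ ?_)
  · intro n x y hxy hyx
    refine exists_map_unitizationMap_eq hψ fun i k => ?_
    set a := x.map (unitizationMap ψ : Unitization ℂ A →+* Unitization ℂ C₀(TotalSpace F E, ℂ))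
    have ha : ∀ i k, IsBundleSchwartz I (a i k).snd := fun i k =>
      (exists_unitizationMap_eq hψ _).1 ⟨x i k, rfl⟩
    set ℓ : Matrix (Fin n) (Fin n) ℂ →L[ℝ] ℂ := LinearMap.toContinuousLinearMap
      (Matrix.entryLinearMap ℝ ℂ i k)
    -- The values of `y` at all points and at infinity are the inverses of those of `a`, and
    -- inversion is smooth on the open set of invertible complex matrices.
    have hu : ∀ χ : Unitization ℂ C₀(TotalSpace F E, ℂ) →ₐ[ℂ] ℂ,
        IsUnit (χ.mapMatrix a) ∧ χ.mapMatrix y = Ring.inverse (χ.mapMatrix a) := by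
      intro χ
      have h1 : χ.mapMatrix a * χ.mapMatrix y = 1 := by rw [← map_mul, hxy, map_one]
      have h2 : χ.mapMatrix y * χ.mapMatrix a = 1 := by rw [← map_mul, hyx, map_one]
      exact ⟨⟨⟨_, _, h1, h2⟩, rfl⟩,
        (Ring.inverse_unit (⟨_, _, h1, h2⟩ : (Matrix (Fin n) (Fin n) ℂ)ˣ)).symm⟩
    have := Matrix.completeSpace_linftyOp n ℂ
    exact isBundleSchwartz_snd_of_eval_eq ha Units.isOpen (hu _).1 (fun p => (hu _).1)
      (ℓ.contDiff.comp_contDiffOn contDiffOn_ringInverse)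
      (fun p => congrArg (fun M => M i k) (hu (evalUnitization p)).2)
      (congrArg (fun M => M i k) (hu (Unitization.fstHom ℂ _)).2)
  · intro n x hx
    refine exists_map_unitizationMap_eq hψ fun i k => ?_
    set a := x.map (unitizationMap ψ : Unitization ℂ A →+* Unitization ℂ C₀(TotalSpace F E, ℂ))
    have ha : ∀ i k, IsBundleSchwartz I (a i k).snd := fun i k =>
      (exists_unitizationMap_eq hψ _).1 ⟨x i k, rfl⟩
    set ℓ : Matrix (Fin n) (Fin n) ℂ →L[ℝ] ℂ := LinearMap.toContinuousLinearMap
      (Matrix.entryLinearMap ℝ ℂ i k)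
    have hu := fun χ : Unitization ℂ C₀(TotalSpace F E, ℂ) →ₐ[ℂ] ℂ =>
      mapMatrix_idempotentRetract χ hx
    have := Matrix.completeSpace_linftyOp n ℂ
    exact isBundleSchwartz_snd_of_eval_eq ha isOpen_nearIdempotents (hu _).1 (fun p => (hu _).1)
      (ℓ.contDiff.comp_contDiffOn idempotentRetract_contDiffOn)
      (fun p => congrArg (fun M => M i k) (hu (evalUnitization p)).2)
      (congrArg (fun M => M i k) (hu (Unitization.fstHom ℂ _)).2)

end SchwartzKTheory

/-! ### The Fourier transform as an isomorphism of algebras -/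

section FourierHom

variable {EB : Type*} [NormedAddCommGroup EB] [NormedSpace ℝ EB] [FiniteDimensional ℝ EB]
    {HB : Type*} [TopologicalSpace HB] {I : ModelWithCorners ℝ EB HB}
    {X : Type*} [TopologicalSpace X] [ChartedSpace HB X] [IsManifold I ∞ X]
    {F : Type*} [NormedAddCommGroup F] [NormedSpace ℝ F] [FiniteDimensional ℝ F]
    [MeasurableSpace F] [BorelSpace F]
    {E : X → Type*} [∀ x, AddCommGroup (E x)] [∀ x, Module ℝ (E x)]
    [∀ x, TopologicalSpace (E x)] [∀ x, IsTopologicalAddGroup (E x)]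
    [∀ x, ContinuousSMul ℝ (E x)] [∀ x, MeasurableSpace (E x)] [∀ x, BorelSpace (E x)]
    [TopologicalSpace (TotalSpace F E)] [FiberBundle F E] [VectorBundle ℝ F E]
    [ContMDiffVectorBundle ∞ F E I]
    {μ : ∀ x, Measure (E x)}

theorem IsBundleSchwartz.integrable_fourier (hμ : IsSmoothHaarSystem I F μ)
    {f : TotalSpace F E → ℂ} (hf : IsBundleSchwartz I f) {x : X} (ζ : E x →L[ℝ] ℝ) :
    Integrable (fun v => Complex.exp (-Complex.I * (ζ v : ℂ)) * f ⟨x, v⟩) (μ x) := by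
  obtain ⟨-, h, -⟩ := hf.fibre hμ x
  refine h.bdd_mul (c := 1) ?_ (.of_forall fun v => (norm_exp_neg_I_mul _).le)
  exact Continuous.aestronglyMeasurable (by fun_prop)

theorem bundleFourier_add (hμ : IsSmoothHaarSystem I F μ) {f g : TotalSpace F E → ℂ}
    (hf : IsBundleSchwartz I f) (hg : IsBundleSchwartz I g) :
    bundleFourier μ (f + g) = bundleFourier μ f + bundleFourier μ g := by
  funext ⟨x, ζ⟩
  refine Eq.trans ?_ (integral_add (hf.integrable_fourier hμ ζ) (hg.integrable_fourier hμ ζ))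
  exact integral_congr_ae (.of_forall fun v => mul_add _ _ _)

theorem bundleFourier_smul (c : ℂ) (f : TotalSpace F E → ℂ) :
    bundleFourier μ (c • f) = c • bundleFourier μ f := by
  funext ⟨x, ζ⟩
  refine Eq.trans ?_ (integral_smul c _)
  exact integral_congr_ae (.of_forall fun v => mul_smul_comm c _ _)

/-- The fibrewise Fourier transform as a homomorphism of algebras. -/
def bundleFourierHom (hμ : IsSmoothHaarSystem I F μ) :
    BundleConvAlgebra (isConvolutionAlgebra hμ) →ₙₐ[ℂ]
      bundleSchwartzPointwise I (F →L[ℝ] ℝ) (DualBundle E) where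
  toFun f := ⟨bundleFourier μ f.toFun, bundleFourier_mem hμ f.2⟩
  map_smul' c f := Subtype.ext (bundleFourier_smul c f.toFun)
  map_zero' := Subtype.ext <| by
    have h := bundleFourier_smul (μ := μ) 0 (0 : TotalSpace F E → ℂ)
    rw [zero_smul, zero_smul] at h
    exact h
  map_add' f g := Subtype.ext (bundleFourier_add hμ f.2 g.2)
  map_mul' f g := Subtype.ext (bundleConv_fourier hμ f.2 g.2).2.2

theorem bundleFourierHom_bijective (hμ : IsSmoothHaarSystem I F μ) :
    Function.Bijective (bundleFourierHom hμ) := by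
  refine ⟨fun f g h => Subtype.ext ?_, fun H => ?_⟩
  · exact bundleFourier_injective hμ f.2 g.2 (congrArg Subtype.val h)
  · obtain ⟨f, hf, hfH⟩ := exists_bundleFourier_eq hμ H.2
    exact ⟨⟨f, hf⟩, Subtype.ext hfH⟩

end FourierHom

/-! ### The inclusion of the Schwartz functions into `C₀` -/

section SchwartzInclusion

variable {EB : Type*} [NormedAddCommGroup EB] [NormedSpace ℝ EB] [FiniteDimensional ℝ EB]
    {HB : Type*} [TopologicalSpace HB] (I : ModelWithCorners ℝ EB HB)
    {X : Type*} [TopologicalSpace X] [ChartedSpace HB X] [IsManifold I ∞ X]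
    (F : Type*) [NormedAddCommGroup F] [NormedSpace ℝ F] [FiniteDimensional ℝ F]
    (E : X → Type*) [∀ x, AddCommGroup (E x)] [∀ x, Module ℝ (E x)]
    [∀ x, TopologicalSpace (E x)]
    [TopologicalSpace (TotalSpace F E)] [FiberBundle F E] [VectorBundle ℝ F E]
    [ContMDiffVectorBundle ∞ F E I]

/-- Schwartz functions are continuous functions vanishing at infinity. -/
def schwartzToZeroAtInfty : bundleSchwartzPointwise I F E →ₙₐ[ℂ] C₀(TotalSpace F E, ℂ) where
  toFun g := ⟨⟨g.1, IsBundleSchwartz.continuous (I := I) g.2⟩,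
    IsBundleSchwartz.tendsto_cocompact (I := I) g.2⟩
  map_smul' _ _ := rfl
  map_zero' := rfl
  map_add' _ _ := rfl
  map_mul' _ _ := rfl

theorem exists_schwartzToZeroAtInfty_eq (b : C₀(TotalSpace F E, ℂ)) :
    (∃ g, schwartzToZeroAtInfty I F E g = b) ↔ IsBundleSchwartz I b := by
  constructor
  · rintro ⟨g, rfl⟩
    exact g.2
  · intro hb
    exact ⟨⟨b, hb⟩, rfl⟩

theorem schwartzToZeroAtInfty_injective :
    Function.Injective (schwartzToZeroAtInfty I F E) := fun _ _ h =>
  Subtype.ext (congrArg (fun b : C₀(TotalSpace F E, ℂ) => (b : TotalSpace F E → ℂ)) h)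

end SchwartzInclusion

end

theorem mainTheorem9
    {EB : Type*} [NormedAddCommGroup EB] [NormedSpace ℝ EB] [FiniteDimensional ℝ EB]
    {HB : Type*} [TopologicalSpace HB] (I : ModelWithCorners ℝ EB HB)
    {X : Type*} [TopologicalSpace X] [ChartedSpace HB X] [IsManifold I ∞ X]
    [T2Space X] [SigmaCompactSpace X]
    (F : Type*) [NormedAddCommGroup F] [NormedSpace ℝ F] [FiniteDimensional ℝ F]
    [MeasurableSpace F] [BorelSpace F]
    (E : X → Type*) [∀ x, AddCommGroup (E x)] [∀ x, Module ℝ (E x)]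
    [∀ x, TopologicalSpace (E x)] [∀ x, IsTopologicalAddGroup (E x)]
    [∀ x, ContinuousSMul ℝ (E x)] [∀ x, MeasurableSpace (E x)] [∀ x, BorelSpace (E x)]
    [TopologicalSpace (TotalSpace F E)] [FiberBundle F E] [VectorBundle ℝ F E]
    [ContMDiffVectorBundle ∞ F E I]
    (μ : ∀ x, Measure (E x)) (hμ : IsSmoothHaarSystem I F μ) :
    ∃ (h : IsConvolutionAlgebra (F := F) I μ)
      (Φ : BundleConvAlgebra h →ₙₐ[ℂ] bundleSchwartzPointwise I (F →L[ℝ] ℝ) (DualBundle E))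
      (ι : bundleSchwartzPointwise I (F →L[ℝ] ℝ) (DualBundle E) →ₙₐ[ℂ]
        C₀(TotalSpace (F →L[ℝ] ℝ) (DualBundle E), ℂ)),
      -- the fibrewise Fourier transform is an isomorphism from `(𝒮(E), *)` onto `(𝒮(E^*), ·)`
      (∀ f : BundleConvAlgebra h, (Φ f : TotalSpace (F →L[ℝ] ℝ) (DualBundle E) → ℂ) =
        bundleFourier μ f.toFun) ∧
      Function.Bijective Φ ∧
      -- `𝒮(E^*)` is contained in `C₀(E^*)`
      (∀ g, ⇑(ι g) = (g : TotalSpace (F →L[ℝ] ℝ) (DualBundle E) → ℂ)) ∧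
      -- through these maps `𝒮(E)` is stable under holomorphic functional calculus in `C₀(E^*)`
      IsStableUnderHolomorphicCalculus (NonUnitalAlgHom.range (ι.comp Φ)) ∧
      (∀ (g : BundleConvAlgebra h) (U : Set ℂ) (φ : ℂ → ℂ), IsOpen U →
        quasispectrum ℂ (ι (Φ g)) ⊆ U → DifferentiableOn ℂ φ U → φ 0 = 0 →
        ∃ g' : BundleConvAlgebra h, ∀ q, ι (Φ g') q = φ (ι (Φ g) q)) ∧
      -- and the induced map `K₀(𝒮(E)) → K₀(C₀(E^*)) = K⁰(E^*)` is an isomorphism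
      Function.Bijective (K0.map (ι.comp Φ)) := by
  -- The image of the composite is exactly the set of Schwartz elements of `C₀(E^*)`; stability and
  -- the `K₀` statement concern only this set and injectivity.
  have hrange : ∀ b : C₀(TotalSpace (F →L[ℝ] ℝ) (DualBundle E), ℂ),
      (∃ f, ((schwartzToZeroAtInfty I (F →L[ℝ] ℝ) (DualBundle E)).comp (bundleFourierHom hμ)) f = b) ↔
        IsBundleSchwartz I b := by
    intro b
    rw [← exists_schwartzToZeroAtInfty_eq]
    exact ⟨fun ⟨f, hf⟩ => ⟨_, hf⟩, fun ⟨g, hg⟩ =>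
      ((bundleFourierHom_bijective hμ).2 g).imp fun f hf => by rw [← hg, ← hf]; rfl⟩
  refine ⟨isConvolutionAlgebra hμ, bundleFourierHom hμ,
    schwartzToZeroAtInfty I (F →L[ℝ] ℝ) (DualBundle E), fun _ => rfl,
    bundleFourierHom_bijective hμ, fun _ => rfl, ?_, ?_, ?_⟩
  · intro n a ha U _ _ f hf m γ hγ i k
    refine (hrange _).2 (isBundleSchwartz_cauchyCalculus (fun i k => ?_) hf.continuousOn hγ i k)
    exact (hrange _).1 (ha i k)
  · intro g U φ hU hgU hφ h0
    set b := schwartzToZeroAtInfty I (F →L[ℝ] ℝ) (DualBundle E) (bundleFourierHom hμ g)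
    have hb : IsBundleSchwartz I b := (hrange b).1 ⟨g, rfl⟩
    -- The quasispectrum contains `0` and every value of `b`, so `U` does as well.
    have hφb := hb.comp_holomorphic hU (hgU (quasispectrum.zero_mem ℂ b))
      (fun p => hgU (apply_mem_quasispectrum b p)) hφ h0
    obtain ⟨g', hg'⟩ := (hrange ⟨⟨_, hφb.continuous⟩, hφb.tendsto_cocompact⟩).2 hφb
    refine ⟨g', fun q => ?_⟩
    exact congrArg (fun c : C₀(TotalSpace (F →L[ℝ] ℝ) (DualBundle E), ℂ) => c q) hg'
  · exact K0.map_bijective_of_schwartz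
      ((schwartzToZeroAtInfty_injective I _ _).comp (bundleFourierHom_bijective hμ).1) hrange
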